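/- Let $S$ be a scheme, let $G$ be a group scheme over $S$ with multiplication $m$, and let $F$ be a commutative group scheme over $S$ (written multiplicatively) that is affine, flat and locally of finite presentation over $S$. For an $S$-scheme $X$, let $\mathrm{H}^1(X_{\mathrm{fppf}},F)$ be the group of isomorphism classes of $F$-torsors on $X_{\mathrm{fppf}}$ under the contracted product $\otimes$; write $T^\vee$ for the dual of a torsor $T$ and $F_X$ for the trivial torsor. Number the factors of $G^k=G\times_S\cdots\times_S G$ by $0,\dots,k-1$, and let $p_0,p_1\colon G^2\to G$ be the projections. Let $p_{0,1},p_{1,2},m_{0,1},m_{1,2}\colon G^3\to G^2$ send $(g_0,g_1,g_2)$ to $(g_0,g_1)$, $(g_1,g_2)$, $(g_0g_1,g_2)$, $(g_0,g_1g_2)$, respectively. Let $\mathrm{HH}^2(G,F)=\ker d^2/\operatorname{im}d^1$ and $\mathrm{HH}^3(G,F)=\ker d^3/\operatorname{im}d^2$, where $d^i\colon F(G^i)\to F(G^{i+1})$ are the Hochschild differentials $$d^1x=(p_1^*x)(m^*x)^{-1}(p_0^*x),\qquad d^2x=(p_{1,2}^*x)(m_{0,1}^*x)^{-1}(m_{1,2}^*x)(p_{0,1}^*x)^{-1},$$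 $$(d^3x)(g_0,g_1,g_2,g_3)=x(g_1,g_2,g_3)\,x(g_0g_1,g_2,g_3)^{-1}\,x(g_0,g_1g_2,g_3)\,x(g_0,g_1,g_2g_3)^{-1}\,x(g_0,g_1,g_2).$$ For an $F$-torsor $T$ on $G$ and an $F$-torsor $P$ on $G^2$, put $$\delta^1T=p_1^*T\otimes(m^*T)^\vee\otimes p_0^*T,\qquad \delta^2P=p_{1,2}^*P\otimes(m_{0,1}^*P)^\vee\otimes m_{1,2}^*P\otimes(p_{0,1}^*P)^\vee .$$ There are canonical isomorphisms $\tau_0\colon F_{G^2}\cong\delta^1F_G$, $F_{G^3}\cong\delta^2F_{G^2}$ and, because every factor occurs together with its dual, $\kappa_T\colon F_{G^3}\cong\delta^2(\delta^1T)$. Let $K(G,F)$ be the kernel of the homomorphism $\mathrm{H}^1(G_{\mathrm{fppf}},F)\to \mathrm{H}^1(G^2_{\mathrm{fppf}},F)$ induced by $\delta^1$. Let $\mathrm{Ext}_S(G,F)$ be the group, under the Baer sum, of isomorphism classes of central extensions $1\to F\to E\to G\to1$ of sheaves of groups on $S_{\mathrm{fppf}}$. Such an $E$ is an $F$-torsor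 on $G$, and its multiplication gives a trivialisation $\tau_E\colon F_{G^2}\cong\delta^1E$ whose value over the image of $(e_0,e_1)$ in $G^2$ is $e_1\otimes(e_0e_1)^\vee\otimes e_0$. Then there are group homomorphisms forming an exact sequence $$1\longrightarrow \mathrm{HH}^2(G,F)\stackrel{\alpha}{\longrightarrow}\mathrm{Ext}_S(G,F)\stackrel{\beta}{\longrightarrow}K(G,F)\stackrel{\xi_{G,F}}{\longrightarrow}\mathrm{HH}^3(G,F)$$ with the following descriptions. * For $u\in F(G^2)$ with $d^2u=1$, $\alpha$ sends the class of $u$ to the class of the extensions $E$ for which there is an isomorphism of torsors $E\cong F_G$ carrying $\tau_E$ to the composition of multiplication by $u$ on $F_{G^2}$ with $\tau_0$. * $\beta$ sends the class of an extension $E$ to the class of the $F$-torsor $E$ on $G$. * Let $T$ be an $F$-torsor on $G$ such that $\delta^1T$ is trivial. For every trivialisation $\tau\colon F_{G^2}\cong\delta^1T$, let $u_\tau\in F(G^3)$ be the element such that the composition $$F_{G^3}\cong\delta^2F_{G^2}\xrightarrow{\delta^2\tau}\delta^2(\delta^1T)\xrightarrow{\kappa_T^{-1}}F_{G^3}$$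 is multiplication by $u_\tau$. Then $d^3u_\tau=1$, and $\xi_{G,F}$ sends the class of $T$ to the class of $u_\tau$ in $\mathrm{HH}^3(G,F)$. -/

import Mathlib

set_option linter.unusedVariables false
set_option linter.unusedSectionVars false

open CategoryTheory MonoidalCategory CartesianMonoidalCategory Opposite
open scoped MonObj

universe v u w

namespace TorsExt

noncomputable section

variable {C : Type u} [Category.{v} C]

/-- Restriction of a section of a presheaf of sets. -/
def res {P : Cᵒᵖ ⥤ Type w} {Y Z : C} (h : Z ⟶ Y) (s : P.obj (op Y)) : P.obj (op Z) :=
  P.map h.op s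

lemma res_id {P : Cᵒᵖ ⥤ Type w} {Y : C} (s : P.obj (op Y)) : res (𝟙 Y) s = s := by
  simp [res]

lemma res_res {P : Cᵒᵖ ⥤ Type w} {Y Z W : C} (k : W ⟶ Z) (h : Z ⟶ Y) (s : P.obj (op Y)) :
    res k (res h s) = res (k ≫ h) s := by
  simp [res]

section Sheaf

variable {J : GrothendieckTopology C}

lemma sheaf_ext {P : Cᵒᵖ ⥤ Type w} (hP : Presieve.IsSheaf J P) {Y : C} {R : Sieve Y}
    (hR : R ∈ J Y) {s t : P.obj (op Y)}
    (h : ∀ ⦃Z : C⦄ (k : Z ⟶ Y), R k → res k s = res k t) : s = t :=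
  (hP R hR).isSeparatedFor.ext fun _ k hk => h k hk

lemma sheaf_glue {P : Cᵒᵖ ⥤ Type w} (hP : Presieve.IsSheaf J P) {Y : C}
    (R : ∀ ⦃Z : C⦄, (Z ⟶ Y) → P.obj (op Z) → Prop)
    (hres : ∀ ⦃Z W : C⦄ (h : Z ⟶ Y) (k : W ⟶ Z) (p : P.obj (op Z)),
      R h p → R (k ≫ h) (res k p))
    (huniq : ∀ ⦃Z : C⦄ (h : Z ⟶ Y) (p p' : P.obj (op Z)), R h p → R h p' → p = p')
    {A : Sieve Y} (hA : A ∈ J Y) (hex : ∀ ⦃Z : C⦄ (h : Z ⟶ Y), A h → ∃ p, R h p) :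
    ∃ p : P.obj (op Y), ∀ ⦃Z : C⦄ (h : Z ⟶ Y) (p' : P.obj (op Z)), R h p' → res h p = p' := by
  choose x hx using hex
  have hc : Presieve.FamilyOfElements.Compatible (P := P) (R := A.arrows) x := by
    refine (Presieve.compatible_iff_sieveCompatible _).2 fun Z W f g hf => ?_
    exact huniq _ _ _ (hx _ _) (hres _ _ _ (hx f hf))
  obtain ⟨p, hp, -⟩ := hP A hA x hc
  refine ⟨p, fun Z h p' hp' => ?_⟩
  refine sheaf_ext hP (J.pullback_stable h hA) fun W k hk => ?_
  rw [res_res]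
  exact (hp (k ≫ h) hk).trans (huniq _ _ _ (hx _ hk) (hres _ _ _ hp'))

lemma isSheaf_mk {P : Cᵒᵖ ⥤ Type w}
    (hsep : ∀ ⦃Y : C⦄ (R : Sieve Y), R ∈ J Y → ∀ s t : P.obj (op Y),
      (∀ ⦃Z : C⦄ (k : Z ⟶ Y), R k → res k s = res k t) → s = t)
    (hglue : ∀ ⦃Y : C⦄ (R : Sieve Y), R ∈ J Y →
      ∀ x : (∀ ⦃Z : C⦄ (k : Z ⟶ Y), R k → P.obj (op Z)),
      (∀ ⦃Z W : C⦄ (k : Z ⟶ Y) (l : W ⟶ Z) (hk : R k) (hlk : R (l ≫ k)),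
        x (l ≫ k) hlk = res l (x k hk)) →
      ∃ s : P.obj (op Y), ∀ ⦃Z : C⦄ (k : Z ⟶ Y) (hk : R k), res k s = x k hk) :
    Presieve.IsSheaf J P := by
  intro Y R hR x hx
  rw [Presieve.compatible_iff_sieveCompatible] at hx
  obtain ⟨s, hs⟩ := hglue R hR x fun Z W k l hk _ => hx k l hk
  refine ⟨s, fun Z k hk => hs k hk, fun t ht => hsep R hR _ _ fun Z k hk => ?_⟩
  exact (ht k hk).trans (hs k hk).symm

variable [J.Subcanonical]

lemma hom_isSheaf (J : GrothendieckTopology C) [J.Subcanonical] (X : C) :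
    Presieve.IsSheaf J (yoneda.obj X) :=
  GrothendieckTopology.Subcanonical.isSheaf_of_isRepresentable _

lemma hom_ext {X Y : C} {R : Sieve Y} (hR : R ∈ J Y) {a b : Y ⟶ X}
    (h : ∀ ⦃Z : C⦄ (k : Z ⟶ Y), R k → k ≫ a = k ≫ b) : a = b :=
  sheaf_ext (P := yoneda.obj X) (hom_isSheaf J X) hR h

lemma hom_glue {X Y : C}
    (R : ∀ ⦃Z : C⦄, (Z ⟶ Y) → (Z ⟶ X) → Prop)
    (hres : ∀ ⦃Z W : C⦄ (h : Z ⟶ Y) (k : W ⟶ Z) (p : Z ⟶ X), R h p → R (k ≫ h) (k ≫ p))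
    (huniq : ∀ ⦃Z : C⦄ (h : Z ⟶ Y) (p p' : Z ⟶ X), R h p → R h p' → p = p')
    {A : Sieve Y} (hA : A ∈ J Y) (hex : ∀ ⦃Z : C⦄ (h : Z ⟶ Y), A h → ∃ p, R h p) :
    ∃ p : Y ⟶ X, ∀ ⦃Z : C⦄ (h : Z ⟶ Y) (p' : Z ⟶ X), R h p' → h ≫ p = p' :=
  sheaf_glue (P := yoneda.obj X) (hom_isSheaf J X) R hres huniq hA hex

end Sheaf

variable [CartesianMonoidalCategory C] [BraidedCategory C]

/-- An `F`-torsor over `X` on the site `(C, J)`, given by its total space: a sheaf `sec` on `C`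
with a map `proj` to (the sheaf represented by) `X` and an action of `F` preserving `proj`, such
that `F` acts simply transitively on the sections lying over any given point of `X`, and such that
`proj` has sections locally. Equivalently, the sheaf on the localised site over `X` whose
sections on `g : Y ⟶ X` are the `t ∈ sec Y` with `proj t = g`. -/
structure Torsor (J : GrothendieckTopology C) (F : C) [GrpObj F] [IsCommMonObj F] (X : C) where
  sec : Cᵒᵖ ⥤ Type (max u v)
  isSheaf : Presieve.IsSheaf J sec
  proj : ∀ {Y : C}, sec.obj (op Y) → (Y ⟶ X)
  proj_res : ∀ {Y Z : C} (h : Z ⟶ Y) (t : sec.obj (op Y)), proj (res h t) = h ≫ proj t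
  act : ∀ {Y : C}, (Y ⟶ F) → sec.obj (op Y) → sec.obj (op Y)
  one_act : ∀ {Y : C} (t : sec.obj (op Y)), act 1 t = t
  mul_act : ∀ {Y : C} (f g : Y ⟶ F) (t : sec.obj (op Y)), act (f * g) t = act f (act g t)
  res_act : ∀ {Y Z : C} (h : Z ⟶ Y) (f : Y ⟶ F) (t : sec.obj (op Y)),
    res h (act f t) = act (h ≫ f) (res h t)
  proj_act : ∀ {Y : C} (f : Y ⟶ F) (t : sec.obj (op Y)), proj (act f t) = proj t
  simply_transitive : ∀ {Y : C} (t t' : sec.obj (op Y)), proj t = proj t' → ∃! f, act f t = t'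
  locally_nonempty : ∀ {Y : C} (g : Y ⟶ X), ∃ R ∈ J Y, ∀ ⦃Z : C⦄ (k : Z ⟶ Y), R k →
    ∃ t : sec.obj (op Z), proj t = k ≫ g

namespace Torsor

variable {J : GrothendieckTopology C} {F : C} [GrpObj F] [IsCommMonObj F] {X : C}

/-- Sections over `Y` of the total space of a torsor. -/
abbrev At (T : Torsor J F X) (Y : C) : Type (max u v) := T.sec.obj (op Y)

lemma exists_act (T : Torsor J F X) {Y : C} {t t' : T.At Y} (h : T.proj t = T.proj t') :
    ∃ f, t' = T.act f t := by
  obtain ⟨f, hf, -⟩ := T.simply_transitive t t' h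
  exact ⟨f, hf.symm⟩

lemma act_inj (T : Torsor J F X) {Y : C} {t : T.At Y} {f g : Y ⟶ F}
    (h : T.act f t = T.act g t) : f = g :=
  (T.simply_transitive t (T.act g t) (T.proj_act g t).symm).unique h rfl

lemma act_inv_act (T : Torsor J F X) {Y : C} (f : Y ⟶ F) (t : T.At Y) :
    T.act f⁻¹ (T.act f t) = t := by
  rw [← T.mul_act, inv_mul_cancel, T.one_act]

lemma act_act_inv (T : Torsor J F X) {Y : C} (f : Y ⟶ F) (t : T.At Y) :
    T.act f (T.act f⁻¹ t) = t := by
  rw [← T.mul_act, mul_inv_cancel, T.one_act]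

lemma act_comm (T : Torsor J F X) {Y : C} (f g : Y ⟶ F) (t : T.At Y) :
    T.act f (T.act g t) = T.act g (T.act f t) := by
  rw [← T.mul_act, mul_comm, T.mul_act]

/-- Isomorphisms of `F`-torsors over `X`. -/
structure Iso (T T' : Torsor J F X) where
  toEquiv : ∀ {Y : C}, T.At Y ≃ T'.At Y
  res_toEquiv : ∀ {Y Z : C} (h : Z ⟶ Y) (t : T.At Y), toEquiv (res h t) = res h (toEquiv t)
  proj_toEquiv : ∀ {Y : C} (t : T.At Y), T'.proj (toEquiv t) = T.proj t
  toEquiv_act : ∀ {Y : C} (f : Y ⟶ F) (t : T.At Y), toEquiv (T.act f t) = T'.act f (toEquiv t)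

namespace Iso

def refl (T : Torsor J F X) : Iso T T where
  toEquiv := Equiv.refl _
  res_toEquiv _ _ := rfl
  proj_toEquiv _ := rfl
  toEquiv_act _ _ := rfl

def symm {T T' : Torsor J F X} (φ : Iso T T') : Iso T' T where
  toEquiv := φ.toEquiv.symm
  res_toEquiv h t := by
    rw [Equiv.symm_apply_eq, φ.res_toEquiv, Equiv.apply_symm_apply]
  proj_toEquiv t := by
    rw [← φ.proj_toEquiv, Equiv.apply_symm_apply]
  toEquiv_act f t := by
    rw [Equiv.symm_apply_eq, φ.toEquiv_act, Equiv.apply_symm_apply]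

def trans {T T' T'' : Torsor J F X} (φ : Iso T T') (ψ : Iso T' T'') : Iso T T'' where
  toEquiv := φ.toEquiv.trans ψ.toEquiv
  res_toEquiv h t := by simp [φ.res_toEquiv, ψ.res_toEquiv]
  proj_toEquiv t := by simp [φ.proj_toEquiv, ψ.proj_toEquiv]
  toEquiv_act f t := by simp [φ.toEquiv_act, ψ.toEquiv_act]

end Iso

/-- A torsor isomorphism presented by its values on enough local sections. -/
structure LocalIso (T T' : Torsor J F X) where
  rel : ∀ ⦃Y : C⦄, T.At Y → T'.At Y → Prop
  rel_res : ∀ ⦃Y Z : C⦄ (h : Z ⟶ Y) {t : T.At Y} {t' : T'.At Y}, rel t t' → rel (res h t) (res h t')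
  rel_proj : ∀ ⦃Y : C⦄ {t : T.At Y} {t' : T'.At Y}, rel t t' → T.proj t = T'.proj t'
  rel_act : ∀ ⦃Y : C⦄ (f : Y ⟶ F) {t : T.At Y} {t' : T'.At Y}, rel t t' →
    rel (T.act f t) (T'.act f t')
  rel_unique : ∀ ⦃Y : C⦄ {t : T.At Y} {t' t'' : T'.At Y}, rel t t' → rel t t'' → t' = t''
  rel_cover : ∀ {Y : C} (g : Y ⟶ X), ∃ R ∈ J Y, ∀ ⦃Z : C⦄ (k : Z ⟶ Y), R k →
    ∃ t t', rel t t' ∧ T.proj t = k ≫ g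

namespace LocalIso

def symm {T T' : Torsor J F X} (φ : LocalIso T T') : LocalIso T' T where
  rel _ t' t := φ.rel t t'
  rel_res _ _ h _ _ := φ.rel_res h
  rel_proj _ _ _ h := (φ.rel_proj h).symm
  rel_act _ f _ _ := φ.rel_act f
  rel_unique Y t' t s h h' := by
    obtain ⟨f, rfl⟩ := T.exists_act ((φ.rel_proj h).trans (φ.rel_proj h').symm)
    have := φ.rel_unique h' (φ.rel_act f h)
    have hf : (1 : Y ⟶ F) = f := T'.act_inj ((T'.one_act t').trans this)
    rw [← hf, T.one_act]
  rel_cover g := by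
    obtain ⟨R, hR, h⟩ := φ.rel_cover g
    refine ⟨R, hR, fun Z k hk => ?_⟩
    obtain ⟨t, t', h, e⟩ := h k hk
    exact ⟨t', t, h, (φ.rel_proj h).symm.trans e⟩

lemma exists_value {T T' : Torsor J F X} (φ : LocalIso T T') {Y : C} (t : T.At Y) :
    ∃ t' : T'.At Y, ∀ ⦃Z : C⦄ (h : Z ⟶ Y) (s : T'.At Z), φ.rel (res h t) s → res h t' = s := by
  obtain ⟨R, hR, hex⟩ := φ.rel_cover (T.proj t)
  refine sheaf_glue T'.isSheaf (fun Z h s => φ.rel (res h t) s) ?_ ?_ hR ?_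
  · intro Z W h k p hp
    have := φ.rel_res k hp
    rwa [res_res] at this
  · intro Z h p p' hp hp'
    exact φ.rel_unique hp hp'
  · intro Z h hh
    obtain ⟨s, s', hs, e⟩ := hex h hh
    obtain ⟨f, hf⟩ := T.exists_act (t := s) (t' := res h t) (by rw [e, T.proj_res])
    exact ⟨T'.act f s', by rw [hf]; exact φ.rel_act f hs⟩

def value {T T' : Torsor J F X} (φ : LocalIso T T') {Y : C} (t : T.At Y) : T'.At Y :=
  (φ.exists_value t).choose

lemma res_value {T T' : Torsor J F X} (φ : LocalIso T T') {Y Z : C} (t : T.At Y) (h : Z ⟶ Y)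
    {s : T'.At Z} (hs : φ.rel (res h t) s) : res h (φ.value t) = s :=
  (φ.exists_value t).choose_spec h s hs

lemma value_eq {T T' : Torsor J F X} (φ : LocalIso T T') {Y : C} {t : T.At Y}
    {s : T'.At Y} (hs : φ.rel t s) : φ.value t = s := by
  have := φ.res_value t (𝟙 Y) (s := s) (by rwa [res_id])
  rwa [res_id] at this

lemma cover_rel {T T' : Torsor J F X} (φ : LocalIso T T') {Y : C} (t : T.At Y) :
    ∃ R ∈ J Y, ∀ ⦃Z : C⦄ (k : Z ⟶ Y), R k → φ.rel (res k t) (res k (φ.value t)) := by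
  obtain ⟨R, hR, hex⟩ := φ.rel_cover (T.proj t)
  refine ⟨R, hR, fun Z h hh => ?_⟩
  obtain ⟨s, s', hs, e⟩ := hex h hh
  obtain ⟨f, hf⟩ := T.exists_act (t := s) (t' := res h t) (by rw [e, T.proj_res])
  have h1 : φ.rel (res h t) (T'.act f s') := by rw [hf]; exact φ.rel_act f hs
  rwa [φ.res_value t h h1]

lemma symm_value {T T' : Torsor J F X} (φ : LocalIso T T') {Y : C} (t : T.At Y) :
    φ.symm.value (φ.value t) = t := by
  obtain ⟨R, hR, h⟩ := φ.cover_rel t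
  exact sheaf_ext T.isSheaf hR fun Z k hk => φ.symm.res_value _ k (h k hk)

/-- The isomorphism of torsors obtained from a local isomorphism by gluing. -/
def toIso [J.Subcanonical] {T T' : Torsor J F X} (φ : LocalIso T T') : Iso T T' where
  toEquiv := ⟨φ.value, φ.symm.value, φ.symm_value, φ.symm.symm_value⟩
  res_toEquiv h t := by
    obtain ⟨R, hR, hh⟩ := φ.cover_rel (res h t)
    refine sheaf_ext T'.isSheaf hR fun Z k hk => ?_
    have := hh k hk
    rw [res_res] at this
    change res k (φ.value (res h t)) = res k (res h (φ.value t))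
    rw [res_res, φ.res_value _ _ this]
  proj_toEquiv t := by
    obtain ⟨R, hR, hh⟩ := φ.cover_rel t
    refine hom_ext hR fun Z k hk => ?_
    have := φ.rel_proj (hh k hk)
    rw [T.proj_res, T'.proj_res] at this
    exact this.symm
  toEquiv_act f t := by
    obtain ⟨R, hR, hh⟩ := φ.cover_rel t
    refine sheaf_ext T'.isSheaf hR fun Z k hk => ?_
    have := φ.rel_act (k ≫ f) (hh k hk)
    rw [← T.res_act] at this
    exact (φ.res_value _ k this).trans (T'.res_act k f _).symm

lemma toIso_eq [J.Subcanonical] {T T' : Torsor J F X} (φ : LocalIso T T') {Y : C} {t : T.At Y}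
    {s : T'.At Y} (hs : φ.rel t s) : φ.toIso.toEquiv t = s :=
  φ.value_eq hs

end LocalIso

variable [J.Subcanonical]

variable (J F X) in
/-- The trivial torsor `F_X`. -/
def trivial : Torsor J F X where
  sec :=
    { obj := fun Y => ULift.{u} ((Y.unop ⟶ F) × (Y.unop ⟶ X))
      map := fun h => ↾fun t => ⟨h.unop ≫ t.down.1, h.unop ≫ t.down.2⟩ }
  isSheaf := by
    refine isSheaf_mk (fun Y R hR s t h => ?_) fun Y R hR x hx => ?_
    · have h' := fun ⦃Z : C⦄ (k : Z ⟶ Y) (hk : R k) =>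
        Prod.ext_iff.1 (ULift.up_injective (h k hk))
      exact ULift.ext _ _ (Prod.ext (hom_ext hR fun Z k hk => (h' k hk).1)
        (hom_ext hR fun Z k hk => (h' k hk).2))
    · have hx' := fun ⦃Z W : C⦄ (k : Z ⟶ Y) (l : W ⟶ Z) (hk : R k) (hlk : R (l ≫ k)) =>
        Prod.ext_iff.1 (congrArg ULift.down (hx k l hk hlk))
      obtain ⟨a, ha⟩ := hom_glue (J := J) (X := F) (Y := Y)
        (fun Z h p => ∃ hh : R h, p = (x h hh).down.1)
        (fun Z W h k p ⟨hh, e⟩ => ⟨R.downward_closed hh k, by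
          subst e; exact (hx' h k hh (R.downward_closed hh k)).1.symm⟩)
        (fun Z h p p' ⟨_, e⟩ ⟨_, e'⟩ => e.trans e'.symm) hR fun Z h hh => ⟨_, hh, rfl⟩
      obtain ⟨b, hb⟩ := hom_glue (J := J) (X := X) (Y := Y)
        (fun Z h p => ∃ hh : R h, p = (x h hh).down.2)
        (fun Z W h k p ⟨hh, e⟩ => ⟨R.downward_closed hh k, by
          subst e; exact (hx' h k hh (R.downward_closed hh k)).2.symm⟩)
        (fun Z h p p' ⟨_, e⟩ ⟨_, e'⟩ => e.trans e'.symm) hR fun Z h hh => ⟨_, hh, rfl⟩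
      exact ⟨⟨a, b⟩, fun Z k hk => ULift.ext _ _
        (Prod.ext (ha k _ ⟨hk, rfl⟩) (hb k _ ⟨hk, rfl⟩))⟩
  proj t := t.down.2
  proj_res _ _ := rfl
  act f t := ⟨f * t.down.1, t.down.2⟩
  one_act t := by simp
  mul_act f g t := ULift.ext _ _ (Prod.ext (mul_assoc _ _ _) rfl)
  res_act h f t := ULift.ext _ _ (Prod.ext (MonObj.comp_mul _ _ _) rfl)
  proj_act _ _ := rfl
  simply_transitive t t' h := by
    refine ⟨t'.down.1 * t.down.1⁻¹, ?_, fun f hf => ?_⟩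
    · exact ULift.ext _ _ (Prod.ext (by simp) h)
    · rw [← hf]; simp
  locally_nonempty g := ⟨⊤, J.top_mem _, fun Z k _ => ⟨⟨1, k ≫ g⟩, rfl⟩⟩

/-- The pull-back of a torsor along `f : X' ⟶ X`. -/
def pullback {X' : C} (f : X' ⟶ X) (T : Torsor J F X) : Torsor J F X' where
  sec :=
    { obj := fun Y => { p : T.At Y.unop × (Y.unop ⟶ X') // T.proj p.1 = p.2 ≫ f }
      map := fun h => ↾fun p => ⟨(res h.unop p.1.1, h.unop ≫ p.1.2), by
        rw [T.proj_res, p.2, Category.assoc]⟩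
      map_id := fun Y => by
        refine ConcreteCategory.hom_ext _ _ fun p => ?_
        refine Subtype.ext (Prod.ext ?_ ?_)
        · exact res_id _
        · exact Category.id_comp _
      map_comp := fun h k => by
        refine ConcreteCategory.hom_ext _ _ fun p => ?_
        refine Subtype.ext (Prod.ext ?_ ?_)
        · exact (res_res _ _ _).symm
        · exact Category.assoc _ _ _ }
  isSheaf := by
    refine isSheaf_mk (fun Y R hR s t h => ?_) fun Y R hR x hx => ?_
    · have h' := fun ⦃Z : C⦄ (k : Z ⟶ Y) (hk : R k) =>
        Prod.ext_iff.1 (congrArg Subtype.val (h k hk))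
      exact Subtype.ext (Prod.ext (sheaf_ext T.isSheaf hR fun Z k hk => (h' k hk).1)
        (hom_ext hR fun Z k hk => (h' k hk).2))
    · have hx' := fun ⦃Z W : C⦄ (k : Z ⟶ Y) (l : W ⟶ Z) (hk : R k) (hlk : R (l ≫ k)) =>
        Prod.ext_iff.1 (congrArg Subtype.val (hx k l hk hlk))
      obtain ⟨a, ha⟩ := sheaf_glue T.isSheaf (Y := Y)
        (fun Z h p => ∃ hh : R h, p = (x h hh).1.1)
        (fun Z W h k p ⟨hh, e⟩ => ⟨R.downward_closed hh k, by
          subst e; exact (hx' h k hh (R.downward_closed hh k)).1.symm⟩)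
        (fun Z h p p' ⟨_, e⟩ ⟨_, e'⟩ => e.trans e'.symm) hR fun Z h hh => ⟨_, hh, rfl⟩
      obtain ⟨b, hb⟩ := hom_glue (J := J) (X := X') (Y := Y)
        (fun Z h p => ∃ hh : R h, p = (x h hh).1.2)
        (fun Z W h k p ⟨hh, e⟩ => ⟨R.downward_closed hh k, by
          subst e; exact (hx' h k hh (R.downward_closed hh k)).2.symm⟩)
        (fun Z h p p' ⟨_, e⟩ ⟨_, e'⟩ => e.trans e'.symm) hR fun Z h hh => ⟨_, hh, rfl⟩
      refine ⟨⟨(a, b), hom_ext hR fun Z k hk => ?_⟩, fun Z k hk => Subtype.ext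
        (Prod.ext (ha k _ ⟨hk, rfl⟩) (hb k _ ⟨hk, rfl⟩))⟩
      rw [← T.proj_res, ha k _ ⟨hk, rfl⟩, ← Category.assoc, hb k _ ⟨hk, rfl⟩, (x k hk).2]
  proj p := p.1.2
  proj_res _ _ := rfl
  act a p := ⟨(T.act a p.1.1, p.1.2), by rw [T.proj_act, p.2]⟩
  one_act p := Subtype.ext (Prod.ext (T.one_act _) rfl)
  mul_act a b p := Subtype.ext (Prod.ext (T.mul_act _ _ _) rfl)
  res_act h a p := Subtype.ext (Prod.ext (T.res_act _ _ _) rfl)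
  proj_act _ _ := rfl
  simply_transitive p p' h := by
    obtain ⟨a, ha, hu⟩ := T.simply_transitive p.1.1 p'.1.1 (by rw [p.2, p'.2]; congr 1)
    exact ⟨a, Subtype.ext (Prod.ext ha h), fun b hb =>
      hu b (Prod.ext_iff.1 (congrArg Subtype.val hb)).1⟩
  locally_nonempty g := by
    obtain ⟨R, hR, hex⟩ := T.locally_nonempty (g ≫ f)
    refine ⟨R, hR, fun Z k hk => ?_⟩
    obtain ⟨t, ht⟩ := hex k hk
    exact ⟨⟨(t, k ≫ g), by rw [ht, Category.assoc]⟩, rfl⟩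

/-- The section of `f^* T` over a point `x` of `X'` given by a section of `T` over `f(x)`. -/
def pb {X' : C} (f : X' ⟶ X) {T : Torsor J F X} {Y : C} (x : Y ⟶ X') (t : T.At Y)
    (h : T.proj t = x ≫ f) : (pullback f T).At Y :=
  ⟨(t, x), h⟩

/-- The dual torsor: the same sheaf, with `F` acting through inversion. -/
def dual (T : Torsor J F X) : Torsor J F X where
  sec := T.sec
  isSheaf := T.isSheaf
  proj := T.proj
  proj_res := T.proj_res
  act f t := T.act f⁻¹ t
  one_act t := by rw [inv_one, T.one_act]
  mul_act f g t := by rw [mul_inv, T.mul_act]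
  res_act h f t := by rw [T.res_act, GrpObj.comp_inv]
  proj_act _ _ := T.proj_act _ _
  simply_transitive t t' h := by
    obtain ⟨f, hf, hu⟩ := T.simply_transitive t t' h
    exact ⟨f⁻¹, by simpa using hf, fun g hg => inv_eq_iff_eq_inv.1 (hu _ hg)⟩
  locally_nonempty := T.locally_nonempty

/-- A section over `Y` of the contracted product of `T` and `T'`, i.e. of the quotient sheaf of
`T ×_X T'` by the antidiagonal action `f • (t, t') = (f t, f⁻¹ t')` of `F`. As this action is free,
such a section is the same as a subsheaf `rel` of the restriction of `T ×_X T'` to `Y` (over some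
point `base` of `X`) that is locally a single `F`-orbit. -/
@[ext]
structure Orbit (T T' : Torsor J F X) (Y : C) where
  base : Y ⟶ X
  rel : ∀ ⦃Z : C⦄, (Z ⟶ Y) → T.At Z → T'.At Z → Prop
  rel_res : ∀ ⦃Z W : C⦄ (h : Z ⟶ Y) (k : W ⟶ Z) {t : T.At Z} {t' : T'.At Z},
    rel h t t' → rel (k ≫ h) (res k t) (res k t')
  rel_local : ∀ ⦃Z : C⦄ (h : Z ⟶ Y) {t : T.At Z} {t' : T'.At Z} (R : Sieve Z), R ∈ J Z →
    (∀ ⦃W : C⦄ (k : W ⟶ Z), R k → rel (k ≫ h) (res k t) (res k t')) → rel h t t'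
  rel_left : ∀ ⦃Z : C⦄ (h : Z ⟶ Y) {t : T.At Z} {t' : T'.At Z}, rel h t t' → T.proj t = h ≫ base
  rel_right : ∀ ⦃Z : C⦄ (h : Z ⟶ Y) {t : T.At Z} {t' : T'.At Z},
    rel h t t' → T'.proj t' = h ≫ base
  rel_iff : ∀ ⦃Z : C⦄ (h : Z ⟶ Y) {t : T.At Z} {t' : T'.At Z}, rel h t t' →
    ∀ s s', rel h s s' ↔ ∃ f : Z ⟶ F, s = T.act f t ∧ s' = T'.act f⁻¹ t'
  cover : ∃ R ∈ J Y, ∀ ⦃Z : C⦄ (h : Z ⟶ Y), R h → ∃ t t', rel h t t'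

namespace Orbit

variable {T T' : Torsor J F X}

/-- The orbit `t ⊗ t'` of a pair of sections over the same point. -/
def mk' {Y : C} (t : T.At Y) (t' : T'.At Y) (e : T.proj t = T'.proj t') : Orbit T T' Y where
  base := T.proj t
  rel Z h s s' := ∃ f : Z ⟶ F, s = T.act f (res h t) ∧ s' = T'.act f⁻¹ (res h t')
  rel_res := by
    rintro Z W h k s s' ⟨f, rfl, rfl⟩
    exact ⟨k ≫ f, by rw [T.res_act, res_res], by rw [T'.res_act, res_res, GrpObj.comp_inv]⟩
  rel_local := by
    intro Z h s s' R hR H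
    have hs : T.proj (res h t) = T.proj s := hom_ext hR fun W k hk => by
      obtain ⟨f, hf, -⟩ := H k hk
      rw [← T.proj_res, ← T.proj_res, hf, T.proj_act, res_res]
    have hs' : T'.proj (res h t') = T'.proj s' := hom_ext hR fun W k hk => by
      obtain ⟨f, -, hf⟩ := H k hk
      rw [← T'.proj_res, ← T'.proj_res, hf, T'.proj_act, res_res]
    obtain ⟨f, rfl⟩ := T.exists_act hs
    obtain ⟨f', rfl⟩ := T'.exists_act hs'
    have hff : f' = f⁻¹ := hom_ext hR fun W k hk => by
      obtain ⟨g, hg, hg'⟩ := H k hk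
      rw [T.res_act, res_res] at hg
      rw [T'.res_act, res_res] at hg'
      rw [T'.act_inj hg', ← T.act_inj hg, GrpObj.comp_inv]
    exact ⟨f, rfl, by rw [hff]⟩
  rel_left := by
    rintro Z h s s' ⟨f, rfl, rfl⟩
    rw [T.proj_act, T.proj_res]
  rel_right := by
    rintro Z h s s' ⟨f, rfl, rfl⟩
    rw [T'.proj_act, T'.proj_res, e]
  rel_iff := by
    rintro Z h _ _ ⟨f, rfl, rfl⟩ s s'
    constructor
    · rintro ⟨g, rfl, rfl⟩
      refine ⟨g * f⁻¹, ?_, ?_⟩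
      · rw [← T.mul_act]; simp
      · rw [← T'.mul_act]; simp
    · rintro ⟨g, rfl, rfl⟩
      exact ⟨g * f, by rw [T.mul_act], by rw [mul_inv, T'.mul_act]⟩
  cover := ⟨⊤, J.top_mem _, fun Z h _ => ⟨res h t, res h t', 1, by rw [T.one_act],
    by rw [inv_one, T'.one_act]⟩⟩

/-- Restriction of orbits. -/
def map {Y Y' : C} (l : Y' ⟶ Y) (o : Orbit T T' Y) : Orbit T T' Y' where
  base := l ≫ o.base
  rel _ h t t' := o.rel (h ≫ l) t t'
  rel_res _ _ h k _ _ H := by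
    rw [Category.assoc]; exact o.rel_res (h ≫ l) k H
  rel_local _ h _ _ R hR H := o.rel_local (h ≫ l) R hR fun _ k hk => by
    rw [← Category.assoc]; exact H k hk
  rel_left _ h _ _ H := by rw [← Category.assoc]; exact o.rel_left (h ≫ l) H
  rel_right _ h _ _ H := by rw [← Category.assoc]; exact o.rel_right (h ≫ l) H
  rel_iff _ h _ _ H := o.rel_iff (h ≫ l) H
  cover := by
    obtain ⟨R, hR, H⟩ := o.cover
    exact ⟨R.pullback l, J.pullback_stable l hR, fun Z h hh => H (h ≫ l) hh⟩

lemma eq_of_rel {Y : C} {o o' : Orbit T T' Y} {R : Sieve Y} (hR : R ∈ J Y)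
    (H : ∀ ⦃Z : C⦄ (h : Z ⟶ Y), R h → ∃ t t', o.rel h t t' ∧ o'.rel h t t') : o = o' := by
  have key : ∀ ⦃Z : C⦄ (h : Z ⟶ Y) (t : T.At Z) (t' : T'.At Z), o.rel h t t' ↔ o'.rel h t t' := by
    intro Z h t t'
    have loc : ∀ ⦃W : C⦄ (k : W ⟶ Z), R.pullback h k →
        (o.rel (k ≫ h) (res k t) (res k t') ↔ o'.rel (k ≫ h) (res k t) (res k t')) := by
      intro W k hk
      obtain ⟨s, s', h1, h2⟩ := H (k ≫ h) hk
      rw [o.rel_iff _ h1, o'.rel_iff _ h2]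
    constructor
    · exact fun h1 => o'.rel_local h _ (J.pullback_stable h hR) fun W k hk =>
        (loc k hk).1 (o.rel_res h k h1)
    · exact fun h1 => o.rel_local h _ (J.pullback_stable h hR) fun W k hk =>
        (loc k hk).2 (o'.rel_res h k h1)
  refine Orbit.ext (hom_ext hR fun Z h hh => ?_) ?_
  · obtain ⟨s, s', h1, h2⟩ := H h hh
    rw [← o.rel_left h h1, ← o'.rel_left h h2]
  · funext Z h t t'
    exact propext (key h t t')

lemma rel_iff_map {Y Z : C} (o : Orbit T T' Y) (h : Z ⟶ Y) (t : T.At Z) (t' : T'.At Z) :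
    o.rel h t t' ↔ ∃ e, o.map h = mk' t t' e := by
  constructor
  · intro H
    refine ⟨(o.rel_left h H).trans (o.rel_right h H).symm,
      eq_of_rel (J.top_mem _) fun W k _ => ⟨_, _, o.rel_res h k H, 1, ?_, ?_⟩⟩
    · rw [T.one_act]
    · rw [inv_one, T'.one_act]
  · rintro ⟨e, H⟩
    have : (mk' t t' e).rel (𝟙 Z) t t' :=
      ⟨1, by rw [T.one_act, res_id], by rw [inv_one, T'.one_act, res_id]⟩
    rw [← H] at this
    change o.rel (𝟙 Z ≫ h) t t' at this
    rwa [Category.id_comp] at this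

end Orbit

/-- The contracted product `T ⊗ T'` of two torsors: the quotient sheaf of `T ×_X T'` by the
antidiagonal action of `F`, on which `F` acts by `f • (t ⊗ t') = (f t) ⊗ t' = t ⊗ (f t')`. -/
def tensor (T T' : Torsor J F X) : Torsor J F X where
  sec :=
    { obj := fun Y => Orbit T T' Y.unop
      map := fun h => ↾(Orbit.map h.unop)
      map_id := fun Y => by
        refine ConcreteCategory.hom_ext _ _ fun o => ?_
        refine Orbit.ext ?_ ?_
        · exact Category.id_comp _
        funext Z h t t'
        exact congrArg (fun l => o.rel l t t') (Category.comp_id h)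
      map_comp := fun k l => by
        refine ConcreteCategory.hom_ext _ _ fun o => ?_
        refine Orbit.ext ?_ ?_
        · exact Category.assoc _ _ _
        funext Z h t t'
        exact congrArg (fun l => o.rel l t t') (Category.assoc h _ _).symm }
  isSheaf := by
    refine isSheaf_mk (fun Y R hR (o : Orbit T T' Y) (o' : Orbit T T' Y) H => ?_)
      fun Y R hR (x : ∀ ⦃Z : C⦄ (k : Z ⟶ Y), R k → Orbit T T' Z) hx => ?_
    · obtain ⟨A, hA, hA'⟩ := o.cover
      refine Orbit.eq_of_rel (J.intersection_covering hR hA) fun Z h hh => ?_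
      obtain ⟨t, t', htt⟩ := hA' h hh.2
      obtain ⟨e, he⟩ := (o.rel_iff_map _ _ _).1 htt
      exact ⟨t, t', htt, (o'.rel_iff_map _ _ _).2 ⟨e, (H h hh.1).symm.trans he⟩⟩
    · have hx' : ∀ ⦃Z W : C⦄ (k : Z ⟶ Y) (l : W ⟶ Z) (hk : R k) (hlk : R (l ≫ k)),
          x (l ≫ k) hlk = (x k hk).map l := hx
      obtain ⟨b, hb⟩ := hom_glue (J := J) (X := X) (Y := Y)
        (fun Z h p => ∃ hh : R h, p = (x h hh).base)
        (fun Z W h k p ⟨hh, e⟩ => ⟨R.downward_closed hh k, by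
          rw [hx' h k hh (R.downward_closed hh k), e]; rfl⟩)
        (fun Z h p p' ⟨_, e⟩ ⟨_, e'⟩ => e.trans e'.symm) hR fun Z h hh => ⟨_, hh, rfl⟩
      have hx1 : ∀ ⦃Z W : C⦄ (k : Z ⟶ Y) (l : W ⟶ Z) (hk : R k) (hlk : R (l ≫ k)) t t',
          (x (l ≫ k) hlk).rel (𝟙 W) t t' ↔ (x k hk).rel l t t' := by
        intro Z W k l hk hlk t t'
        rw [hx' k l hk hlk]
        change (x k hk).rel (𝟙 W ≫ l) t t' ↔ _
        rw [Category.id_comp]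
      have hcon : ∀ ⦃Z : C⦄ {h h' : Z ⟶ Y} (e : h = h') (hh : R h) (hh' : R h') t t',
          (x h hh).rel (𝟙 Z) t t' → (x h' hh').rel (𝟙 Z) t t' := by
        rintro Z h _ rfl _ _ t t' H
        exact H
      have hproj : ∀ ⦃Z : C⦄ (h : Z ⟶ Y) (t : T.At Z) (t' : T'.At Z),
          (∀ ⦃W : C⦄ (k : W ⟶ Z) (hk : R (k ≫ h)),
            (x (k ≫ h) hk).rel (𝟙 W) (res k t) (res k t')) →
          T.proj t = h ≫ b ∧ T'.proj t' = h ≫ b := by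
        intro Z h t t' H
        constructor
        · refine hom_ext (J.pullback_stable h hR) fun W k hk => ?_
          rw [← T.proj_res, (x (k ≫ h) hk).rel_left _ (H k hk), ← Category.assoc k,
            hb (k ≫ h) _ ⟨hk, rfl⟩, Category.id_comp]
        · refine hom_ext (J.pullback_stable h hR) fun W k hk => ?_
          rw [← T'.proj_res, (x (k ≫ h) hk).rel_right _ (H k hk), ← Category.assoc k,
            hb (k ≫ h) _ ⟨hk, rfl⟩, Category.id_comp]
      let o : Orbit T T' Y :=
        { base := b
          rel := fun Z h t t' => ∀ ⦃W : C⦄ (k : W ⟶ Z) (hk : R (k ≫ h)),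
            (x (k ≫ h) hk).rel (𝟙 W) (res k t) (res k t')
          rel_res := fun Z W h k t t' H V l hl => by
            rw [res_res, res_res]
            exact hcon (Category.assoc l k h) (by rwa [Category.assoc]) hl _ _ (H (l ≫ k) _)
          rel_local := fun Z h t t' A hA H W k hk => by
            refine (x (k ≫ h) hk).rel_local (𝟙 W) _ (J.pullback_stable k hA) fun V l hl => ?_
            have h1 := H (l ≫ k) hl (𝟙 V) (by
              rw [Category.id_comp, Category.assoc]; exact R.downward_closed hk l)
            rw [res_id, res_id] at h1
            have h2 := hcon (h' := l ≫ k ≫ h) (by simp) _ (R.downward_closed hk l) _ _ h1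
            rw [hx1] at h2
            rw [Category.comp_id, res_res, res_res]
            exact h2
          rel_left := fun Z h t t' H => (hproj h t t' H).1
          rel_right := fun Z h t t' H => (hproj h t t' H).2
          rel_iff := fun Z h t t' H s s' => by
            constructor
            · intro H'
              obtain ⟨f, rfl⟩ := T.exists_act ((hproj h t t' H).1.trans (hproj h s s' H').1.symm)
              obtain ⟨f', rfl⟩ := T'.exists_act ((hproj h t t' H).2.trans (hproj h _ s' H').2.symm)
              refine ⟨f, rfl, ?_⟩
              congr 1
              refine hom_ext (J.pullback_stable h hR) fun W k hk => ?_
              obtain ⟨g, hg, hg'⟩ := ((x (k ≫ h) hk).rel_iff _ (H k hk) _ _).1 (H' k hk)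
              rw [T.res_act] at hg
              rw [T'.res_act] at hg'
              rw [T'.act_inj hg', ← T.act_inj hg, GrpObj.comp_inv]
            · rintro ⟨f, rfl, rfl⟩ W k hk
              exact ((x (k ≫ h) hk).rel_iff _ (H k hk) _ _).2 ⟨k ≫ f, T.res_act _ _ _, by
                rw [T'.res_act, GrpObj.comp_inv]⟩
          cover := by
            let A : Sieve Y :=
              { arrows := fun Z h => ∃ hh : R h, ∃ t t', (x h hh).rel (𝟙 Z) t t'
                downward_closed := by
                  rintro Z W h ⟨hh, t, t', H⟩ k
                  refine ⟨R.downward_closed hh k, res k t, res k t', ?_⟩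
                  rw [hx1 h k hh]
                  simpa using (x h hh).rel_res (𝟙 Z) k H }
            refine ⟨A, J.transitive hR A fun Z h hh => ?_, ?_⟩
            · obtain ⟨B, hB, H⟩ := (x h hh).cover
              refine J.superset_covering (fun W k hk => ?_) hB
              obtain ⟨t, t', H'⟩ := H k hk
              exact ⟨R.downward_closed hh k, t, t', (hx1 h k hh _ _ _).2 H'⟩
            · rintro Z h ⟨hh, t, t', H⟩
              refine ⟨t, t', fun W k hk => ?_⟩
              rw [hx1 h k hh]
              simpa using (x h hh).rel_res (𝟙 Z) k H }
      refine ⟨o, fun Z h hh => ?_⟩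
      obtain ⟨B, hB, H⟩ := (x h hh).cover
      refine Orbit.eq_of_rel (o := o.map h) hB fun W k hk => ?_
      obtain ⟨t, t', H'⟩ := H k hk
      refine ⟨t, t', fun V l hl => ?_, H'⟩
      have hl' : R (l ≫ k ≫ h) := R.downward_closed (R.downward_closed hh k) l
      refine hcon (h := (l ≫ k) ≫ h) (by simp) (by simpa using hl') hl _ _ ?_
      rw [hx1 h (l ≫ k) hh]
      exact (x h hh).rel_res k l H'
  proj o := Orbit.base o
  proj_res _ _ := rfl
  act f o :=
    { base := Orbit.base o
      rel := fun Z h t t' => Orbit.rel o h t (T'.act (h ≫ f)⁻¹ t')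
      rel_res := fun Z W h k t t' H => by
        have := Orbit.rel_res o h k H
        rwa [T'.res_act, GrpObj.comp_inv, ← Category.assoc] at this
      rel_local := fun Z h t t' R hR H => Orbit.rel_local o h R hR fun W k hk => by
        have := H k hk
        rwa [T'.res_act, GrpObj.comp_inv, ← Category.assoc]
      rel_left := fun Z h t t' H => Orbit.rel_left o h H
      rel_right := fun Z h t t' H => (T'.proj_act _ _).symm.trans (Orbit.rel_right o h H)
      rel_iff := fun Z h t t' H s s' => by
        rw [Orbit.rel_iff o h H]
        refine exists_congr fun g => and_congr_right fun _ => ?_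
        rw [T'.act_comm]
        refine ⟨fun e => ?_, fun e => by rw [e]⟩
        rw [← T'.act_act_inv (h ≫ f) s', e, T'.act_act_inv]
      cover := by
        obtain ⟨R, hR, H⟩ := Orbit.cover o
        refine ⟨R, hR, fun Z h hh => ?_⟩
        obtain ⟨t, t', H'⟩ := H h hh
        exact ⟨t, T'.act (h ≫ f) t', by rwa [T'.act_inv_act]⟩ }
  one_act o := Orbit.ext rfl (by
    funext Z h t t'
    simp [T'.one_act])
  mul_act f g o := Orbit.ext rfl (by
    funext Z h t t'
    simp only [MonObj.comp_mul, mul_inv, T'.mul_act]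
    rw [T'.act_comm])
  res_act h f o := Orbit.ext rfl (by
    funext Z k t t'
    change Orbit.rel o (k ≫ h) t _ = Orbit.rel o (k ≫ h) t _
    rw [Category.assoc]; rfl)
  proj_act _ _ := rfl
  simply_transitive {Y} o o' e := by
    have e : Orbit.base o = Orbit.base o' := e
    obtain ⟨A, hA, hA'⟩ := Orbit.cover o
    obtain ⟨B, hB, hB'⟩ := Orbit.cover o'
    let Q : ∀ ⦃Z : C⦄, (Z ⟶ Y) → (Z ⟶ F) → Prop := fun Z h f =>
      ∃ t t', Orbit.rel o h t t' ∧ Orbit.rel o' h t (T'.act f t')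
    have hQ : ∀ ⦃Z : C⦄ (h : Z ⟶ Y) (p p' : Z ⟶ F), Q h p → Q h p' → p = p' := by
      rintro Z h f f' ⟨t, t', h1, h2⟩ ⟨s, s', h3, h4⟩
      obtain ⟨g, rfl, rfl⟩ := (Orbit.rel_iff o h h1 _ _).1 h3
      obtain ⟨g', h5, h6⟩ := (Orbit.rel_iff o' h h2 _ _).1 h4
      rw [← T.act_inj h5, T'.act_comm f' g⁻¹] at h6
      have := congrArg (T'.act g) h6
      rw [T'.act_act_inv, T'.act_act_inv] at this
      exact (T'.act_inj this).symm
    obtain ⟨f, hf⟩ := hom_glue (J := J) (X := F) (Y := Y) Q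
      (by
        rintro Z W h k f ⟨t, t', h1, h2⟩
        refine ⟨_, _, Orbit.rel_res o h k h1, ?_⟩
        rw [← T'.res_act]
        exact Orbit.rel_res o' h k h2)
      hQ
      (J.intersection_covering hA hB)
      (by
        intro Z h hh
        obtain ⟨t, t', h1⟩ := hA' h hh.1
        obtain ⟨s, s', h2⟩ := hB' h hh.2
        obtain ⟨g, rfl⟩ := T.exists_act (t := s) (t' := t)
          (by rw [Orbit.rel_left o h h1, Orbit.rel_left o' h h2, e])
        have h3 : Orbit.rel o' h (T.act g s) (T'.act g⁻¹ s') :=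
          (Orbit.rel_iff o' h h2 _ _).2 ⟨g, rfl, rfl⟩
        obtain ⟨f, hf⟩ := T'.exists_act (t := t') (t' := T'.act g⁻¹ s')
          (by rw [Orbit.rel_right o h h1, Orbit.rel_right o' h h3, e])
        exact ⟨f, _, t', h1, by rwa [← hf]⟩)
    refine ⟨f, ?_, ?_⟩
    · refine Orbit.eq_of_rel (J.intersection_covering hA hB) fun Z h hh => ?_
      obtain ⟨t, t', h1⟩ := hA' h hh.1
      obtain ⟨s, s', h2⟩ := hB' h hh.2
      obtain ⟨g, rfl⟩ := T.exists_act (t := s) (t' := t)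
        (by rw [Orbit.rel_left o h h1, Orbit.rel_left o' h h2, e])
      have h3 : Orbit.rel o' h (T.act g s) (T'.act g⁻¹ s') :=
        (Orbit.rel_iff o' h h2 _ _).2 ⟨g, rfl, rfl⟩
      obtain ⟨f', hf'⟩ := T'.exists_act (t := t') (t' := T'.act g⁻¹ s')
        (by rw [Orbit.rel_right o h h1, Orbit.rel_right o' h h3, e])
      have h4 := hf h f' ⟨_, t', h1, by rwa [← hf']⟩
      refine ⟨_, T'.act g⁻¹ s', ?_, h3⟩
      change Orbit.rel o h _ (T'.act (h ≫ f)⁻¹ _)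
      rwa [hf', h4, T'.act_inv_act]
    · intro f' hf'
      refine hom_ext (J.intersection_covering hA hB) fun Z h hh => ?_
      obtain ⟨t, t', h1⟩ := hA' h hh.1
      refine (hf h _ ⟨t, t', h1, ?_⟩).symm
      rw [← hf']
      change Orbit.rel o h _ (T'.act (h ≫ f')⁻¹ _)
      rwa [T'.act_inv_act]
  locally_nonempty g := by
    obtain ⟨A, hA, hA'⟩ := T.locally_nonempty g
    obtain ⟨B, hB, hB'⟩ := T'.locally_nonempty g
    refine ⟨A ⊓ B, J.intersection_covering hA hB, fun Z k hk => ?_⟩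
    obtain ⟨t, ht⟩ := hA' k hk.1
    obtain ⟨t', ht'⟩ := hB' k hk.2
    exact ⟨Orbit.mk' t t' (ht.trans ht'.symm), ht⟩

/-- The section `t ⊗ t'` of the contracted product. -/
def tmul {T T' : Torsor J F X} {Y : C} (t : T.At Y) (t' : T'.At Y) (e : T.proj t = T'.proj t') :
    (tensor T T').At Y :=
  Orbit.mk' t t' e

section tmul

variable {T T' : Torsor J F X}

lemma proj_tmul {Y : C} (t : T.At Y) (t' : T'.At Y) (e) :
    (tensor T T').proj (tmul t t' e) = T.proj t := rfl

lemma tmul_eq_iff {Y : C} {t s : T.At Y} {t' s' : T'.At Y} {e e'} :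
    tmul t t' e = tmul s s' e' ↔ ∃ f : Y ⟶ F, s = T.act f t ∧ s' = T'.act f⁻¹ t' := by
  have h := (Orbit.mk' t t' e).rel_iff_map (𝟙 Y) s s'
  have h2 : Orbit.map (𝟙 Y) (Orbit.mk' t t' e) = Orbit.mk' t t' e :=
    res_id (P := (tensor T T').sec) (tmul t t' e)
  rw [h2] at h
  change Orbit.mk' t t' e = Orbit.mk' s s' e' ↔ _
  refine ⟨fun H => ?_, fun ⟨f, h1, h3⟩ => ?_⟩
  · obtain ⟨f, h3, h4⟩ := h.2 ⟨e', H⟩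
    exact ⟨f, by rwa [res_id] at h3, by rwa [res_id] at h4⟩
  · exact (h.1 ⟨f, by rwa [res_id], by rwa [res_id]⟩).choose_spec

lemma res_tmul {Y Z : C} (h : Z ⟶ Y) (t : T.At Y) (t' : T'.At Y) (e) :
    res h (tmul t t' e) = tmul (res h t) (res h t') (by rw [T.proj_res, T'.proj_res, e]) := by
  have : (Orbit.mk' t t' e).rel h (res h t) (res h t') :=
    ⟨1, by rw [T.one_act], by rw [inv_one, T'.one_act]⟩
  exact ((Orbit.rel_iff_map _ _ _ _).1 this).choose_spec

lemma act_tmul {Y : C} (f : Y ⟶ F) (t : T.At Y) (t' : T'.At Y) (e) :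
    (tensor T T').act f (tmul t t' e) = tmul t (T'.act f t') (by rw [e, T'.proj_act]) := by
  refine Orbit.eq_of_rel (J.top_mem _) fun Z h _ => ⟨res h t, res h (T'.act f t'), ?_, ?_⟩
  · refine ⟨1, by rw [T.one_act], ?_⟩
    rw [T'.res_act, T'.act_inv_act, inv_one, T'.one_act]
  · exact ⟨1, by rw [T.one_act], by rw [inv_one, T'.one_act]⟩

lemma act_tmul' {Y : C} (f : Y ⟶ F) (t : T.At Y) (t' : T'.At Y) (e) :
    (tensor T T').act f (tmul t t' e) = tmul (T.act f t) t' (by rw [T.proj_act, e]) := by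
  rw [act_tmul, tmul_eq_iff]
  exact ⟨f, rfl, (T'.act_inv_act f t').symm⟩

lemma exists_tmul {Y : C} (o : (tensor T T').At Y) :
    ∃ R ∈ J Y, ∀ ⦃Z : C⦄ (h : Z ⟶ Y), R h → ∃ t t' e, res h o = tmul (T := T) (T' := T') t t' e := by
  obtain ⟨R, hR, H⟩ := Orbit.cover o
  refine ⟨R, hR, fun Z h hh => ?_⟩
  obtain ⟨t, t', H'⟩ := H h hh
  exact ⟨t, t', (Orbit.rel_iff_map o _ _ _).1 H'⟩

end tmul

/-- A biequivariant map from `T ×_X T'` to a torsor `P` induces `T ⊗ T' ≅ P`. -/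
def tensorLift {T T' P : Torsor J F X}
    (φ : ∀ ⦃Y : C⦄ (t : T.At Y) (t' : T'.At Y), T.proj t = T'.proj t' → P.At Y)
    (hres : ∀ ⦃Y Z : C⦄ (h : Z ⟶ Y) (t : T.At Y) (t' : T'.At Y) (e e'),
      res h (φ t t' e) = φ (res h t) (res h t') e')
    (hproj : ∀ ⦃Y : C⦄ (t : T.At Y) (t' : T'.At Y) (e), P.proj (φ t t' e) = T.proj t)
    (hleft : ∀ ⦃Y : C⦄ (f : Y ⟶ F) (t : T.At Y) (t' : T'.At Y) (e e'),
      φ (T.act f t) t' e' = P.act f (φ t t' e))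
    (hright : ∀ ⦃Y : C⦄ (f : Y ⟶ F) (t : T.At Y) (t' : T'.At Y) (e e'),
      φ t (T'.act f t') e' = P.act f (φ t t' e)) :
    LocalIso (tensor T T') P where
  rel Y o p := ∃ t t' e, o = tmul t t' e ∧ p = φ t t' e
  rel_res := by
    rintro Y Z h _ _ ⟨t, t', e, rfl, rfl⟩
    exact ⟨_, _, _, res_tmul h t t' e, hres h t t' e _⟩
  rel_proj := by
    rintro Y _ _ ⟨t, t', e, rfl, rfl⟩
    exact (hproj t t' e).symm
  rel_act := by
    rintro Y f _ _ ⟨t, t', e, rfl, rfl⟩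
    exact ⟨_, _, _, act_tmul f t t' e, (hright f t t' e _).symm⟩
  rel_unique := by
    rintro Y _ _ _ ⟨t, t', e, rfl, rfl⟩ ⟨s, s', e', h, rfl⟩
    obtain ⟨f, rfl, rfl⟩ := tmul_eq_iff.1 h
    rw [hright f⁻¹ _ t' (by rw [T.proj_act, e]), hleft f t t' e, P.act_inv_act]
  rel_cover g := by
    obtain ⟨A, hA, hA'⟩ := T.locally_nonempty g
    obtain ⟨B, hB, hB'⟩ := T'.locally_nonempty g
    refine ⟨A ⊓ B, J.intersection_covering hA hB, fun Z k hk => ?_⟩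
    obtain ⟨t, ht⟩ := hA' k hk.1
    obtain ⟨t', ht'⟩ := hB' k hk.2
    exact ⟨_, _, ⟨t, t', ht.trans ht'.symm, rfl, rfl⟩, ht⟩

/-- Functoriality of the contracted product. -/
def tensorMap {T₁ T₂ T₁' T₂' : Torsor J F X} (φ : Iso T₁ T₂) (φ' : Iso T₁' T₂') :
    Iso (tensor T₁ T₁') (tensor T₂ T₂') :=
  LocalIso.toIso (tensorLift
    (fun _ t t' e => tmul (φ.toEquiv t) (φ'.toEquiv t') (by
      rw [φ.proj_toEquiv, φ'.proj_toEquiv, e]))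
    (fun _ _ h t t' e e' => by
      rw [res_tmul]; congr 1 <;> simp [φ.res_toEquiv, φ'.res_toEquiv])
    (fun _ t t' e => by rw [proj_tmul, φ.proj_toEquiv])
    (fun _ f t t' e e' => by rw [act_tmul']; congr 1; exact φ.toEquiv_act f t)
    (fun _ f t t' e e' => by rw [act_tmul]; congr 1; exact φ'.toEquiv_act f t'))

/-- Functoriality of the dual. -/
def dualMap {T T' : Torsor J F X} (φ : Iso T T') : Iso (dual T) (dual T') where
  toEquiv := φ.toEquiv
  res_toEquiv := φ.res_toEquiv
  proj_toEquiv := φ.proj_toEquiv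
  toEquiv_act f t := φ.toEquiv_act f⁻¹ t

/-- Functoriality of the pull-back. -/
def pullbackMap {X' : C} (f : X' ⟶ X) {T T' : Torsor J F X} (φ : Iso T T') :
    Iso (pullback f T) (pullback f T') where
  toEquiv :=
    { toFun := fun p => ⟨(φ.toEquiv p.1.1, p.1.2), by rw [φ.proj_toEquiv, p.2]⟩
      invFun := fun p => ⟨(φ.symm.toEquiv p.1.1, p.1.2), by rw [φ.symm.proj_toEquiv, p.2]⟩
      left_inv := fun p => Subtype.ext (Prod.ext (φ.toEquiv.symm_apply_apply _) rfl)
      right_inv := fun p => Subtype.ext (Prod.ext (φ.toEquiv.apply_symm_apply _) rfl) }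
  res_toEquiv h p := Subtype.ext (Prod.ext (φ.res_toEquiv h p.1.1) rfl)
  proj_toEquiv _ := rfl
  toEquiv_act a p := Subtype.ext (Prod.ext (φ.toEquiv_act a p.1.1) rfl)

def tensorComm (T T' : Torsor J F X) : LocalIso (tensor T T') (tensor T' T) :=
  tensorLift (fun _ t t' e => tmul t' t e.symm)
    (fun _ _ h t t' e e' => res_tmul _ _ _ _)
    (fun _ t t' e => e.symm)
    (fun _ f t t' e e' => (act_tmul _ _ _ _).symm)
    (fun _ f t t' e e' => (act_tmul' _ _ _ _).symm)

def tensorAssoc (T T' T'' : Torsor J F X) :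
    LocalIso (tensor (tensor T T') T'') (tensor T (tensor T' T'')) where
  rel Y o p := ∃ (t : T.At Y) (t' : T'.At Y) (t'' : T''.At Y) (e : T.proj t = T'.proj t')
    (e' : T'.proj t' = T''.proj t''),
    o = tmul (tmul t t' e) t'' ((proj_tmul t t' e).trans (e.trans e')) ∧
      p = tmul t (tmul t' t'' e') (e.trans (proj_tmul t' t'' e').symm)
  rel_res := by
    rintro Y Z h _ _ ⟨t, t', t'', e, e', rfl, rfl⟩
    refine ⟨res h t, res h t', res h t'', by rw [T.proj_res, T'.proj_res, e],
      by rw [T'.proj_res, T''.proj_res, e'], ?_, ?_⟩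
    · rw [res_tmul]; congr 1; exact res_tmul _ _ _ _
    · rw [res_tmul]; congr 1; exact res_tmul _ _ _ _
  rel_proj := by
    rintro Y _ _ ⟨t, t', t'', e, e', rfl, rfl⟩
    rfl
  rel_act := by
    rintro Y f _ _ ⟨t, t', t'', e, e', rfl, rfl⟩
    refine ⟨t, t', T''.act f t'', e, by rw [T''.proj_act, e'], act_tmul _ _ _ _, ?_⟩
    rw [act_tmul]; congr 1; exact act_tmul _ _ _ _
  rel_unique := by
    rintro Y _ _ _ ⟨t, t', t'', e, e', rfl, rfl⟩ ⟨s, s', s'', d, d', h, rfl⟩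
    obtain ⟨f, h1, rfl⟩ := tmul_eq_iff.1 h
    rw [act_tmul, eq_comm, tmul_eq_iff] at h1
    obtain ⟨g, rfl, rfl⟩ := h1
    refine tmul_eq_iff.2 ⟨g, rfl, ?_⟩
    rw [act_tmul']
    refine (tmul_eq_iff.2 ⟨f, ?_, rfl⟩).symm
    rw [T'.act_comm]
  rel_cover g := by
    obtain ⟨A, hA, hA'⟩ := T.locally_nonempty g
    obtain ⟨B, hB, hB'⟩ := T'.locally_nonempty g
    obtain ⟨D, hD, hD'⟩ := T''.locally_nonempty g
    refine ⟨A ⊓ B ⊓ D, J.intersection_covering (J.intersection_covering hA hB) hD,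
      fun Z k hk => ?_⟩
    obtain ⟨t, ht⟩ := hA' k hk.1.1
    obtain ⟨t', ht'⟩ := hB' k hk.1.2
    obtain ⟨t'', ht''⟩ := hD' k hk.2
    exact ⟨_, _, ⟨t, t', t'', ht.trans ht'.symm, ht'.trans ht''.symm, rfl, rfl⟩, ht⟩

def trivialTensor (T : Torsor J F X) : LocalIso (tensor (trivial J F X) T) T :=
  tensorLift (fun _ a t _ => T.act a.down.1 t)
    (fun _ _ h t t' e e' => T.res_act _ _ _)
    (fun _ t t' e => (T.proj_act _ _).trans e.symm)
    (fun _ f t t' e e' => T.mul_act _ _ _)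
    (fun _ f t t' e e' => T.act_comm _ _ _)

/-- The unique `f` with `f t = t'`. -/
def diff (T : Torsor J F X) {Y : C} (t t' : T.At Y) (e : T.proj t = T.proj t') : Y ⟶ F :=
  (T.simply_transitive t t' e).choose

lemma act_diff (T : Torsor J F X) {Y : C} (t t' : T.At Y) (e : T.proj t = T.proj t') :
    T.act (T.diff t t' e) t = t' :=
  (T.simply_transitive t t' e).choose_spec.1

lemma diff_eq (T : Torsor J F X) {Y : C} {t t' : T.At Y} (e : T.proj t = T.proj t') {f : Y ⟶ F}
    (h : T.act f t = t') : T.diff t t' e = f :=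
  T.act_inj ((T.act_diff t t' e).trans h.symm)

lemma res_diff (T : Torsor J F X) {Y Z : C} (h : Z ⟶ Y) (t t' : T.At Y) (e) (e') :
    h ≫ T.diff t t' e = T.diff (res h t) (res h t') e' :=
  (T.diff_eq e' (by rw [← T.res_act, T.act_diff])).symm

lemma diff_act_left (T : Torsor J F X) {Y : C} (f : Y ⟶ F) (t t' : T.At Y) (e) (e') :
    T.diff (T.act f⁻¹ t) t' e' = f * T.diff t t' e :=
  T.diff_eq e' (by
    rw [← T.mul_act, mul_comm f, mul_assoc, mul_inv_cancel, mul_one, T.act_diff])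

lemma diff_act_right (T : Torsor J F X) {Y : C} (f : Y ⟶ F) (t t' : T.At Y) (e) (e') :
    T.diff t (T.act f t') e' = f * T.diff t t' e :=
  T.diff_eq e' (by rw [T.mul_act, T.act_diff])

def dualTensor (T : Torsor J F X) : LocalIso (tensor (dual T) T) (trivial J F X) :=
  tensorLift (T := dual T) (T' := T)
    (fun _ t t' e => ⟨T.diff (Y := _) t t' e, T.proj t⟩)
    (fun _ _ h t t' e e' => ULift.ext _ _ (Prod.ext
      (T.res_diff h t t' e e') (T.proj_res h t).symm))
    (fun _ t t' e => rfl)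
    (fun _ f t t' e e' => ULift.ext _ _ (Prod.ext
      (T.diff_act_left f t t' e e') (T.proj_act f⁻¹ t)))
    (fun _ f t t' e e' => ULift.ext _ _ (Prod.ext (T.diff_act_right f t t' e e') rfl))

def pullbackTensor {X' : C} (f : X' ⟶ X) (T T' : Torsor J F X) :
    LocalIso (tensor (pullback f T) (pullback f T')) (pullback f (tensor T T')) :=
  tensorLift
    (fun _ p p' e => pb f p.1.2 (tmul p.1.1 p'.1.1 (by
      rw [p.2, p'.2]; exact congrArg (· ≫ f) e)) p.2)
    (fun _ _ h p p' e e' => Subtype.ext (Prod.ext (res_tmul h p.1.1 p'.1.1 (by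
      rw [p.2, p'.2]; exact congrArg (· ≫ f) e)) rfl))
    (fun _ p p' e => rfl)
    (fun _ a p p' e e' => Subtype.ext (Prod.ext (act_tmul' a p.1.1 p'.1.1 (by
      rw [p.2, p'.2]; exact congrArg (· ≫ f) e)).symm rfl))
    (fun _ a p p' e e' => Subtype.ext (Prod.ext (act_tmul a p.1.1 p'.1.1 (by
      rw [p.2, p'.2]; exact congrArg (· ≫ f) e)).symm rfl))

variable (J F X) in
/-- Two torsors are equivalent when they are isomorphic. -/
def setoid : Setoid (Torsor J F X) where
  r T T' := Nonempty (Iso T T')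
  iseqv := ⟨fun T => ⟨Iso.refl T⟩, fun ⟨φ⟩ => ⟨φ.symm⟩, fun ⟨φ⟩ ⟨ψ⟩ => ⟨φ.trans ψ⟩⟩

end Torsor

section H1

variable (J : GrothendieckTopology C) (F : C) [GrpObj F] [IsCommMonObj F] (X : C)

/-- `H¹(X, F)`: the group of isomorphism classes of `F`-torsors over `X`. -/
def H1 : Type (max (u + 1) (v + 1)) := Quotient (Torsor.setoid J F X)

variable {J F X}

def H1.mk (T : Torsor J F X) : H1 J F X := Quotient.mk (Torsor.setoid J F X) T

lemma H1.mk_eq {T T' : Torsor J F X} : H1.mk T = H1.mk T' ↔ Nonempty (Torsor.Iso T T') :=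
  Quotient.eq (r := Torsor.setoid J F X)

lemma H1.sound {T T' : Torsor J F X} (φ : Torsor.Iso T T') : H1.mk T = H1.mk T' :=
  H1.mk_eq.2 ⟨φ⟩

lemma H1.ind {p : H1 J F X → Prop} (h : ∀ T, p (H1.mk T)) (x : H1 J F X) : p x :=
  Quotient.ind h x

variable [J.Subcanonical]

/-- The group law on `H¹(X, F)` is induced by the contracted product. -/
instance : CommGroup (H1 J F X) where
  mul := Quotient.map₂ Torsor.tensor fun _ _ ⟨φ⟩ _ _ ⟨ψ⟩ => ⟨Torsor.tensorMap φ ψ⟩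
  one := H1.mk (Torsor.trivial J F X)
  inv := Quotient.map Torsor.dual fun _ _ ⟨φ⟩ => ⟨Torsor.dualMap φ⟩
  mul_assoc := by
    rintro ⟨T⟩ ⟨T'⟩ ⟨T''⟩
    exact H1.sound (Torsor.tensorAssoc T T' T'').toIso
  one_mul := by
    rintro ⟨T⟩
    exact H1.sound (Torsor.trivialTensor T).toIso
  mul_one := by
    rintro ⟨T⟩
    exact H1.sound ((Torsor.tensorComm _ _).toIso.trans (Torsor.trivialTensor T).toIso)
  inv_mul_cancel := by
    rintro ⟨T⟩
    exact H1.sound (Torsor.dualTensor T).toIso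
  mul_comm := by
    rintro ⟨T⟩ ⟨T'⟩
    exact H1.sound (Torsor.tensorComm T T').toIso

lemma H1.mk_mul (T T' : Torsor J F X) : H1.mk T * H1.mk T' = H1.mk (Torsor.tensor T T') := rfl

lemma H1.mk_inv (T : Torsor J F X) : (H1.mk T)⁻¹ = H1.mk (Torsor.dual T) := rfl

/-- Pull-back of torsor classes. -/
def H1.pullback {X' : C} (f : X' ⟶ X) : H1 J F X →* H1 J F X' :=
  MonoidHom.mk' (Quotient.map (Torsor.pullback f) fun _ _ ⟨φ⟩ => ⟨Torsor.pullbackMap f φ⟩) (by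
    rintro ⟨T⟩ ⟨T'⟩
    exact (H1.sound (Torsor.pullbackTensor f T T').toIso).symm)

end H1

section Hochschild

variable (G F : C) [GrpObj G] [GrpObj F] [IsCommMonObj F]

/-- `(g₀, g₁, g₂) ↦ (g₀, g₁)`. -/
def p01 : G ⊗ G ⊗ G ⟶ G ⊗ G := lift (fst G (G ⊗ G)) (snd G (G ⊗ G) ≫ fst G G)

/-- `(g₀, g₁, g₂) ↦ (g₁, g₂)`. -/
def p12 : G ⊗ G ⊗ G ⟶ G ⊗ G := lift (snd G (G ⊗ G) ≫ fst G G) (snd G (G ⊗ G) ≫ snd G G)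

/-- `(g₀, g₁, g₂) ↦ (g₀ g₁, g₂)`. -/
def m01 : G ⊗ G ⊗ G ⟶ G ⊗ G :=
  lift (fst G (G ⊗ G) * (snd G (G ⊗ G) ≫ fst G G)) (snd G (G ⊗ G) ≫ snd G G)

/-- `(g₀, g₁, g₂) ↦ (g₀, g₁ g₂)`. -/
def m12 : G ⊗ G ⊗ G ⟶ G ⊗ G :=
  lift (fst G (G ⊗ G)) ((snd G (G ⊗ G) ≫ fst G G) * (snd G (G ⊗ G) ≫ snd G G))

/-- The Hochschild differential `d¹ : F(G) → F(G²)`,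
`(d¹ x)(g₀, g₁) = x(g₁) x(g₀ g₁)⁻¹ x(g₀)`. -/
def hd1 : (G ⟶ F) →* (G ⊗ G ⟶ F) :=
  MonoidHom.mk' (fun x => (snd G G ≫ x) * (μ[G] ≫ x)⁻¹ * (fst G G ≫ x)) fun x y => by
    simp only [MonObj.comp_mul, mul_inv]; ac_rfl

/-- The Hochschild differential `d² : F(G²) → F(G³)`,
`(d² x)(g₀, g₁, g₂) = x(g₁, g₂) x(g₀ g₁, g₂)⁻¹ x(g₀, g₁ g₂) x(g₀, g₁)⁻¹`. -/
def hd2 : (G ⊗ G ⟶ F) →* (G ⊗ G ⊗ G ⟶ F) :=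
  MonoidHom.mk' (fun x => (p12 G ≫ x) * (m01 G ≫ x)⁻¹ * (m12 G ≫ x) * (p01 G ≫ x)⁻¹)
    fun x y => by
      simp only [MonObj.comp_mul, mul_inv]; ac_rfl

/-- The Hochschild differential `d³ : F(G³) → F(G⁴)`, `(d³ x)(g₀, g₁, g₂, g₃) =
x(g₁, g₂, g₃) x(g₀ g₁, g₂, g₃)⁻¹ x(g₀, g₁ g₂, g₃) x(g₀, g₁, g₂ g₃)⁻¹ x(g₀, g₁, g₂)`. -/
def hd3 : (G ⊗ G ⊗ G ⟶ F) →* (G ⊗ G ⊗ G ⊗ G ⟶ F) :=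
  let g₀ : G ⊗ G ⊗ G ⊗ G ⟶ G := fst _ _
  let g₁ : G ⊗ G ⊗ G ⊗ G ⟶ G := snd _ _ ≫ fst _ _
  let g₂ : G ⊗ G ⊗ G ⊗ G ⟶ G := snd _ _ ≫ snd _ _ ≫ fst _ _
  let g₃ : G ⊗ G ⊗ G ⊗ G ⟶ G := snd _ _ ≫ snd _ _ ≫ snd _ _
  MonoidHom.mk' (fun x => (lift g₁ (lift g₂ g₃) ≫ x) * (lift (g₀ * g₁) (lift g₂ g₃) ≫ x)⁻¹ *
    (lift g₀ (lift (g₁ * g₂) g₃) ≫ x) * (lift g₀ (lift g₁ (g₂ * g₃)) ≫ x)⁻¹ *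
    (lift g₀ (lift g₁ g₂) ≫ x)) fun x y => by
      simp only [MonObj.comp_mul, mul_inv]; ac_rfl

/-- The second Hochschild cohomology group `ker d² / im d¹`. -/
abbrev HH2 : Type v := (hd2 G F).ker ⧸ (hd1 G F).range.subgroupOf (hd2 G F).ker

/-- The third Hochschild cohomology group `ker d³ / im d²`. -/
abbrev HH3 : Type v := (hd3 G F).ker ⧸ (hd2 G F).range.subgroupOf (hd3 G F).ker

end Hochschild

namespace Torsor

section Trivial

variable {J : GrothendieckTopology C} [J.Subcanonical] {F : C} [GrpObj F] [IsCommMonObj F] {X : C}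

variable (J F) in
/-- The unit section of the trivial torsor over a point `x` of `X`. -/
def unitAt {Y : C} (x : Y ⟶ X) : (trivial J F X).At Y := ⟨(1, x)⟩

lemma proj_unitAt {Y : C} (x : Y ⟶ X) : (trivial J F X).proj (unitAt J F x) = x := rfl

/-- The automorphism of the trivial torsor `F_X` given by multiplication by `a ∈ F(X)`. -/
def mulIso (a : X ⟶ F) : Iso (trivial J F X) (trivial J F X) where
  toEquiv :=
    { toFun := fun t => ⟨((t.down.2 ≫ a) * t.down.1, t.down.2)⟩
      invFun := fun t => ⟨((t.down.2 ≫ a)⁻¹ * t.down.1, t.down.2)⟩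
      left_inv := fun t => ULift.ext _ _ (Prod.ext (inv_mul_cancel_left _ _) rfl)
      right_inv := fun t => ULift.ext _ _ (Prod.ext (mul_inv_cancel_left _ _) rfl) }
  res_toEquiv h t := ULift.ext _ _ (Prod.ext
    ((congrArg (· * _) (Category.assoc _ _ _)).trans (MonObj.comp_mul h _ _).symm) rfl)
  proj_toEquiv _ := rfl
  toEquiv_act f t := ULift.ext _ _ (Prod.ext (mul_left_comm _ _ _) rfl)

/-- The trivialisation `F_X ≅ P` sending the unit section to a given global section `s` of `P`. -/
def ofSection (P : Torsor J F X) (s : P.At X) (hs : P.proj s = 𝟙 X) :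
    LocalIso (trivial J F X) P where
  rel Y a p := p = P.act a.down.1 (res a.down.2 s)
  rel_res := by
    rintro Y Z h a _ rfl
    rw [P.res_act, res_res]; rfl
  rel_proj := by
    rintro Y a _ rfl
    rw [P.proj_act, P.proj_res, hs, Category.comp_id]; rfl
  rel_act := by
    rintro Y f a _ rfl
    exact (P.mul_act _ _ _).symm
  rel_unique := by
    rintro Y a _ _ rfl rfl
    rfl
  rel_cover g := ⟨⊤, J.top_mem _, fun Z k _ => ⟨unitAt J F (k ≫ g), _, rfl, rfl⟩⟩

lemma proj_pb {X' : C} (f : X' ⟶ X) {T : Torsor J F X} {Y : C} (x : Y ⟶ X') (t : T.At Y)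
    (h : T.proj t = x ≫ f) : (pullback f T).proj (pb f x t h) = x := rfl

lemma res_pb {X' : C} (f : X' ⟶ X) {T : Torsor J F X} {Y Z : C} (k : Z ⟶ Y) (x : Y ⟶ X')
    (t : T.At Y) (h : T.proj t = x ≫ f) :
    res k (pb f x t h) = pb f (k ≫ x) (res k t) (by rw [T.proj_res, h, Category.assoc]) := rfl

lemma act_pb {X' : C} (f : X' ⟶ X) {T : Torsor J F X} {Y : C} (a : Y ⟶ F) (x : Y ⟶ X')
    (t : T.At Y) (h : T.proj t = x ≫ f) :
    (pullback f T).act a (pb f x t h) = pb f x (T.act a t) (by rw [T.proj_act, h]) := rfl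

/-- A section of `T` viewed as a section of the dual torsor. -/
def toDual {T : Torsor J F X} {Y : C} (t : T.At Y) : (dual T).At Y := t

lemma proj_toDual {T : Torsor J F X} {Y : C} (t : T.At Y) :
    (dual T).proj (toDual t) = T.proj t := rfl

lemma res_toDual {T : Torsor J F X} {Y Z : C} (k : Z ⟶ Y) (t : T.At Y) :
    res k (toDual t) = toDual (res k t) := rfl

lemma act_toDual {T : Torsor J F X} {Y : C} (a : Y ⟶ F) (t : T.At Y) :
    (dual T).act a (toDual t) = toDual (T.act a⁻¹ t) := rfl

end Trivial

section Delta

variable {J : GrothendieckTopology C} [J.Subcanonical] {F G : C} [GrpObj F] [IsCommMonObj F]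
  [GrpObj G]

/-- `δ¹ T = p₁^* T ⊗ (m^* T)^∨ ⊗ p₀^* T`. -/
def delta1 (T : Torsor J F G) : Torsor J F (G ⊗ G) :=
  tensor (tensor (pullback (snd G G) T) (dual (pullback μ[G] T))) (pullback (fst G G) T)

/-- `δ¹` on isomorphisms. -/
def delta1Map {T T' : Torsor J F G} (φ : Iso T T') : Iso (delta1 T) (delta1 T') :=
  tensorMap (tensorMap (pullbackMap _ φ) (dualMap (pullbackMap _ φ))) (pullbackMap _ φ)

/-- `δ² P = p₁₂^* P ⊗ (m₀₁^* P)^∨ ⊗ m₁₂^* P ⊗ (p₀₁^* P)^∨`. -/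
def delta2 (P : Torsor J F (G ⊗ G)) : Torsor J F (G ⊗ G ⊗ G) :=
  tensor (tensor (tensor (pullback (p12 G) P) (dual (pullback (m01 G) P))) (pullback (m12 G) P))
    (dual (pullback (p01 G) P))

/-- `δ²` on isomorphisms. -/
def delta2Map {P P' : Torsor J F (G ⊗ G)} (φ : Iso P P') : Iso (delta2 P) (delta2 P') :=
  tensorMap (tensorMap (tensorMap (pullbackMap _ φ) (dualMap (pullbackMap _ φ)))
    (pullbackMap _ φ)) (dualMap (pullbackMap _ φ))

/-- The section `t₁ ⊗ t₀₁^∨ ⊗ t₀` of `δ¹ T` over a point `x = (g₀, g₁)` of `G²`, for sections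
`t₁`, `t₀₁`, `t₀` of `T` over `g₁`, `g₀ g₁`, `g₀`. -/
def delta1Tmul {T : Torsor J F G} {Y : C} (x : Y ⟶ G ⊗ G) (t₁ t₀₁ t₀ : T.At Y)
    (h₁ : T.proj t₁ = x ≫ snd G G) (h₀₁ : T.proj t₀₁ = x ≫ μ[G]) (h₀ : T.proj t₀ = x ≫ fst G G) :
    (delta1 T).At Y :=
  tmul (tmul (pb (snd G G) x t₁ h₁) (toDual (pb μ[G] x t₀₁ h₀₁)) rfl) (pb (fst G G) x t₀ h₀) rfl

/-- The section `s₁₂ ⊗ s₀₁'^∨ ⊗ s₁₂' ⊗ s₀₁^∨` of `δ² P` over a point `x = (g₀, g₁, g₂)` of `G³`,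
for sections of `P` over `(g₁, g₂)`, `(g₀ g₁, g₂)`, `(g₀, g₁ g₂)`, `(g₀, g₁)`. -/
def delta2Tmul {P : Torsor J F (G ⊗ G)} {Y : C} (x : Y ⟶ G ⊗ G ⊗ G) (s₁₂ s₀₁' s₁₂' s₀₁ : P.At Y)
    (h₁₂ : P.proj s₁₂ = x ≫ p12 G) (h₀₁' : P.proj s₀₁' = x ≫ m01 G)
    (h₁₂' : P.proj s₁₂' = x ≫ m12 G) (h₀₁ : P.proj s₀₁ = x ≫ p01 G) : (delta2 P).At Y :=
  tmul (tmul (tmul (pb (p12 G) x s₁₂ h₁₂) (toDual (pb (m01 G) x s₀₁' h₀₁')) rfl)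
    (pb (m12 G) x s₁₂' h₁₂') rfl) (toDual (pb (p01 G) x s₀₁ h₀₁)) rfl

lemma proj_delta1Tmul {T : Torsor J F G} {Y : C} (x : Y ⟶ G ⊗ G) (t₁ t₀₁ t₀ : T.At Y)
    (h₁ h₀₁ h₀) : (delta1 T).proj (delta1Tmul x t₁ t₀₁ t₀ h₁ h₀₁ h₀) = x := rfl

lemma proj_delta2Tmul {P : Torsor J F (G ⊗ G)} {Y : C} (x : Y ⟶ G ⊗ G ⊗ G)
    (s₁₂ s₀₁' s₁₂' s₀₁ : P.At Y) (h₁₂ h₀₁' h₁₂' h₀₁) :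
    (delta2 P).proj (delta2Tmul x s₁₂ s₀₁' s₁₂' s₀₁ h₁₂ h₀₁' h₁₂' h₀₁) = x := rfl

lemma res_delta1Tmul {T : Torsor J F G} {Y Z : C} (k : Z ⟶ Y) (x : Y ⟶ G ⊗ G)
    (t₁ t₀₁ t₀ : T.At Y) (h₁ h₀₁ h₀) :
    res k (delta1Tmul x t₁ t₀₁ t₀ h₁ h₀₁ h₀) = delta1Tmul (k ≫ x) (res k t₁) (res k t₀₁) (res k t₀)
      (by rw [T.proj_res, h₁, Category.assoc]) (by rw [T.proj_res, h₀₁, Category.assoc])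
      (by rw [T.proj_res, h₀, Category.assoc]) := by
  refine (res_tmul k _ _ _).trans ?_
  congr 1
  exact res_tmul k _ _ _

lemma res_delta2Tmul {P : Torsor J F (G ⊗ G)} {Y Z : C} (k : Z ⟶ Y) (x : Y ⟶ G ⊗ G ⊗ G)
    (s₁₂ s₀₁' s₁₂' s₀₁ : P.At Y) (h₁₂ h₀₁' h₁₂' h₀₁) :
    res k (delta2Tmul x s₁₂ s₀₁' s₁₂' s₀₁ h₁₂ h₀₁' h₁₂' h₀₁) =
      delta2Tmul (k ≫ x) (res k s₁₂) (res k s₀₁') (res k s₁₂') (res k s₀₁)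
      (by rw [P.proj_res, h₁₂, Category.assoc]) (by rw [P.proj_res, h₀₁', Category.assoc])
      (by rw [P.proj_res, h₁₂', Category.assoc]) (by rw [P.proj_res, h₀₁, Category.assoc]) := by
  refine (res_tmul k _ _ _).trans ?_
  congr 1
  refine (res_tmul k _ _ _).trans ?_
  congr 1
  exact res_tmul k _ _ _

lemma tmul_act_act {X : C} {T T' : Torsor J F X} {Y : C} {f g : Y ⟶ F} {t s : T.At Y}
    {t' s' : T'.At Y} (h : s = T.act f t) (h' : s' = T'.act g t') (e e') :
    tmul s s' e' = (tensor T T').act (f * g) (tmul t t' e) := by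
  subst h h'
  rw [Torsor.mul_act, act_tmul, act_tmul']

lemma delta1Tmul_act {T : Torsor J F G} {Y : C} (x : Y ⟶ G ⊗ G) {t₁ t₀₁ t₀ s₁ s₀₁ s₀ : T.At Y}
    (h₁ h₀₁ h₀) {f₁ f₀₁ f₀ : Y ⟶ F} (h₁' h₀₁' h₀') (e₁ : s₁ = T.act f₁ t₁)
    (e₀₁ : s₀₁ = T.act f₀₁ t₀₁) (e₀ : s₀ = T.act f₀ t₀) :
    delta1Tmul x s₁ s₀₁ s₀ h₁' h₀₁' h₀' =
      (delta1 T).act (f₁ * f₀₁⁻¹ * f₀) (delta1Tmul x t₁ t₀₁ t₀ h₁ h₀₁ h₀) := by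
  subst e₁ e₀₁ e₀
  refine tmul_act_act (T := tensor (pullback (snd G G) T) (dual (pullback μ[G] T)))
    (T' := pullback (fst G G) T) (f := f₁ * f₀₁⁻¹) (g := f₀) ?_ (act_pb _ _ _ _ _).symm _ _
  refine tmul_act_act (T := pullback (snd G G) T) (T' := dual (pullback μ[G] T))
    (f := f₁) (g := f₀₁⁻¹) (act_pb _ _ _ _ _).symm ?_ _ _
  rw [act_toDual, inv_inv, act_pb]

lemma delta2Tmul_act {P : Torsor J F (G ⊗ G)} {Y : C} (x : Y ⟶ G ⊗ G ⊗ G)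
    {s₁₂ s₀₁' s₁₂' s₀₁ r₁₂ r₀₁' r₁₂' r₀₁ : P.At Y} (h₁₂ h₀₁' h₁₂' h₀₁)
    {f₁₂ f₀₁' f₁₂' f₀₁ : Y ⟶ F} (k₁₂ k₀₁' k₁₂' k₀₁) (e₁₂ : r₁₂ = P.act f₁₂ s₁₂)
    (e₀₁' : r₀₁' = P.act f₀₁' s₀₁') (e₁₂' : r₁₂' = P.act f₁₂' s₁₂') (e₀₁ : r₀₁ = P.act f₀₁ s₀₁) :
    delta2Tmul x r₁₂ r₀₁' r₁₂' r₀₁ k₁₂ k₀₁' k₁₂' k₀₁ =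
      (delta2 P).act (f₁₂ * f₀₁'⁻¹ * f₁₂' * f₀₁⁻¹)
        (delta2Tmul x s₁₂ s₀₁' s₁₂' s₀₁ h₁₂ h₀₁' h₁₂' h₀₁) := by
  subst e₁₂ e₀₁' e₁₂' e₀₁
  refine tmul_act_act
    (T := tensor (tensor (pullback (p12 G) P) (dual (pullback (m01 G) P))) (pullback (m12 G) P))
    (T' := dual (pullback (p01 G) P)) (f := f₁₂ * f₀₁'⁻¹ * f₁₂') (g := f₀₁⁻¹) ?_ ?_ _ _
  · refine tmul_act_act (T := tensor (pullback (p12 G) P) (dual (pullback (m01 G) P)))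
      (T' := pullback (m12 G) P) (f := f₁₂ * f₀₁'⁻¹) (g := f₁₂') ?_
      (act_pb _ _ _ _ _).symm _ _
    refine tmul_act_act (T := pullback (p12 G) P) (T' := dual (pullback (m01 G) P))
      (f := f₁₂) (g := f₀₁'⁻¹) (act_pb _ _ _ _ _).symm ?_ _ _
    rw [act_toDual, inv_inv, act_pb]
  · rw [act_toDual, inv_inv, act_pb]

/-- Sections of `T` over the six points `g₀, g₁, g₂, g₀ g₁, g₁ g₂, g₀ g₁ g₂` of `G` attached to a
point `x = (g₀, g₁, g₂)` of `G³`. -/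
structure Six (T : Torsor J F G) {Y : C} (x : Y ⟶ G ⊗ G ⊗ G) where
  (t₀ t₁ t₂ t₀₁ t₁₂ t₀₁₂ : T.At Y)
  h₀ : T.proj t₀ = x ≫ fst _ _
  h₁ : T.proj t₁ = x ≫ snd _ _ ≫ fst _ _
  h₂ : T.proj t₂ = x ≫ snd _ _ ≫ snd _ _
  h₀₁ : T.proj t₀₁ = T.proj t₀ * T.proj t₁
  h₁₂ : T.proj t₁₂ = T.proj t₁ * T.proj t₂
  h₀₁₂ : T.proj t₀₁₂ = T.proj t₀ * T.proj t₁ * T.proj t₂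

lemma comp_mul_eq {Y : C} (x : Y ⟶ G ⊗ G) : x ≫ μ[G] = (x ≫ fst G G) * (x ≫ snd G G) := by
  rw [MonObj.mul_eq_mul, MonObj.comp_mul]

namespace Six

variable {T : Torsor J F G} {Y : C} {x : Y ⟶ G ⊗ G ⊗ G} (a : Six T x)

/-- `t₂ ⊗ t₁₂^∨ ⊗ t₁`, a section of `δ¹ T` over `(g₁, g₂)`. -/
def s₁₂ : (delta1 T).At Y :=
  delta1Tmul (x ≫ p12 G) a.t₂ a.t₁₂ a.t₁ (by simp [p12, a.h₂])
    (by simp [comp_mul_eq, p12, a.h₁₂, a.h₁, a.h₂]) (by simp [p12, a.h₁])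

/-- `t₂ ⊗ t₀₁₂^∨ ⊗ t₀₁`, a section of `δ¹ T` over `(g₀ g₁, g₂)`. -/
def s₀₁' : (delta1 T).At Y :=
  delta1Tmul (x ≫ m01 G) a.t₂ a.t₀₁₂ a.t₀₁ (by simp [m01, a.h₂])
    (by simp [comp_mul_eq, m01, a.h₀₁₂, a.h₀, a.h₁, a.h₂, MonObj.comp_mul])
    (by simp [m01, a.h₀₁, a.h₀, a.h₁, MonObj.comp_mul])

/-- `t₁₂ ⊗ t₀₁₂^∨ ⊗ t₀`, a section of `δ¹ T` over `(g₀, g₁ g₂)`. -/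
def s₁₂' : (delta1 T).At Y :=
  delta1Tmul (x ≫ m12 G) a.t₁₂ a.t₀₁₂ a.t₀
    (by simp [m12, a.h₁₂, a.h₁, a.h₂, MonObj.comp_mul])
    (by simp [comp_mul_eq, m12, a.h₀₁₂, a.h₀, a.h₁, a.h₂, MonObj.comp_mul, mul_assoc])
    (by simp [m12, a.h₀])

/-- `t₁ ⊗ t₀₁^∨ ⊗ t₀`, a section of `δ¹ T` over `(g₀, g₁)`. -/
def s₀₁ : (delta1 T).At Y :=
  delta1Tmul (x ≫ p01 G) a.t₁ a.t₀₁ a.t₀ (by simp [p01, a.h₁])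
    (by simp [comp_mul_eq, p01, a.h₀₁, a.h₀, a.h₁]) (by simp [p01, a.h₀])

/-- Restriction of the six sections. -/
def map {Z : C} (k : Z ⟶ Y) : Six T (k ≫ x) where
  t₀ := res k a.t₀
  t₁ := res k a.t₁
  t₂ := res k a.t₂
  t₀₁ := res k a.t₀₁
  t₁₂ := res k a.t₁₂
  t₀₁₂ := res k a.t₀₁₂
  h₀ := by rw [T.proj_res, a.h₀, Category.assoc]
  h₁ := by rw [T.proj_res, a.h₁, Category.assoc]
  h₂ := by rw [T.proj_res, a.h₂, Category.assoc]
  h₀₁ := by simp only [T.proj_res, a.h₀₁, MonObj.comp_mul]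
  h₁₂ := by simp only [T.proj_res, a.h₁₂, MonObj.comp_mul]
  h₀₁₂ := by simp only [T.proj_res, a.h₀₁₂, MonObj.comp_mul]

end Six

lemma delta1Tmul_congr {T : Torsor J F G} {Y : C} {x x' : Y ⟶ G ⊗ G} (e : x = x')
    (t₁ t₀₁ t₀ : T.At Y) (h₁ h₀₁ h₀ h₁' h₀₁' h₀') :
    delta1Tmul x t₁ t₀₁ t₀ h₁ h₀₁ h₀ = delta1Tmul x' t₁ t₀₁ t₀ h₁' h₀₁' h₀' := by
  subst e; rfl

/-- The section of `δ² (δ¹ T)` over `(g₀, g₁, g₂)` obtained by tensoring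
`t₂ ⊗ t₁₂^∨ ⊗ t₁`, `(t₂ ⊗ t₀₁₂^∨ ⊗ t₀₁)^∨`, `t₁₂ ⊗ t₀₁₂^∨ ⊗ t₀`, `(t₁ ⊗ t₀₁^∨ ⊗ t₀)^∨`.
Every factor occurs together with its dual. -/
def kappaTmul {T : Torsor J F G} {Y : C} {x : Y ⟶ G ⊗ G ⊗ G} (a : Six T x) :
    (delta2 (delta1 T)).At Y :=
  delta2Tmul x a.s₁₂ a.s₀₁' a.s₁₂' a.s₀₁
    (proj_delta1Tmul _ _ _ _ _ _ _) (proj_delta1Tmul _ _ _ _ _ _ _)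
    (proj_delta1Tmul _ _ _ _ _ _ _) (proj_delta1Tmul _ _ _ _ _ _ _)

lemma kappa_cancel {A : Type*} [CommGroup A] (a₀ a₁ a₂ a₀₁ a₁₂ a₀₁₂ : A) :
    (a₂ * a₁₂⁻¹ * a₁) * (a₂ * a₀₁₂⁻¹ * a₀₁)⁻¹ * (a₁₂ * a₀₁₂⁻¹ * a₀) * (a₁ * a₀₁⁻¹ * a₀)⁻¹ = 1 := by
  have h (a₀ a₁ a₂ a₀₁ a₁₂ a₀₁₂ : Additive A) : (a₂ + -a₁₂ + a₁) + -(a₂ + -a₀₁₂ + a₀₁) +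
      (a₁₂ + -a₀₁₂ + a₀) + -(a₁ + -a₀₁ + a₀) = 0 := by abel
  exact h a₀ a₁ a₂ a₀₁ a₁₂ a₀₁₂

/-- The section `kappaTmul` does not depend on the choice of the six sections. -/
lemma kappaTmul_eq {T : Torsor J F G} {Y : C} {x : Y ⟶ G ⊗ G ⊗ G} (a b : Six T x) :
    kappaTmul a = kappaTmul b := by
  obtain ⟨f₀, e₀⟩ := T.exists_act (a.h₀.trans b.h₀.symm)
  obtain ⟨f₁, e₁⟩ := T.exists_act (a.h₁.trans b.h₁.symm)
  obtain ⟨f₂, e₂⟩ := T.exists_act (a.h₂.trans b.h₂.symm)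
  obtain ⟨f₀₁, e₀₁⟩ := T.exists_act (t := a.t₀₁) (t' := b.t₀₁)
    (by rw [a.h₀₁, b.h₀₁, a.h₀, a.h₁, b.h₀, b.h₁])
  obtain ⟨f₁₂, e₁₂⟩ := T.exists_act (t := a.t₁₂) (t' := b.t₁₂)
    (by rw [a.h₁₂, b.h₁₂, a.h₁, a.h₂, b.h₁, b.h₂])
  obtain ⟨f₀₁₂, e₀₁₂⟩ := T.exists_act (t := a.t₀₁₂) (t' := b.t₀₁₂)
    (by rw [a.h₀₁₂, b.h₀₁₂, a.h₀, a.h₁, a.h₂, b.h₀, b.h₁, b.h₂])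
  have h := delta2Tmul_act x (P := delta1 T) (s₁₂ := a.s₁₂) (s₀₁' := a.s₀₁') (s₁₂' := a.s₁₂')
    (s₀₁ := a.s₀₁) (r₁₂ := b.s₁₂) (r₀₁' := b.s₀₁') (r₁₂' := b.s₁₂') (r₀₁ := b.s₀₁)
    (proj_delta1Tmul _ _ _ _ _ _ _)
    (proj_delta1Tmul _ _ _ _ _ _ _) (proj_delta1Tmul _ _ _ _ _ _ _)
    (proj_delta1Tmul _ _ _ _ _ _ _) (proj_delta1Tmul _ _ _ _ _ _ _)
    (proj_delta1Tmul _ _ _ _ _ _ _) (proj_delta1Tmul _ _ _ _ _ _ _)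
    (proj_delta1Tmul _ _ _ _ _ _ _)
    (delta1Tmul_act (x ≫ p12 G) _ _ _ _ _ _ e₂ e₁₂ e₁)
    (delta1Tmul_act (x ≫ m01 G) _ _ _ _ _ _ e₂ e₀₁₂ e₀₁)
    (delta1Tmul_act (x ≫ m12 G) _ _ _ _ _ _ e₁₂ e₀₁₂ e₀)
    (delta1Tmul_act (x ≫ p01 G) _ _ _ _ _ _ e₁ e₀₁ e₀)
  rw [kappa_cancel, Torsor.one_act] at h
  exact h.symm

lemma res_kappaTmul {T : Torsor J F G} {Y Z : C} (k : Z ⟶ Y) {x : Y ⟶ G ⊗ G ⊗ G} (a : Six T x) :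
    res k (kappaTmul a) = kappaTmul (a.map k) := by
  refine (res_delta2Tmul k _ _ _ _ _ _ _ _ _).trans ?_
  have h₁₂ : res k a.s₁₂ = (a.map k).s₁₂ :=
    (res_delta1Tmul k _ _ _ _ _ _ _).trans
      (delta1Tmul_congr (Category.assoc _ _ _).symm _ _ _ _ _ _ _ _ _)
  have h₀₁' : res k a.s₀₁' = (a.map k).s₀₁' :=
    (res_delta1Tmul k _ _ _ _ _ _ _).trans
      (delta1Tmul_congr (Category.assoc _ _ _).symm _ _ _ _ _ _ _ _ _)
  have h₁₂' : res k a.s₁₂' = (a.map k).s₁₂' :=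
    (res_delta1Tmul k _ _ _ _ _ _ _).trans
      (delta1Tmul_congr (Category.assoc _ _ _).symm _ _ _ _ _ _ _ _ _)
  have h₀₁ : res k a.s₀₁ = (a.map k).s₀₁ :=
    (res_delta1Tmul k _ _ _ _ _ _ _).trans
      (delta1Tmul_congr (Category.assoc _ _ _).symm _ _ _ _ _ _ _ _ _)
  unfold kappaTmul
  congr 1

/-- The canonical trivialisation `κ_T : F_{G³} ≅ δ² (δ¹ T)`, which sends the unit section to the
section obtained by gluing the local sections `kappaTmul`. -/
def kappaLocal (T : Torsor J F G) : LocalIso (trivial J F (G ⊗ G ⊗ G)) (delta2 (delta1 T)) where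
  rel Y a p := ∃ s : Six T a.down.2, p = (delta2 (delta1 T)).act a.down.1 (kappaTmul s)
  rel_res := by
    rintro Y Z h a _ ⟨s, rfl⟩
    exact ⟨s.map h, ((delta2 (delta1 T)).res_act _ _ _).trans
      (congrArg ((delta2 (delta1 T)).act _) (res_kappaTmul h s))⟩
  rel_proj := by
    rintro Y a _ ⟨s, rfl⟩
    rfl
  rel_act := by
    rintro Y f a _ ⟨s, rfl⟩
    exact ⟨s, (Torsor.mul_act _ _ _ _).symm⟩
  rel_unique := by
    rintro Y a _ _ ⟨s, rfl⟩ ⟨s', rfl⟩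
    rw [kappaTmul_eq s s']
  rel_cover {Y} g := by
    obtain ⟨A₀, hA₀, e₀⟩ := T.locally_nonempty (g ≫ fst _ _)
    obtain ⟨A₁, hA₁, e₁⟩ := T.locally_nonempty (g ≫ snd _ _ ≫ fst _ _)
    obtain ⟨A₂, hA₂, e₂⟩ := T.locally_nonempty (g ≫ snd _ _ ≫ snd _ _)
    obtain ⟨A₃, hA₃, e₃⟩ := T.locally_nonempty ((g ≫ fst _ _) * (g ≫ snd _ _ ≫ fst _ _))
    obtain ⟨A₄, hA₄, e₄⟩ :=
      T.locally_nonempty ((g ≫ snd _ _ ≫ fst _ _) * (g ≫ snd _ _ ≫ snd _ _))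
    obtain ⟨A₅, hA₅, e₅⟩ := T.locally_nonempty
      ((g ≫ fst _ _) * (g ≫ snd _ _ ≫ fst _ _) * (g ≫ snd _ _ ≫ snd _ _))
    refine ⟨(A₀ ⊓ (A₁ ⊓ A₂)) ⊓ (A₃ ⊓ (A₄ ⊓ A₅)), J.intersection_covering
      (J.intersection_covering hA₀ (J.intersection_covering hA₁ hA₂))
      (J.intersection_covering hA₃ (J.intersection_covering hA₄ hA₅)), fun Z k hk => ?_⟩
    obtain ⟨⟨k₀, k₁, k₂⟩, k₃, k₄, k₅⟩ := hk
    obtain ⟨t₀, i₀⟩ := e₀ k k₀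
    obtain ⟨t₁, i₁⟩ := e₁ k k₁
    obtain ⟨t₂, i₂⟩ := e₂ k k₂
    obtain ⟨t₃, i₃⟩ := e₃ k k₃
    obtain ⟨t₄, i₄⟩ := e₄ k k₄
    obtain ⟨t₅, i₅⟩ := e₅ k k₅
    let s : Six T (k ≫ g) := ⟨t₀, t₁, t₂, t₃, t₄, t₅, by rw [i₀, Category.assoc],
      by rw [i₁, Category.assoc], by rw [i₂, Category.assoc],
      by rw [i₃, i₀, i₁, MonObj.comp_mul], by rw [i₄, i₁, i₂, MonObj.comp_mul],
      by rw [i₅, i₀, i₁, i₂, MonObj.comp_mul, MonObj.comp_mul]⟩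
    exact ⟨unitAt J F (k ≫ g), _, ⟨s, rfl⟩, rfl⟩

/-- The canonical trivialisation `κ_T` of `δ² (δ¹ T)`. -/
def kappa (T : Torsor J F G) : Iso (trivial J F (G ⊗ G ⊗ G)) (delta2 (delta1 T)) :=
  (kappaLocal T).toIso

variable (J F G) in
/-- The canonical isomorphism `F_{G²} ≅ δ¹ F_G`, sending `1` to `1 ⊗ 1^∨ ⊗ 1`. -/
def delta1Trivial : Iso (trivial J F (G ⊗ G)) (delta1 (trivial J F G)) :=
  (ofSection _ (delta1Tmul (𝟙 (G ⊗ G)) (unitAt J F (snd G G)) (unitAt J F μ[G])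
    (unitAt J F (fst G G)) (Category.id_comp _).symm (Category.id_comp _).symm
    (Category.id_comp _).symm) rfl).toIso

variable (J F G) in
/-- The canonical isomorphism `F_{G³} ≅ δ² F_{G²}`, sending `1` to `1 ⊗ 1^∨ ⊗ 1 ⊗ 1^∨`. -/
def delta2Trivial : Iso (trivial J F (G ⊗ G ⊗ G)) (delta2 (trivial J F (G ⊗ G))) :=
  (ofSection _ (delta2Tmul (𝟙 (G ⊗ G ⊗ G)) (unitAt J F (p12 G)) (unitAt J F (m01 G))
    (unitAt J F (m12 G)) (unitAt J F (p01 G)) (Category.id_comp _).symm (Category.id_comp _).symm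
    (Category.id_comp _).symm (Category.id_comp _).symm) rfl).toIso

/-- For a trivialisation `τ : F_{G²} ≅ δ¹ T`, this says that `a ∈ F(G³)` is the element `u_τ`: the
composition `F_{G³} ≅ δ² F_{G²} ≅ δ² (δ¹ T) ≅ F_{G³}` of the canonical isomorphism, `δ² τ` and
`κ_T⁻¹` equals multiplication by `a`. -/
def IsObstruction (T : Torsor J F G) (τ : Iso (trivial J F (G ⊗ G)) (delta1 T))
    (a : G ⊗ G ⊗ G ⟶ F) : Prop :=
  ∀ (Y : C) (t : (trivial J F (G ⊗ G ⊗ G)).At Y),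
    (((delta2Trivial J F G).trans (delta2Map τ)).trans (kappa T).symm).toEquiv t =
      (mulIso a).toEquiv t

end Delta

end Torsor

section K

variable (J : GrothendieckTopology C) [J.Subcanonical] (F G : C) [GrpObj F] [IsCommMonObj F]
  [GrpObj G]

/-- The map `d¹ : H¹(G, F) → H¹(G², F)` induced by the functor `δ¹`. -/
def H1.d1 : H1 J F G →* H1 J F (G ⊗ G) where
  toFun := Quotient.map Torsor.delta1 fun _ _ ⟨φ⟩ => ⟨Torsor.delta1Map φ⟩
  map_one' := H1.sound (Torsor.delta1Trivial J F G).symm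
  map_mul' := by
    rintro ⟨T⟩ ⟨T'⟩
    have h : ∀ T : Torsor J F G, H1.mk (Torsor.delta1 T) = H1.pullback (snd G G) (H1.mk T) *
      (H1.pullback μ[G] (H1.mk T))⁻¹ * H1.pullback (fst G G) (H1.mk T) := fun _ => rfl
    change H1.mk (Torsor.delta1 (Torsor.tensor T T')) =
      H1.mk (Torsor.delta1 T) * H1.mk (Torsor.delta1 T')
    simp only [h, ← H1.mk_mul, map_mul, mul_inv]
    ac_rfl

/-- `K(G, F)`, the kernel of `d¹ : H¹(G, F) → H¹(G², F)`. -/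
def K : Subgroup (H1 J F G) := (H1.d1 J F G).ker

end K

/-- A central extension `1 → F → E → G → 1` of sheaves of groups on the site `(C, J)`: a sheaf of
groups `E` (the sheaf `sec` with group structures compatible with restriction), an injective
homomorphism `incl : F → E` with central image, and a homomorphism `proj : E → G` with kernel the
image of `incl`, which is an epimorphism of sheaves, i.e. locally surjective. -/
structure CentralExt (J : GrothendieckTopology C) (F G : C) [GrpObj F] [IsCommMonObj F]
    [GrpObj G] where
  sec : Cᵒᵖ ⥤ Type (max u v)
  isSheaf : Presieve.IsSheaf J sec
  [group : ∀ Y : C, Group (sec.obj (op Y))]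
  res_mul : ∀ {Y Z : C} (h : Z ⟶ Y) (a b : sec.obj (op Y)), res h (a * b) = res h a * res h b
  incl : ∀ {Y : C}, (Y ⟶ F) →* sec.obj (op Y)
  res_incl : ∀ {Y Z : C} (h : Z ⟶ Y) (f : Y ⟶ F), res h (incl f) = incl (h ≫ f)
  proj : ∀ {Y : C}, sec.obj (op Y) →* (Y ⟶ G)
  proj_res : ∀ {Y Z : C} (h : Z ⟶ Y) (a : sec.obj (op Y)), proj (res h a) = h ≫ proj a
  incl_injective : ∀ {Y : C}, Function.Injective (incl (Y := Y))
  proj_eq_one_iff : ∀ {Y : C} (a : sec.obj (op Y)), proj a = 1 ↔ ∃ f, incl f = a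
  proj_locally_surjective : ∀ {Y : C} (g : Y ⟶ G), ∃ R ∈ J Y, ∀ ⦃Z : C⦄ (k : Z ⟶ Y), R k →
    ∃ a : sec.obj (op Z), proj a = k ≫ g
  central : ∀ {Y : C} (f : Y ⟶ F) (a : sec.obj (op Y)), incl f * a = a * incl f

namespace CentralExt

variable {J : GrothendieckTopology C} {F G : C} [GrpObj F] [IsCommMonObj F] [GrpObj G]

/-- Sections over `Y`. -/
abbrev At (E : CentralExt J F G) (Y : C) : Type (max u v) := E.sec.obj (op Y)

instance (E : CentralExt J F G) (Y : C) : Group (E.sec.obj (op Y)) := E.group Y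

lemma proj_incl (E : CentralExt J F G) {Y : C} (f : Y ⟶ F) : E.proj (E.incl f) = 1 :=
  (E.proj_eq_one_iff _).2 ⟨f, rfl⟩

lemma mul_mul_eq (E : CentralExt J F G) {Y : C} (f g : Y ⟶ F) (a b : E.At Y) :
    (E.incl f * a) * (E.incl g * b) = E.incl (f * g) * (a * b) := by
  rw [map_mul, mul_assoc, mul_assoc, ← mul_assoc a, ← E.central g a, mul_assoc]

lemma inv_mul_eq (E : CentralExt J F G) {Y : C} (f : Y ⟶ F) (a : E.At Y) :
    (E.incl f * a)⁻¹ = E.incl f⁻¹ * a⁻¹ := by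
  rw [mul_inv_rev, ← map_inv, E.central]

lemma res_one (E : CentralExt J F G) {Y Z : C} (h : Z ⟶ Y) : res h (1 : E.At Y) = 1 := by
  rw [← map_one E.incl, E.res_incl, MonObj.comp_one, map_one]

lemma res_inv (E : CentralExt J F G) {Y Z : C} (h : Z ⟶ Y) (a : E.At Y) :
    res h a⁻¹ = (res h a)⁻¹ := by
  rw [eq_inv_iff_mul_eq_one, ← E.res_mul, inv_mul_cancel, E.res_one]

/-- A central extension of `G` by `F` as an `F`-torsor over `G`. -/
abbrev torsor (E : CentralExt J F G) : Torsor J F G where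
  sec := E.sec
  isSheaf := E.isSheaf
  proj a := E.proj a
  proj_res := E.proj_res
  act f a := E.incl f * a
  one_act a := by rw [map_one, one_mul]
  mul_act f g a := by rw [map_mul, mul_assoc]
  res_act h f a := by rw [E.res_mul, E.res_incl]
  proj_act f a := by rw [map_mul, E.proj_incl, one_mul]
  simply_transitive a b e := by
    obtain ⟨f, hf⟩ := (E.proj_eq_one_iff (b * a⁻¹)).1 (by rw [map_mul, map_inv, e, mul_inv_cancel])
    refine ⟨f, by simp only [hf, inv_mul_cancel_right], fun g hg => E.incl_injective ?_⟩
    rw [hf, ← hg, mul_inv_cancel_right]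
  locally_nonempty := E.proj_locally_surjective

/-- Isomorphisms of central extensions of `G` by `F`. -/
structure Iso (E E' : CentralExt J F G) where
  toMulEquiv : ∀ {Y : C}, E.At Y ≃* E'.At Y
  res_toMulEquiv : ∀ {Y Z : C} (h : Z ⟶ Y) (a : E.At Y),
    toMulEquiv (res h a) = res h (toMulEquiv a)
  toMulEquiv_incl : ∀ {Y : C} (f : Y ⟶ F), toMulEquiv (E.incl f) = E'.incl f
  proj_toMulEquiv : ∀ {Y : C} (a : E.At Y), E'.proj (toMulEquiv a) = E.proj a

namespace Iso

def refl (E : CentralExt J F G) : Iso E E where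
  toMulEquiv := MulEquiv.refl _
  res_toMulEquiv _ _ := rfl
  toMulEquiv_incl _ := rfl
  proj_toMulEquiv _ := rfl

def symm {E E' : CentralExt J F G} (φ : Iso E E') : Iso E' E where
  toMulEquiv := φ.toMulEquiv.symm
  res_toMulEquiv h t := by
    rw [MulEquiv.symm_apply_eq, φ.res_toMulEquiv, MulEquiv.apply_symm_apply]
  toMulEquiv_incl f := by
    rw [MulEquiv.symm_apply_eq, φ.toMulEquiv_incl]
  proj_toMulEquiv t := by
    rw [← φ.proj_toMulEquiv, MulEquiv.apply_symm_apply]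

def trans {E E' E'' : CentralExt J F G} (φ : Iso E E') (ψ : Iso E' E'') : Iso E E'' where
  toMulEquiv := φ.toMulEquiv.trans ψ.toMulEquiv
  res_toMulEquiv h t := by simp [φ.res_toMulEquiv, ψ.res_toMulEquiv]
  toMulEquiv_incl f := by simp [φ.toMulEquiv_incl, ψ.toMulEquiv_incl]
  proj_toMulEquiv t := by simp [φ.proj_toMulEquiv, ψ.proj_toMulEquiv]

/-- The isomorphism of torsors underlying an isomorphism of central extensions. -/
def torsor {E E' : CentralExt J F G} (φ : Iso E E') : Torsor.Iso E.torsor E'.torsor where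
  toEquiv := φ.toMulEquiv.toEquiv
  res_toEquiv := φ.res_toMulEquiv
  proj_toEquiv := φ.proj_toMulEquiv
  toEquiv_act f a := (map_mul φ.toMulEquiv _ _).trans (congrArg (· * _) (φ.toMulEquiv_incl f))

/-- A compatible family of bijections that is locally multiplicative and compatible with the
inclusions of `F` is an isomorphism of extensions. -/
def ofTorsor {E E' : CentralExt J F G} (ψ : ∀ {Y : C}, E.At Y ≃ E'.At Y)
    (hres : ∀ {Y Z : C} (h : Z ⟶ Y) (a : E.At Y), ψ (res h a) = res h (ψ a))
    (hincl : ∀ {Y : C} (f : Y ⟶ F), ψ (E.incl f) = E'.incl f)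
    (hproj : ∀ {Y : C} (a : E.At Y), E'.proj (ψ a) = E.proj a)
    (V : ∀ ⦃Y : C⦄, E.At Y → E'.At Y → Prop)
    (hV : ∀ {Y : C} {a : E.At Y} {a' : E'.At Y}, V a a' → ψ a = a')
    (cover : ∀ {Y : C} (a : E.At Y), ∃ R ∈ J Y, ∀ ⦃Z : C⦄ (k : Z ⟶ Y), R k → ∃ a', V (res k a) a')
    (hmul : ∀ {Y : C} {a b : E.At Y} {a' b' : E'.At Y}, V a a' → V b b' → V (a * b) (a' * b')) :
    Iso E E' where
  toMulEquiv {Y} :=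
    { ψ (Y := Y) with
      map_mul' := fun a b => by
        obtain ⟨R, hR, ha⟩ := cover a
        obtain ⟨R', hR', hb⟩ := cover b
        refine sheaf_ext E'.isSheaf (J.intersection_covering hR hR') fun Z k hk => ?_
        obtain ⟨a', ha'⟩ := ha k hk.1
        obtain ⟨b', hb'⟩ := hb k hk.2
        change res k (ψ (a * b)) = res k (ψ a * ψ b)
        rw [E'.res_mul, ← hres, ← hres, ← hres, E.res_mul, hV ha', hV hb', hV (hmul ha' hb')] }
  res_toMulEquiv := hres
  toMulEquiv_incl := hincl
  proj_toMulEquiv := hproj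

end Iso

variable [J.Subcanonical]

variable (J F G) in
/-- The product group structure on the sections of `F × G`. -/
@[reducible]
def trivialGroup (Y : C) : Group ((Torsor.trivial J F G).sec.obj (op Y)) :=
  inferInstanceAs (Group (ULift.{u} ((Y ⟶ F) × (Y ⟶ G))))

attribute [local instance] trivialGroup

variable (J F G) in
/-- The trivial extension `F × G`. -/
def trivial : CentralExt J F G where
  sec := (Torsor.trivial J F G).sec
  isSheaf := (Torsor.trivial J F G).isSheaf
  group := trivialGroup J F G
  res_mul h a b := ULift.ext _ _ (Prod.ext (MonObj.comp_mul h _ _) (MonObj.comp_mul h _ _))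
  incl {Y} := MonoidHom.mk' (fun f => (⟨(f, 1)⟩ : ULift.{u} ((Y ⟶ F) × (Y ⟶ G))))
    fun f g => ULift.ext _ _ (Prod.ext rfl (mul_one _).symm)
  res_incl h f := ULift.ext _ _ (Prod.ext rfl (MonObj.comp_one h))
  proj {Y} := MonoidHom.mk' (fun a : ULift.{u} ((Y ⟶ F) × (Y ⟶ G)) => a.down.2) fun _ _ => rfl
  proj_res _ _ := rfl
  incl_injective {Y} f g h := (Prod.ext_iff.1 (ULift.up_injective h)).1
  proj_eq_one_iff a := ⟨fun h => ⟨a.down.1, ULift.ext _ _ (Prod.ext rfl h.symm)⟩, by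
    rintro ⟨f, rfl⟩; rfl⟩
  proj_locally_surjective g := ⟨⊤, J.top_mem _, fun Z k _ => ⟨⟨(1, k ≫ g)⟩, rfl⟩⟩
  central f a := ULift.ext _ _ (Prod.ext (mul_comm _ _) ((one_mul _).trans (mul_one _).symm))

/-- The extension with the same sheaf of groups and the inclusion of `F` composed with inversion. -/
def inverse (E : CentralExt J F G) : CentralExt J F G where
  sec := E.sec
  isSheaf := E.isSheaf
  group := E.group
  res_mul := E.res_mul
  incl := MonoidHom.mk' (fun f => E.incl f⁻¹) fun f g => by rw [mul_inv, map_mul]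
  res_incl h f := by
    change res h (E.incl f⁻¹) = E.incl (h ≫ f)⁻¹
    rw [E.res_incl, GrpObj.comp_inv]
  proj := E.proj
  proj_res := E.proj_res
  incl_injective {Y} f g h := inv_injective (E.incl_injective h)
  proj_eq_one_iff a := (E.proj_eq_one_iff a).trans
    ⟨fun ⟨f, hf⟩ => ⟨f⁻¹, by simpa using hf⟩, fun ⟨f, hf⟩ => ⟨f⁻¹, hf⟩⟩
  proj_locally_surjective := E.proj_locally_surjective
  central f a := E.central f⁻¹ a

section Baer

variable (E E' : CentralExt J F G)

/-- Sections of the contracted product of the torsors of two extensions. -/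
abbrev BaerAt (Y : C) : Type (max u v) := (Torsor.tensor E.torsor E'.torsor).At Y

variable {E E'}

/-- The class of a pair `(a, a')` in `(E ×_G E') / F`. -/
def tm {Y : C} (a : E.At Y) (a' : E'.At Y) (e : E.proj a = E'.proj a') : BaerAt E E' Y :=
  Torsor.tmul (T := E.torsor) (T' := E'.torsor) a a' e

lemma tm_eq_iff {Y : C} {a b : E.At Y} {a' b' : E'.At Y} {e e'} :
    tm a a' e = tm b b' e' ↔ ∃ f : Y ⟶ F, b = E.incl f * a ∧ b' = E'.incl f⁻¹ * a' :=
  Torsor.tmul_eq_iff (T := E.torsor) (T' := E'.torsor)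

lemma res_tm {Y Z : C} (h : Z ⟶ Y) (a : E.At Y) (a' : E'.At Y) (e) :
    res h (tm a a' e) = tm (res h a) (res h a') (by rw [E.proj_res, E'.proj_res, e]) :=
  Torsor.res_tmul (T := E.torsor) (T' := E'.torsor) h a a' e

lemma mul_compat {Y : C} {a b : E.At Y} {a' b' : E'.At Y} (e : E.proj a = E'.proj a')
    (d : E.proj b = E'.proj b') : E.proj (a * b) = E'.proj (a' * b') := by
  rw [map_mul, map_mul, e, d]

lemma inv_compat {Y : C} {a : E.At Y} {a' : E'.At Y} (e : E.proj a = E'.proj a') :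
    E.proj a⁻¹ = E'.proj a'⁻¹ := by
  rw [map_inv, map_inv, e]

/-- The property of being of the form `a ⊗ a'`. -/
def IsTm {Y : C} (o : BaerAt E E' Y) : Prop := ∃ a a' e, o = tm a a' e

lemma cover_isTm {Y : C} (o : BaerAt E E' Y) :
    ∃ R ∈ J Y, ∀ ⦃Z : C⦄ (k : Z ⟶ Y), R k → IsTm (res k o) :=
  Torsor.exists_tmul (T := E.torsor) (T' := E'.torsor) o

lemma exists_baerMul {Y : C} (o p : BaerAt E E' Y) : ∃ r : BaerAt E E' Y,
    ∀ ⦃Z : C⦄ (h : Z ⟶ Y) (r' : BaerAt E E' Z), (∃ a a' e b b' d, res h o = tm a a' e ∧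
      res h p = tm b b' d ∧ r' = tm (a * b) (a' * b') (mul_compat e d)) → res h r = r' := by
  obtain ⟨R, hR, ho⟩ := cover_isTm o
  obtain ⟨R', hR', hp⟩ := cover_isTm p
  refine sheaf_glue (Torsor.tensor E.torsor E'.torsor).isSheaf _ ?_ ?_
    (J.intersection_covering hR hR') ?_
  · rintro Z W h k _ ⟨a, a', e, b, b', d, h1, h2, rfl⟩
    refine ⟨res k a, res k a', by rw [E.proj_res, E'.proj_res, e], res k b, res k b',
      by rw [E.proj_res, E'.proj_res, d], ?_, ?_, ?_⟩
    · rw [← res_res, h1, res_tm]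
    · rw [← res_res, h2, res_tm]
    · rw [res_tm]; congr 1 <;> apply res_mul
  · rintro Z h _ _ ⟨a, a', e, b, b', d, h1, h2, rfl⟩ ⟨a₁, a₁', e₁, b₁, b₁', d₁, h3, h4, rfl⟩
    obtain ⟨f, rfl, rfl⟩ := tm_eq_iff.1 (h1.symm.trans h3)
    obtain ⟨g, rfl, rfl⟩ := tm_eq_iff.1 (h2.symm.trans h4)
    exact tm_eq_iff.2 ⟨f * g, E.mul_mul_eq _ _ _ _, by rw [E'.mul_mul_eq, mul_inv]⟩
  · intro Z h hh
    obtain ⟨a, a', e, h1⟩ := ho h hh.1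
    obtain ⟨b, b', d, h2⟩ := hp h hh.2
    exact ⟨_, a, a', e, b, b', d, h1, h2, rfl⟩

/-- The product of `(E ×_G E') / F`, characterised by `(a ⊗ a') (b ⊗ b') = (a b) ⊗ (a' b')`. -/
def baerMul {Y : C} (o p : BaerAt E E' Y) : BaerAt E E' Y := (exists_baerMul o p).choose

lemma res_baerMul_eq {Y Z : C} (h : Z ⟶ Y) {o p : BaerAt E E' Y} {a b : E.At Z} {a' b' : E'.At Z}
    {e d} (h1 : res h o = tm a a' e) (h2 : res h p = tm b b' d) :
    res h (baerMul o p) = tm (a * b) (a' * b') (mul_compat e d) :=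
  (exists_baerMul o p).choose_spec h _ ⟨a, a', e, b, b', d, h1, h2, rfl⟩

lemma baerMul_tm {Y : C} {a b : E.At Y} {a' b' : E'.At Y} (e d) :
    baerMul (tm a a' e) (tm b b' d) = tm (a * b) (a' * b') (mul_compat e d) := by
  have := res_baerMul_eq (𝟙 Y) (res_id (tm a a' e)) (res_id (tm b b' d))
  rwa [res_id] at this

lemma res_baerMul {Y Z : C} (h : Z ⟶ Y) (o p : BaerAt E E' Y) :
    res h (baerMul o p) = baerMul (res h o) (res h p) := by
  obtain ⟨R, hR, ho⟩ := cover_isTm (res h o)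
  obtain ⟨R', hR', hp⟩ := cover_isTm (res h p)
  refine sheaf_ext (Torsor.tensor E.torsor E'.torsor).isSheaf
    (J.intersection_covering hR hR') fun W k hk => ?_
  obtain ⟨a, a', e, h1⟩ := ho k hk.1
  obtain ⟨b, b', d, h2⟩ := hp k hk.2
  rw [res_baerMul_eq k h1 h2, res_res]
  rw [res_res] at h1 h2
  exact res_baerMul_eq (k ≫ h) h1 h2

lemma exists_baerInv {Y : C} (o : BaerAt E E' Y) : ∃ r : BaerAt E E' Y,
    ∀ ⦃Z : C⦄ (h : Z ⟶ Y) (r' : BaerAt E E' Z), (∃ a a' e, res h o = tm a a' e ∧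
      r' = tm a⁻¹ a'⁻¹ (inv_compat e)) → res h r = r' := by
  obtain ⟨R, hR, ho⟩ := cover_isTm o
  refine sheaf_glue (Torsor.tensor E.torsor E'.torsor).isSheaf _ ?_ ?_ hR ?_
  · rintro Z W h k _ ⟨a, a', e, h1, rfl⟩
    refine ⟨res k a, res k a', by rw [E.proj_res, E'.proj_res, e], ?_, ?_⟩
    · rw [← res_res, h1, res_tm]
    · rw [res_tm]; congr 1 <;> apply res_inv
  · rintro Z h _ _ ⟨a, a', e, h1, rfl⟩ ⟨b, b', d, h2, rfl⟩
    obtain ⟨f, rfl, rfl⟩ := tm_eq_iff.1 (h1.symm.trans h2)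
    exact tm_eq_iff.2 ⟨f⁻¹, E.inv_mul_eq _ _, E'.inv_mul_eq _ _⟩
  · intro Z h hh
    obtain ⟨a, a', e, h1⟩ := ho h hh
    exact ⟨_, a, a', e, h1, rfl⟩

/-- The inverse of `(E ×_G E') / F`, characterised by `(a ⊗ a')⁻¹ = a⁻¹ ⊗ a'⁻¹`. -/
def baerInv {Y : C} (o : BaerAt E E' Y) : BaerAt E E' Y := (exists_baerInv o).choose

lemma res_baerInv_eq {Y Z : C} (h : Z ⟶ Y) {o : BaerAt E E' Y} {a : E.At Z} {a' : E'.At Z}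
    {e} (h1 : res h o = tm a a' e) :
    res h (baerInv o) = tm a⁻¹ a'⁻¹ (inv_compat e) :=
  (exists_baerInv o).choose_spec h _ ⟨a, a', e, h1, rfl⟩

lemma one_compat {Y : C} : E.proj (1 : E.At Y) = E'.proj (1 : E'.At Y) := by
  rw [map_one, map_one]

lemma tm_congr {Y : C} {a b : E.At Y} {a' b' : E'.At Y} (h : a = b) (h' : a' = b') (e e') :
    tm a a' e = tm b b' e' := by
  subst h h'; rfl

lemma res_tm_one {Y Z : C} (h : Z ⟶ Y) :
    res h (tm (1 : E.At Y) (1 : E'.At Y) one_compat) = tm 1 1 one_compat := by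
  rw [res_tm]; exact tm_congr (E.res_one h) (E'.res_one h) _ _

variable (E E') in
/-- The group structure on the sections of `(E ×_G E') / F`. -/
@[reducible]
def baerGroup (Y : C) : Group (BaerAt E E' Y) where
  mul := baerMul
  one := tm 1 1 one_compat
  inv := baerInv
  mul_assoc o p q := by
    change baerMul (baerMul o p) q = baerMul o (baerMul p q)
    obtain ⟨R, hR, ho⟩ := cover_isTm o
    obtain ⟨R', hR', hp⟩ := cover_isTm p
    obtain ⟨R'', hR'', hq⟩ := cover_isTm q
    refine sheaf_ext (Torsor.tensor E.torsor E'.torsor).isSheaf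
      (J.intersection_covering (J.intersection_covering hR hR') hR'') fun W k hk => ?_
    obtain ⟨a, a', e, h1⟩ := ho k hk.1.1
    obtain ⟨b, b', d, h2⟩ := hp k hk.1.2
    obtain ⟨c, c', i, h3⟩ := hq k hk.2
    rw [res_baerMul_eq k (res_baerMul_eq k h1 h2) h3, res_baerMul_eq k h1 (res_baerMul_eq k h2 h3)]
    exact tm_congr (mul_assoc _ _ _) (mul_assoc _ _ _) _ _
  one_mul o := by
    change baerMul (tm 1 1 one_compat) o = o
    obtain ⟨R, hR, ho⟩ := cover_isTm o
    refine sheaf_ext (Torsor.tensor E.torsor E'.torsor).isSheaf hR fun W k hk => ?_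
    obtain ⟨a, a', e, h1⟩ := ho k hk
    rw [res_baerMul_eq k (res_tm_one k) h1, h1]
    exact tm_congr (one_mul _) (one_mul _) _ _
  mul_one o := by
    change baerMul o (tm 1 1 one_compat) = o
    obtain ⟨R, hR, ho⟩ := cover_isTm o
    refine sheaf_ext (Torsor.tensor E.torsor E'.torsor).isSheaf hR fun W k hk => ?_
    obtain ⟨a, a', e, h1⟩ := ho k hk
    rw [res_baerMul_eq k h1 (res_tm_one k), h1]
    exact tm_congr (mul_one _) (mul_one _) _ _
  inv_mul_cancel o := by
    change baerMul (baerInv o) o = tm 1 1 one_compat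
    obtain ⟨R, hR, ho⟩ := cover_isTm o
    refine sheaf_ext (Torsor.tensor E.torsor E'.torsor).isSheaf hR fun W k hk => ?_
    obtain ⟨a, a', e, h1⟩ := ho k hk
    rw [res_baerMul_eq k (res_baerInv_eq k h1) h1, res_tm_one k]
    exact tm_congr (inv_mul_cancel _) (inv_mul_cancel _) _ _

attribute [local instance] baerGroup

lemma incl_compat {Y : C} (f : Y ⟶ F) : E.proj (E.incl f) = E'.proj (1 : E'.At Y) := by
  rw [E.proj_incl, map_one]

lemma res_tm_incl {Y Z : C} (h : Z ⟶ Y) (f : Y ⟶ F) :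
    res h (tm (E.incl f) (1 : E'.At Y) (incl_compat f)) =
      tm (E.incl (h ≫ f)) 1 (incl_compat _) := by
  rw [res_tm]; exact tm_congr (E.res_incl h f) (E'.res_one h) _ _

lemma tm_incl_mul {Y : C} (f : Y ⟶ F) (o : BaerAt E E' Y) :
    baerMul (tm (E.incl f) 1 (incl_compat f)) o =
      (Torsor.tensor E.torsor E'.torsor).act f o := by
  obtain ⟨R, hR, ho⟩ := cover_isTm o
  refine sheaf_ext (Torsor.tensor E.torsor E'.torsor).isSheaf hR fun W k hk => ?_
  obtain ⟨a, a', e, h1⟩ := ho k hk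
  rw [res_baerMul_eq k (res_tm_incl k f) h1, Torsor.res_act, h1]
  refine Eq.trans ?_ (Torsor.act_tmul' (T := E.torsor) (T' := E'.torsor) (k ≫ f) a a' e).symm
  exact tm_congr rfl (one_mul _) _ _

lemma proj_baerMul {Y : C} (o p : BaerAt E E' Y) :
    (Torsor.tensor E.torsor E'.torsor).proj (baerMul o p) =
      (Torsor.tensor E.torsor E'.torsor).proj o * (Torsor.tensor E.torsor E'.torsor).proj p := by
  obtain ⟨R, hR, ho⟩ := cover_isTm o
  obtain ⟨R', hR', hp⟩ := cover_isTm p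
  refine hom_ext (J.intersection_covering hR hR') fun W k hk => ?_
  obtain ⟨a, a', e, h1⟩ := ho k hk.1
  obtain ⟨b, b', d, h2⟩ := hp k hk.2
  rw [MonObj.comp_mul, ← Torsor.proj_res, ← Torsor.proj_res, ← Torsor.proj_res,
    res_baerMul_eq k h1 h2, h1, h2]
  exact map_mul E.proj a b

variable (E E') in
/-- The Baer sum of two central extensions: the quotient of `E ×_G E'` by the antidiagonally
embedded `F`. -/
def baer : CentralExt J F G where
  sec := (Torsor.tensor E.torsor E'.torsor).sec
  isSheaf := (Torsor.tensor E.torsor E'.torsor).isSheaf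
  group := baerGroup E E'
  res_mul := res_baerMul
  incl {Y} := MonoidHom.mk' (fun f => (tm (E.incl f) 1 (incl_compat f) : BaerAt E E' Y))
    fun f g => (tm_congr (map_mul _ _ _) (one_mul _).symm _ _).trans
      (baerMul_tm (incl_compat f) (incl_compat g)).symm
  res_incl h f := res_tm_incl h f
  proj {Y} := MonoidHom.mk' (fun o : BaerAt E E' Y => (Torsor.tensor E.torsor E'.torsor).proj o)
    proj_baerMul
  proj_res := (Torsor.tensor E.torsor E'.torsor).proj_res
  incl_injective {Y} f g h := by
    have h' : tm (E.incl f) (1 : E'.At Y) (incl_compat f) = tm (E.incl g) 1 (incl_compat g) := h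
    obtain ⟨k, h1, h2⟩ := tm_eq_iff.1 h'
    rw [mul_one, ← map_one E'.incl] at h2
    have hk : k = 1 := inv_eq_one.1 (E'.incl_injective h2).symm
    rw [hk, map_one, one_mul] at h1
    exact (E.incl_injective h1).symm
  proj_eq_one_iff {Y} o := by
    have key : ∀ f : Y ⟶ F, tm (E.incl f) (1 : E'.At Y) (incl_compat f) =
        (Torsor.tensor E.torsor E'.torsor).act f (tm 1 1 one_compat) := fun f =>
      (tm_congr (mul_one _).symm rfl _ _).trans
        (Torsor.act_tmul' (T := E.torsor) (T' := E'.torsor) f 1 1 one_compat).symm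
    constructor
    · intro h
      obtain ⟨f, hf⟩ := Torsor.exists_act (Torsor.tensor E.torsor E'.torsor)
        (t := tm 1 1 one_compat) (t' := o) ((map_one E.proj).trans h.symm)
      exact ⟨f, (key f).trans hf.symm⟩
    · rintro ⟨f, rfl⟩
      exact E.proj_incl f
  proj_locally_surjective := (Torsor.tensor E.torsor E'.torsor).locally_nonempty
  central {Y} f o := by
    change baerMul (tm (E.incl f) 1 (incl_compat f)) o = baerMul o (tm (E.incl f) 1 (incl_compat f))
    obtain ⟨R, hR, ho⟩ := cover_isTm o
    refine sheaf_ext (Torsor.tensor E.torsor E'.torsor).isSheaf hR fun W k hk => ?_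
    obtain ⟨a, a', e, h1⟩ := ho k hk
    rw [res_baerMul_eq k (res_tm_incl k f) h1, res_baerMul_eq k h1 (res_tm_incl k f)]
    exact tm_congr (E.central _ _) ((one_mul _).trans (mul_one _).symm) _ _

variable (E E') in
/-- The torsor of a Baer sum is the contracted product of the torsors. -/
def baerTorsor : Torsor.Iso (baer E E').torsor (Torsor.tensor E.torsor E'.torsor) where
  toEquiv := Equiv.refl _
  res_toEquiv _ _ := rfl
  proj_toEquiv _ := rfl
  toEquiv_act f o := tm_incl_mul f o

variable (J F G) in
/-- The torsor of the trivial extension is trivial. -/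
def trivialTorsor : Torsor.Iso (trivial J F G).torsor (Torsor.trivial J F G) where
  toEquiv := Equiv.refl _
  res_toEquiv _ _ := rfl
  proj_toEquiv _ := rfl
  toEquiv_act f o := ULift.ext _ _ (Prod.ext rfl (one_mul _))

lemma baer_mul_tm {Y : C} {a b : E.At Y} {a' b' : E'.At Y} (e d) :
    (tm a a' e : (baer E E').At Y) * (tm b b' d : (baer E E').At Y) =
      tm (a * b) (a' * b') (mul_compat e d) :=
  baerMul_tm e d

lemma tensorMap_tm {T T' : Torsor J F G} (φ : Torsor.Iso E.torsor T) (φ' : Torsor.Iso E'.torsor T')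
    {Y : C} (a : E.At Y) (a' : E'.At Y) (e) :
    (Torsor.tensorMap φ φ').toEquiv (tm a a' e) = Torsor.tmul (φ.toEquiv a) (φ'.toEquiv a')
      (((φ.proj_toEquiv a).trans e).trans (φ'.proj_toEquiv a').symm) :=
  Torsor.LocalIso.toIso_eq _ ⟨a, a', e, rfl, rfl⟩

/-- Functoriality of the Baer sum. -/
def baerMap {E₁ E₂ E₁' E₂' : CentralExt J F G} (φ : Iso E₁ E₂) (φ' : Iso E₁' E₂') :
    Iso (baer E₁ E₁') (baer E₂ E₂') :=
  Iso.ofTorsor (Torsor.tensorMap φ.torsor φ'.torsor).toEquiv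
    (Torsor.tensorMap φ.torsor φ'.torsor).res_toEquiv
    (fun f => (tensorMap_tm φ.torsor φ'.torsor (E₁.incl f) 1 (incl_compat f)).trans
      (tm_congr (φ.toMulEquiv_incl f) (map_one φ'.toMulEquiv)
        (by rw [φ.toMulEquiv_incl, map_one, incl_compat]) (incl_compat f)))
    (Torsor.tensorMap φ.torsor φ'.torsor).proj_toEquiv
    (fun Y o p => ∃ (a : E₁.At Y) (a' : E₁'.At Y) (e : E₁.proj a = E₁'.proj a')
      (e' : E₂.proj (φ.toMulEquiv a) = E₂'.proj (φ'.toMulEquiv a')),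
      o = tm a a' e ∧ p = tm (φ.toMulEquiv a) (φ'.toMulEquiv a') e')
    (by rintro Y _ _ ⟨a, a', e, e', rfl, rfl⟩; exact tensorMap_tm _ _ _ _ _)
    (fun o => by
      obtain ⟨R, hR, ho⟩ := cover_isTm o
      refine ⟨R, hR, fun Z k hk => ?_⟩
      obtain ⟨a, a', e, h⟩ := ho k hk
      exact ⟨_, a, a', e, ((φ.proj_toMulEquiv a).trans e).trans (φ'.proj_toMulEquiv a').symm, h,
        rfl⟩)
    (by
      rintro Y _ _ _ _ ⟨a, a', e, e', rfl, rfl⟩ ⟨b, b', d, d', rfl, rfl⟩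
      have h := mul_compat e' d'
      rw [← map_mul, ← map_mul] at h
      exact ⟨a * b, a' * b', mul_compat e d, h, baer_mul_tm e d,
        (baer_mul_tm e' d').trans
          (tm_congr (map_mul φ.toMulEquiv a b).symm (map_mul φ'.toMulEquiv a' b').symm _ _)⟩)

lemma comm_tm {Y : C} (a : E.At Y) (a' : E'.At Y) (e) :
    (Torsor.tensorComm E.torsor E'.torsor).toIso.toEquiv (tm a a' e) = tm a' a e.symm :=
  Torsor.LocalIso.toIso_eq _ ⟨a, a', e, rfl, rfl⟩

variable (E E') in
def baerComm : Iso (baer E E') (baer E' E) :=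
  Iso.ofTorsor (Torsor.tensorComm E.torsor E'.torsor).toIso.toEquiv
    (Torsor.tensorComm E.torsor E'.torsor).toIso.res_toEquiv
    (fun f => (comm_tm (E.incl f) 1 (incl_compat f)).trans ((tm_eq_iff (e' := incl_compat f)).2 ⟨f, (mul_one _).symm, by
      rw [← map_mul, inv_mul_cancel, map_one]⟩))
    (Torsor.tensorComm E.torsor E'.torsor).toIso.proj_toEquiv
    (fun Y o p => ∃ (a : E.At Y) (a' : E'.At Y) (e : E.proj a = E'.proj a'),
      o = tm a a' e ∧ p = tm a' a e.symm)
    (by rintro Y _ _ ⟨a, a', e, rfl, rfl⟩; exact comm_tm _ _ _)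
    (fun o => by
      obtain ⟨R, hR, ho⟩ := cover_isTm o
      refine ⟨R, hR, fun Z k hk => ?_⟩
      obtain ⟨a, a', e, h⟩ := ho k hk
      exact ⟨_, a, a', e, h, rfl⟩)
    (by
      rintro Y _ _ _ _ ⟨a, a', e, rfl, rfl⟩ ⟨b, b', d, rfl, rfl⟩
      exact ⟨a * b, a' * b', mul_compat e d, baer_mul_tm e d, baer_mul_tm e.symm d.symm⟩)

lemma incl_diff {Y : C} (a b : E.At Y) (e) : E.incl (E.torsor.diff a b e) * a = b :=
  E.torsor.act_diff a b e

lemma dual_tm {Y : C} (a : (inverse E).At Y) (a' : E.At Y) (e) :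
    (Torsor.dualTensor E.torsor).toIso.toEquiv (tm (E := inverse E) (E' := E) a a' e) =
      ⟨(E.torsor.diff a a' e, E.proj a)⟩ :=
  Torsor.LocalIso.toIso_eq _ ⟨a, a', e, rfl, rfl⟩

variable (E) in
def baerInverse : Iso (baer (inverse E) E) (trivial J F G) :=
  Iso.ofTorsor (Torsor.dualTensor E.torsor).toIso.toEquiv
    (Torsor.dualTensor E.torsor).toIso.res_toEquiv
    (fun {Y} f => (dual_tm (E := E) (E.incl f⁻¹) 1 (incl_compat (E := E) (E' := E) f⁻¹)).trans
      (ULift.ext _ _ (Prod.ext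
        (E.torsor.diff_eq (t := E.incl f⁻¹) (t' := 1) (incl_compat (E := E) (E' := E) f⁻¹) (f := f)
          (by
            change E.incl f * E.incl f⁻¹ = 1
            rw [← map_mul, mul_inv_cancel, map_one])) (E.proj_incl f⁻¹))))
    (Torsor.dualTensor E.torsor).toIso.proj_toEquiv
    (fun Y o p => ∃ (a : E.At Y) (a' : E.At Y) (e : E.proj a = E.proj a'),
      o = tm (E := inverse E) (E' := E) a a' e ∧ p = ⟨(E.torsor.diff a a' e, E.proj a)⟩)
    (by rintro Y _ _ ⟨a, a', e, rfl, rfl⟩; exact dual_tm _ _ _)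
    (fun o => by
      obtain ⟨R, hR, ho⟩ := cover_isTm o
      refine ⟨R, hR, fun Z k hk => ?_⟩
      obtain ⟨a, a', e, h⟩ := ho k hk
      exact ⟨_, a, a', e, h, rfl⟩)
    (by
      rintro Y _ _ _ _ ⟨a, a', e, rfl, rfl⟩ ⟨b, b', d, rfl, rfl⟩
      refine ⟨a * b, a' * b', mul_compat (E := E) (E' := E) e d,
        baer_mul_tm (E := inverse E) (E' := E) e d, ?_⟩
      refine ULift.ext _ _ (Prod.ext (E.torsor.diff_eq (t := (a * b : E.At Y)) (t' := a' * b')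
        (mul_compat (E := E) (E' := E) e d)
        (f := E.torsor.diff a a' e * E.torsor.diff b b' d) ?_).symm (map_mul E.proj a b).symm)
      change E.incl (_ * _) * _ = _
      rw [← E.mul_mul_eq, incl_diff, incl_diff])

lemma one_tm {Y : C} (x : (trivial J F G).At Y) (a : E.At Y) (e) :
    ((Torsor.tensorMap (trivialTorsor J F G) (Torsor.Iso.refl E.torsor)).trans
      (Torsor.trivialTensor E.torsor).toIso).toEquiv (tm x a e) = E.incl x.down.1 * a :=
  (congrArg (Torsor.trivialTensor E.torsor).toIso.toEquiv (tensorMap_tm _ _ x a e)).trans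
    (Torsor.LocalIso.toIso_eq _ ⟨x, a, e, rfl, rfl⟩)

variable (E) in
def baerTrivial : Iso (baer (trivial J F G) E) E :=
  let φ := (Torsor.tensorMap (trivialTorsor J F G) (Torsor.Iso.refl E.torsor)).trans
      (Torsor.trivialTensor E.torsor).toIso
  Iso.ofTorsor φ.toEquiv φ.res_toEquiv
    (fun f => (one_tm ((trivial J F G).incl f) (1 : E.At _) (incl_compat f)).trans (mul_one _))
    φ.proj_toEquiv
    (fun Y o p => ∃ (x : (trivial J F G).At Y) (a : E.At Y)
      (e : (trivial J F G).proj x = E.proj a), o = tm x a e ∧ p = E.incl x.down.1 * a)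
    (by rintro Y _ _ ⟨x, a, e, rfl, rfl⟩; exact one_tm _ _ _)
    (fun o => by
      obtain ⟨R, hR, ho⟩ := cover_isTm o
      refine ⟨R, hR, fun Z k hk => ?_⟩
      obtain ⟨x, a, e, h⟩ := ho k hk
      exact ⟨_, x, a, e, h, rfl⟩)
    (by
      rintro Y _ _ _ _ ⟨x, a, e, rfl, rfl⟩ ⟨y, b, d, rfl, rfl⟩
      exact ⟨x * y, a * b, mul_compat e d, baer_mul_tm e d, E.mul_mul_eq _ _ _ _⟩)

variable (E E') in
/-- The isomorphism of torsors underlying the associativity of the Baer sum. -/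
def assocTorsor (E'' : CentralExt J F G) :
    Torsor.Iso (Torsor.tensor (baer E E').torsor E''.torsor)
      (Torsor.tensor E.torsor (baer E' E'').torsor) :=
  ((Torsor.tensorMap (baerTorsor E E') (Torsor.Iso.refl E''.torsor)).trans
    (Torsor.tensorAssoc E.torsor E'.torsor E''.torsor).toIso).trans
    (Torsor.tensorMap (Torsor.Iso.refl E.torsor) (baerTorsor E' E'').symm)

lemma assoc_tm {E'' : CentralExt J F G} {Y : C} (a : E.At Y) (a' : E'.At Y) (a'' : E''.At Y)
    (e : E.proj a = E'.proj a') (e' : E'.proj a' = E''.proj a'') :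
    (assocTorsor E E' E'').toEquiv (tm (E := baer E E') (tm a a' e) a'' (e.trans e')) =
      tm (E' := baer E' E'') a (tm a' a'' e') e := by
  have h : (Torsor.tensorAssoc E.torsor E'.torsor E''.torsor).toIso.toEquiv
      (Torsor.tmul (T := Torsor.tensor E.torsor E'.torsor) (T' := E''.torsor)
        (Torsor.tmul (T := E.torsor) (T' := E'.torsor) a a' e) a'' (e.trans e')) =
      Torsor.tmul (T := E.torsor) (T' := Torsor.tensor E'.torsor E''.torsor) a
        (Torsor.tmul (T := E'.torsor) (T' := E''.torsor) a' a'' e') e :=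
    Torsor.LocalIso.toIso_eq _ ⟨a, a', a'', e, e', rfl, rfl⟩
  have h1 := tensorMap_tm (E := baer E E') (E' := E'') (baerTorsor E E')
    (Torsor.Iso.refl E''.torsor) (tm a a' e) a'' (e.trans e')
  refine (congrArg (Torsor.tensorMap (Torsor.Iso.refl E.torsor) (baerTorsor E' E'').symm).toEquiv
    ((congrArg (Torsor.tensorAssoc E.torsor E'.torsor E''.torsor).toIso.toEquiv h1).trans
      h)).trans ?_
  exact Torsor.LocalIso.toIso_eq _
    ⟨a, Torsor.tmul (T := E'.torsor) (T' := E''.torsor) a' a'' e', e, rfl, rfl⟩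

lemma cover_tm₃ {E'' : CentralExt J F G} {Y : C} (o : BaerAt (baer E E') E'' Y) :
    ∃ R ∈ J Y, ∀ ⦃Z : C⦄ (k : Z ⟶ Y), R k → ∃ (a : E.At Z) (a' : E'.At Z) (a'' : E''.At Z)
      (e : E.proj a = E'.proj a') (e' : E'.proj a' = E''.proj a''),
      res k o = tm (E := baer E E') (tm a a' e) a'' (e.trans e') := by
  obtain ⟨R, hR, ho⟩ := cover_isTm (E := baer E E') o
  choose x a'' e h using ho
  choose R' hR' hx using fun Z (k : Z ⟶ Y) (hk : R k) => cover_isTm (E := E) (E' := E') (x k hk)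
  refine ⟨Sieve.bind R fun Z k hk => R' Z k hk, J.bind_covering hR fun Z k hk => hR' Z k hk, ?_⟩
  rintro W _ ⟨Z, g, k, hk, hg, rfl⟩
  obtain ⟨a, a', d, hd⟩ := hx Z k hk g hg
  have h1 : res g (x k hk) = (tm a a' d : (baer E E').At W) := hd
  have h2 : E'.proj a' = E''.proj (res g (a'' k hk)) := by
    rw [E''.proj_res, ← e k hk, ← (baer E E').proj_res, h1]
    exact d.symm
  refine ⟨a, a', res g (a'' k hk), d, h2, ?_⟩
  rw [← res_res, h k hk, res_tm]
  exact tm_congr h1 rfl _ _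

variable (E E') in
def baerAssoc (E'' : CentralExt J F G) :
    Iso (baer (baer E E') E'') (baer E (baer E' E'')) :=
  Iso.ofTorsor (assocTorsor E E' E'').toEquiv (assocTorsor E E' E'').res_toEquiv
    (fun f => (assoc_tm (E.incl f) 1 1 (incl_compat f) one_compat))
    (assocTorsor E E' E'').proj_toEquiv
    (fun Y o p => ∃ (a : E.At Y) (a' : E'.At Y) (a'' : E''.At Y)
      (e : E.proj a = E'.proj a') (e' : E'.proj a' = E''.proj a''),
      o = tm (E := baer E E') (tm a a' e) a'' (e.trans e') ∧
        p = tm (E' := baer E' E'') a (tm a' a'' e') e)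
    (by rintro Y _ _ ⟨a, a', a'', e, e', rfl, rfl⟩; exact assoc_tm a a' a'' e e')
    (by
      intro Y o
      obtain ⟨R, hR, ho⟩ := cover_tm₃ o
      refine ⟨R, hR, fun Z k hk => ?_⟩
      obtain ⟨a, a', a'', e, e', h⟩ := ho k hk
      exact ⟨_, a, a', a'', e, e', h, rfl⟩)
    (by
      rintro Y _ _ _ _ ⟨a, a', a'', e, e', rfl, rfl⟩ ⟨b, b', b'', d, d', rfl, rfl⟩
      exact ⟨a * b, a' * b', a'' * b'', mul_compat e d, mul_compat e' d',
        (baer_mul_tm (E := baer E E') (e.trans e') (d.trans d')).trans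
          (tm_congr (baer_mul_tm e d) rfl _ _),
        (baer_mul_tm (E' := baer E' E'') e d).trans
          (tm_congr rfl (baer_mul_tm e' d') _ _)⟩)

end Baer

/-- Functoriality of the inverse. -/
def inverseMap {E E' : CentralExt J F G} (φ : Iso E E') : Iso (inverse E) (inverse E') where
  toMulEquiv := φ.toMulEquiv
  res_toMulEquiv := φ.res_toMulEquiv
  toMulEquiv_incl f := φ.toMulEquiv_incl f⁻¹
  proj_toMulEquiv := φ.proj_toMulEquiv

/-- The extension `E` corresponds to the extension datum `(T, τ)`: there is an isomorphism of
torsors `E ≅ T` transporting the multiplication of `E`, that is, the trivialization of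
`δ¹E = p₁^*E ⊗ (m^*E)^∨ ⊗ p₀^*E` with the value `e₁ ⊗ (e₀ e₁)^∨ ⊗ e₀` at the image of `(e₀, e₁)`
in `G²`, into `τ`. -/
def Corresponds (E : CentralExt J F G) (T : Torsor J F G)
    (τ : Torsor.Iso (Torsor.trivial J F (G ⊗ G)) (Torsor.delta1 T)) : Prop :=
  ∃ φ : Torsor.Iso E.torsor T, ∀ (Y : C) (e₀ e₁ : E.At Y),
    τ.toEquiv (Torsor.unitAt J F (lift (E.proj e₀) (E.proj e₁))) =
      Torsor.delta1Tmul (lift (E.proj e₀) (E.proj e₁)) (φ.toEquiv e₁) (φ.toEquiv (e₀ * e₁))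
        (φ.toEquiv e₀) (by rw [φ.proj_toEquiv, lift_snd])
        (by rw [φ.proj_toEquiv, Torsor.comp_mul_eq, lift_fst, lift_snd]; exact map_mul E.proj e₀ e₁)
        (by rw [φ.proj_toEquiv, lift_fst])

end CentralExt

variable (J : GrothendieckTopology C) [J.Subcanonical] (F G : C) [GrpObj F] [IsCommMonObj F]
  [GrpObj G]

/-- Isomorphism of central extensions. -/
instance CentralExt.setoid : Setoid (CentralExt J F G) where
  r E E' := Nonempty (CentralExt.Iso E E')
  iseqv := ⟨fun E => ⟨.refl E⟩, fun ⟨φ⟩ => ⟨φ.symm⟩, fun ⟨φ⟩ ⟨ψ⟩ => ⟨φ.trans ψ⟩⟩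

/-- The set of isomorphism classes of central extensions of `G` by `F`. -/
def Ext : Type _ := Quotient (CentralExt.setoid J F G)

namespace Ext

variable {J F G}

/-- The class of an extension. -/
def mk (E : CentralExt J F G) : Ext J F G := Quotient.mk (CentralExt.setoid J F G) E

lemma sound {E E' : CentralExt J F G} (φ : CentralExt.Iso E E') : mk E = mk E' :=
  Quotient.sound ⟨φ⟩

/-- The group structure given by the Baer sum. -/
instance : CommGroup (Ext J F G) where
  mul := Quotient.map₂ CentralExt.baer fun _ _ ⟨φ⟩ _ _ ⟨ψ⟩ => ⟨CentralExt.baerMap φ ψ⟩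
  one := mk (CentralExt.trivial J F G)
  inv := Quotient.map CentralExt.inverse fun _ _ ⟨φ⟩ => ⟨CentralExt.inverseMap φ⟩
  mul_assoc a b c := by
    induction a using Quotient.inductionOn
    induction b using Quotient.inductionOn
    induction c using Quotient.inductionOn
    exact sound (CentralExt.baerAssoc _ _ _)
  one_mul a := by
    induction a using Quotient.inductionOn
    exact sound (CentralExt.baerTrivial _)
  mul_one a := by
    induction a using Quotient.inductionOn
    exact sound ((CentralExt.baerComm _ _).trans (CentralExt.baerTrivial _))
  inv_mul_cancel a := by
    induction a using Quotient.inductionOn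
    exact sound (CentralExt.baerInverse _)
  mul_comm a b := by
    induction a using Quotient.inductionOn
    induction b using Quotient.inductionOn
    exact sound (CentralExt.baerComm _ _)

end Ext

/-- The big fppf site of a scheme `S`. -/
abbrev fppf (S : AlgebraicGeometry.Scheme.{u}) : GrothendieckTopology (Over S) :=
  AlgebraicGeometry.Scheme.fppfTopology.over S

end

end TorsExt

namespace TorsExt

noncomputable section

variable {C : Type u} [Category.{v} C] [CartesianMonoidalCategory C] [BraidedCategory C]
  {J : GrothendieckTopology C} [J.Subcanonical] {F G : C} [GrpObj F] [IsCommMonObj F] [GrpObj G]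

namespace Torsor

/-! ### Trivialisations and automorphisms of the trivial torsor -/

section Generalities

variable {X : C}

/-! The argument works on any subcanonical site and rests on one reinterpretation. Let τ be a
trivialisation of δ¹T. Once sections t₀, t₁ of T over g₀, g₁ are chosen, the value of τ at (g₀, g₁)
is t₁ ⊗ r^∨ ⊗ t₀ for a unique r over g₀g₁. Setting t₀t₁ = r gives a product T × T → T that covers
the multiplication of G and is biequivariant for F. Conversely a product defines a trivialisation:
rescaling t₀, t₁ by f₀, f₁ multiplies t₁ ⊗ (t₀t₁)^∨ ⊗ t₀ by f₁(f₀f₁)⁻¹f₀ = 1, so these local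
sections glue. This dictionary is `Multiplication.exists_of_trivialisation` and
`Multiplication.exists_trivialisation`; it asks for no associativity.

The defect of associativity is an element a of F(G³) with (rs)t = a · r(st). If κ_T is computed with
the sections r, s, t, rs, st, (rs)t, then three of its four factors are values of τ and the
remaining one is off by a⁻¹; hence a = u_τ (`Presents.isAssociator`). The theorem is now a statement
about associators.

The pentagon of the five bracketings of four sections gives d³a = 1 (`IsAssociator.hd3_eq_one`). Two
products on the same torsor differ by some u in F(G²) (`exists_eq_twist`), and changing the product
by u changes a by d²u (`IsAssociator.twist`), so the class of a depends only on the class of T.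
Associators multiply under contracted products (`IsAssociator.tensor`), so ξ is a homomorphism.

An associative product is automatically a group law on sections: over the unit of G there is exactly
one idempotent section, and left inverses exist locally and are unique. Thus a central extension is
the same as a torsor with an associative product, and isomorphisms of extensions are the
multiplicative isomorphisms of torsors (`toExt`, `isoOfIsHom`).

Exactness follows. If a = d²u, dividing u out makes the product associative, which is exactness at
K(G,F). If the torsor of E is trivial, its product differs from that of F × G by some u, and
associativity of both says d²u = 1, which is exactness at Ext. Finally, the automorphisms of F_G are
the multiplications by b in F(G); they change u by d¹b, whence injectivity of α. -/

lemma Iso.ext_unit {P : Torsor J F X} {τ τ' : Iso (trivial J F X) P}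
    (h : ∀ ⦃Y : C⦄ (x : Y ⟶ X), τ.toEquiv (unitAt J F x) = τ'.toEquiv (unitAt J F x))
    {Y : C} (t : (trivial J F X).At Y) : τ.toEquiv t = τ'.toEquiv t := by
  have e : t = (trivial J F X).act t.down.1 (unitAt J F t.down.2) :=
    ULift.ext _ _ (Prod.ext (mul_one _).symm rfl)
  rw [e, τ.toEquiv_act, τ'.toEquiv_act, h]

/-- Every automorphism of the trivial torsor is the multiplication by an element of `F(X)`. -/
lemma exists_mulIso (φ : Iso (trivial J F X) (trivial J F X)) :
    ∃ a : X ⟶ F, ∀ (Y : C) (t : (trivial J F X).At Y), φ.toEquiv t = (mulIso a).toEquiv t := by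
  -- The element is read off at the universal point: every unit section is the restriction of the
  -- one over the identity of X.
  refine ⟨(φ.toEquiv (unitAt J F (𝟙 X))).down.1, fun Y t => Iso.ext_unit (fun Z x => ?_) t⟩
  have e : unitAt J F x = res x (unitAt J F (𝟙 X)) :=
    ULift.ext _ _ (Prod.ext (MonObj.comp_one x).symm (Category.comp_id x).symm)
  have h2 : (φ.toEquiv (unitAt J F (𝟙 X))).down.2 = 𝟙 X := φ.proj_toEquiv _
  conv_lhs => rw [e, φ.res_toEquiv]
  refine ULift.ext _ _ (Prod.ext (mul_one _).symm ?_)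
  change x ≫ (φ.toEquiv (unitAt J F (𝟙 X))).down.2 = x
  rw [h2, Category.comp_id]

lemma mulIso_unitAt (a : X ⟶ F) {Y : C} (x : Y ⟶ X) :
    (mulIso (J := J) a).toEquiv (unitAt J F x) = (trivial J F X).act (x ≫ a) (unitAt J F x) := rfl

lemma act_eq_self_iff (T : Torsor J F X) {Y : C} {f : Y ⟶ F} {t : T.At Y} :
    T.act f t = t ↔ f = 1 :=
  ⟨fun h => T.act_inj (h.trans (T.one_act t).symm), fun h => by rw [h, T.one_act]⟩

end Generalities

/-! ### Calculus of sections of δ¹ and δ² -/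

section Delta

/-- The middle slot is dualised, so the scalar comes out inverted. This is the origin of every
inverse in the later correspondence between products and trivialisations. -/
lemma delta1Tmul_act_mid {T : Torsor J F G} {Y : C} (x : Y ⟶ G ⊗ G) {t₁ t₀₁ s₀₁ t₀ : T.At Y}
    (h₁ h₀₁ h₀) {f : Y ⟶ F} (h₀₁') (e : s₀₁ = T.act f t₀₁) :
    delta1Tmul x t₁ s₀₁ t₀ h₁ h₀₁' h₀ =
      (delta1 T).act f⁻¹ (delta1Tmul x t₁ t₀₁ t₀ h₁ h₀₁ h₀) := by
  have := delta1Tmul_act x h₁ h₀₁ h₀ (f₁ := 1) (f₀ := 1) h₁ h₀₁' h₀ (T.one_act t₁).symm e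
    (T.one_act t₀).symm
  rwa [one_mul, mul_one] at this

/-- F acts freely on δ¹T, so with fixed outer factors the middle one is determined. All uniqueness
and naturality of the product attached to a trivialisation comes from here. -/
lemma delta1Tmul_injective {T : Torsor J F G} {Y : C} {x : Y ⟶ G ⊗ G} {t₁ t₀₁ s₀₁ t₀ : T.At Y}
    {h₁ h₀₁ h₀ h₀₁'}
    (h : delta1Tmul x t₁ s₀₁ t₀ h₁ h₀₁' h₀ = delta1Tmul x t₁ t₀₁ t₀ h₁ h₀₁ h₀) : s₀₁ = t₀₁ := by
  obtain ⟨f, e⟩ := T.exists_act (h₀₁.trans h₀₁'.symm)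
  rw [delta1Tmul_act_mid x h₁ h₀₁ h₀ h₀₁' e, act_eq_self_iff, inv_eq_one] at h
  rw [e, h, T.one_act]

/-- A section of `δ¹ T` over a point `(g₀, g₁)` is of the form `t₁ ⊗ r^∨ ⊗ t₀` as soon as sections
`t₁`, `t₀` of `T` over `g₁`, `g₀` are given. -/
lemma exists_delta1Tmul {T : Torsor J F G} {Y : C} {x : Y ⟶ G ⊗ G} {t₁ t₀ : T.At Y}
    (h₁ : T.proj t₁ = x ≫ snd G G) (h₀ : T.proj t₀ = x ≫ fst G G) (o : (delta1 T).At Y)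
    (ho : (delta1 T).proj o = x) : ∃ r h, o = delta1Tmul x t₁ r t₀ h₁ h h₀ := by
  have k₁ : ∀ ⦃Z : C⦄ (k : Z ⟶ Y), T.proj (res k t₁) = (k ≫ x) ≫ snd G G := fun Z k => by
    rw [T.proj_res, h₁, Category.assoc]
  have k₀ : ∀ ⦃Z : C⦄ (k : Z ⟶ Y), T.proj (res k t₀) = (k ≫ x) ≫ fst G G := fun Z k => by
    rw [T.proj_res, h₀, Category.assoc]
  obtain ⟨A, hA, hex⟩ := T.locally_nonempty (x ≫ μ[G])
  have hex' : ∀ ⦃Z : C⦄ (k : Z ⟶ Y), A k → ∃ r h,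
      res k o = delta1Tmul (k ≫ x) (res k t₁) r (res k t₀) (k₁ k) h (k₀ k) := by
    intro Z k hk
    obtain ⟨r, hr⟩ := hex k hk
    rw [← Category.assoc] at hr
    -- An arbitrary local section r over the product point is right up to a scalar f of δ¹T;
    -- rescaling r by f⁻¹ in the dual slot absorbs f.
    obtain ⟨f, hf⟩ := (delta1 T).exists_act
      (t := delta1Tmul (k ≫ x) (res k t₁) r (res k t₀) (k₁ k) hr (k₀ k)) (t' := res k o)
      (by rw [proj_delta1Tmul, (delta1 T).proj_res, ho])
    refine ⟨T.act f⁻¹ r, by rw [T.proj_act, hr], ?_⟩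
    rw [delta1Tmul_act_mid (k ≫ x) (k₁ k) hr (k₀ k) _ rfl, inv_inv, hf]
  -- The outer sections are defined on all of Y, so the local middle factors are unique and glue,
  -- with no further covering needed.
  obtain ⟨r, hr⟩ := sheaf_glue T.isSheaf (Y := Y)
    (fun Z k r => ∃ h, res k o = delta1Tmul (k ≫ x) (res k t₁) r (res k t₀) (k₁ k) h (k₀ k))
    (by
      rintro Z W k l r ⟨h, e⟩
      refine ⟨by rw [T.proj_res, h]; simp only [Category.assoc], ?_⟩
      rw [← res_res, e, res_delta1Tmul]
      simp only [res_res]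
      exact delta1Tmul_congr (Category.assoc _ _ _).symm _ _ _ _ _ _ _ _ _)
    (by
      rintro Z k r r' ⟨h, e⟩ ⟨h', e'⟩
      exact delta1Tmul_injective (e.symm.trans e')) hA hex'
  have hp : T.proj r = x ≫ μ[G] := hom_ext hA fun Z k hk => by
    obtain ⟨r', h, e⟩ := hex' k hk
    rw [← T.proj_res, hr k r' ⟨h, e⟩, h, Category.assoc]
  refine ⟨r, hp, sheaf_ext (delta1 T).isSheaf hA fun Z k hk => ?_⟩
  obtain ⟨r', h, e⟩ := hex' k hk
  rw [e, res_delta1Tmul]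
  congr 1
  exact (hr k r' ⟨h, e⟩).symm

lemma delta2Map_delta2Tmul {P P' : Torsor J F (G ⊗ G)} (φ : Iso P P') {Y : C} (x : Y ⟶ G ⊗ G ⊗ G)
    (s₁₂ s₀₁' s₁₂' s₀₁ : P.At Y) (h₁₂ h₀₁' h₁₂' h₀₁) :
    (delta2Map φ).toEquiv (delta2Tmul x s₁₂ s₀₁' s₁₂' s₀₁ h₁₂ h₀₁' h₁₂' h₀₁) =
      delta2Tmul x (φ.toEquiv s₁₂) (φ.toEquiv s₀₁') (φ.toEquiv s₁₂') (φ.toEquiv s₀₁)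
      (by rw [φ.proj_toEquiv, h₁₂]) (by rw [φ.proj_toEquiv, h₀₁'])
      (by rw [φ.proj_toEquiv, h₁₂']) (by rw [φ.proj_toEquiv, h₀₁]) := by
  -- The images s, s' are free variables so that the statement can be nested, once for each of the
  -- three tensor signs in δ².
  have key : ∀ {T₁ T₂ T₁' T₂' : Torsor J F (G ⊗ G ⊗ G)} (ψ : Iso T₁ T₂) (ψ' : Iso T₁' T₂')
      (t : T₁.At Y) (t' : T₁'.At Y) (s : T₂.At Y) (s' : T₂'.At Y) (e) (e'),
      ψ.toEquiv t = s → ψ'.toEquiv t' = s' →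
      (tensorMap ψ ψ').toEquiv (tmul t t' e) = tmul s s' e' := by
    rintro T₁ T₂ T₁' T₂' ψ ψ' t t' _ _ e e' rfl rfl
    exact LocalIso.toIso_eq _ ⟨t, t', e, rfl, rfl⟩
  exact key _ _ _ _ _ _ _ _ (key _ _ _ _ _ _ _ _ (key _ _ _ _ _ _ _ _ rfl rfl) rfl) rfl

/-- The canonical isomorphism is defined by a single section over the identity of G²; restriction
along x gives its value at every point. -/
lemma delta1Trivial_unitAt {Y : C} (x : Y ⟶ G ⊗ G) :
    (delta1Trivial J F G).toEquiv (unitAt J F x) =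
      delta1Tmul x (unitAt J F (x ≫ snd G G)) (unitAt J F (x ≫ μ[G])) (unitAt J F (x ≫ fst G G))
        (proj_unitAt _) (proj_unitAt _) (proj_unitAt _) := by
  refine (LocalIso.toIso_eq _ (rfl : _ = _)).trans ?_
  refine ((delta1 (trivial J F G)).one_act _).trans ?_
  refine (res_delta1Tmul x _ _ _ _ _ _ _).trans ?_
  have h : ∀ {X : C} (y : G ⊗ G ⟶ X), res x (unitAt J F y) = unitAt J F (x ≫ y) := fun y =>
    ULift.ext _ _ (Prod.ext (MonObj.comp_one x) rfl)
  simp only [h]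
  exact delta1Tmul_congr (Category.comp_id x) _ _ _ _ _ _ _ _ _

lemma delta2Tmul_congr {P : Torsor J F (G ⊗ G)} {Y : C} {x x' : Y ⟶ G ⊗ G ⊗ G} (e : x = x')
    (s₁₂ s₀₁' s₁₂' s₀₁ : P.At Y) (h₁₂ h₀₁' h₁₂' h₀₁ k₁₂ k₀₁' k₁₂' k₀₁) :
    delta2Tmul x s₁₂ s₀₁' s₁₂' s₀₁ h₁₂ h₀₁' h₁₂' h₀₁ =
      delta2Tmul x' s₁₂ s₀₁' s₁₂' s₀₁ k₁₂ k₀₁' k₁₂' k₀₁ := by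
  subst e; rfl

lemma delta2Trivial_unitAt {Y : C} (x : Y ⟶ G ⊗ G ⊗ G) :
    (delta2Trivial J F G).toEquiv (unitAt J F x) =
      delta2Tmul x (unitAt J F (x ≫ p12 G)) (unitAt J F (x ≫ m01 G)) (unitAt J F (x ≫ m12 G))
        (unitAt J F (x ≫ p01 G)) (proj_unitAt _) (proj_unitAt _) (proj_unitAt _)
        (proj_unitAt _) := by
  refine (LocalIso.toIso_eq _ (rfl : _ = _)).trans ?_
  refine ((delta2 (trivial J F (G ⊗ G))).one_act _).trans ?_
  refine (res_delta2Tmul x _ _ _ _ _ _ _ _ _).trans ?_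
  have h : ∀ {X : C} (y : G ⊗ G ⊗ G ⟶ X), res x (unitAt J F y) = unitAt J F (x ≫ y) := fun y =>
    ULift.ext _ _ (Prod.ext (MonObj.comp_one x) rfl)
  simp only [h]
  exact delta2Tmul_congr (Category.comp_id x) _ _ _ _ _ _ _ _ _ _ _ _

end Delta

/-- A multiplication on a torsor `T` over `G`: a map `T × T → T` that lies over the multiplication
of `G` and is biequivariant for `F`. This is the same as a trivialisation of `δ¹ T`. -/
structure Multiplication (T : Torsor J F G) where
  mul : ∀ {Y : C}, T.At Y → T.At Y → T.At Y
  res_mul : ∀ {Y Z : C} (h : Z ⟶ Y) (s t : T.At Y), res h (mul s t) = mul (res h s) (res h t)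
  proj_mul : ∀ {Y : C} (s t : T.At Y), T.proj (mul s t) = T.proj s * T.proj t
  act_mul_act : ∀ {Y : C} (f g : Y ⟶ F) (s t : T.At Y),
    mul (T.act f s) (T.act g t) = T.act (f * g) (mul s t)

/-! ### Trivialisations of δ¹T as products on T, and their associators -/

namespace Multiplication

variable {T : Torsor J F G}

lemma act_mul (M : Multiplication T) {Y : C} (f : Y ⟶ F) (s t : T.At Y) :
    M.mul (T.act f s) t = T.act f (M.mul s t) := by
  have := M.act_mul_act f 1 s t
  rwa [T.one_act, mul_one] at this

lemma mul_act (M : Multiplication T) {Y : C} (f : Y ⟶ F) (s t : T.At Y) :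
    M.mul s (T.act f t) = T.act f (M.mul s t) := by
  have := M.act_mul_act 1 f s t
  rwa [T.one_act, one_mul] at this

/-- The multiplication `M` corresponds to the trivialisation `τ` of `δ¹ T`, i.e. the value of `τ`
at the image of `(t₀, t₁)` in `G²` is `t₁ ⊗ (t₀ t₁)^∨ ⊗ t₀`. -/
def Presents (M : Multiplication T) (τ : Iso (Torsor.trivial J F (G ⊗ G)) (delta1 T)) : Prop :=
  ∀ ⦃Y : C⦄ (x : Y ⟶ G ⊗ G) (t₀ t₁ : T.At Y) (h₁ h₀₁ h₀),
    τ.toEquiv (unitAt J F x) = delta1Tmul x t₁ (M.mul t₀ t₁) t₀ h₁ h₀₁ h₀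

/-- A point of G² below a pair of sections is the pair of their projections, so it need not be given
separately. -/
lemma presents_of_lift {M : Multiplication T}
    {τ : Iso (Torsor.trivial J F (G ⊗ G)) (delta1 T)}
    (H : ∀ ⦃Y : C⦄ (t₀ t₁ : T.At Y) (h₁ h₀₁ h₀),
      τ.toEquiv (unitAt J F (lift (T.proj t₀) (T.proj t₁))) =
        delta1Tmul (lift (T.proj t₀) (T.proj t₁)) t₁ (M.mul t₀ t₁) t₀ h₁ h₀₁ h₀) :
    M.Presents τ := by
  intro Y x t₀ t₁ h₁ h₀₁ h₀
  have e : x = lift (T.proj t₀) (T.proj t₁) := by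
    rw [h₁, h₀]
    exact CartesianMonoidalCategory.hom_ext _ _ (lift_fst _ _).symm (lift_snd _ _).symm
  subst e
  exact H t₀ t₁ _ _ _

/-- The product of t₀ and t₁ is the unique middle factor in the expression of the value of τ as a
tensor with outer factors t₁ and t₀. Compatibility with restriction and with F follows from this
uniqueness. -/
lemma exists_of_trivialisation (τ : Iso (Torsor.trivial J F (G ⊗ G)) (delta1 T)) :
    ∃ M : Multiplication T, M.Presents τ := by
  have hp₁ : ∀ ⦃Y : C⦄ (t₀ t₁ : T.At Y),
      T.proj t₁ = lift (T.proj t₀) (T.proj t₁) ≫ snd G G := fun Y t₀ t₁ => (lift_snd _ _).symm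
  have hp₀ : ∀ ⦃Y : C⦄ (t₀ t₁ : T.At Y),
      T.proj t₀ = lift (T.proj t₀) (T.proj t₁) ≫ fst G G := fun Y t₀ t₁ => (lift_fst _ _).symm
  choose m hm₁ hm₂ using fun (Y : C) (t₀ t₁ : T.At Y) => exists_delta1Tmul (hp₁ t₀ t₁) (hp₀ t₀ t₁)
    (τ.toEquiv (unitAt J F (lift (T.proj t₀) (T.proj t₁))))
    (by rw [τ.proj_toEquiv, proj_unitAt])
  refine ⟨⟨fun {Y} => m Y, ?_, ?_, ?_⟩, presents_of_lift fun Y t₀ t₁ _ _ _ => hm₂ Y t₀ t₁⟩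
  · intro Y Z h s t
    have e : lift (T.proj (res h s)) (T.proj (res h t)) = h ≫ lift (T.proj s) (T.proj t) := by
      rw [T.proj_res, T.proj_res, comp_lift]
    have e2 : unitAt J F (h ≫ lift (T.proj s) (T.proj t)) =
        res h (unitAt J F (lift (T.proj s) (T.proj t))) :=
      ULift.ext _ _ (Prod.ext (MonObj.comp_one h).symm rfl)
    have h1 := hm₂ Z (res h s) (res h t)
    have h2 := congrArg (res h) (hm₂ Y s t)
    rw [← τ.res_toEquiv, ← e2, ← e, h1, res_delta1Tmul] at h2
    have hh : T.proj (res h (m Y s t)) = lift (T.proj (res h s)) (T.proj (res h t)) ≫ μ[G] := by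
      rw [T.proj_res, hm₁, e, Category.assoc]
    rw [delta1Tmul_congr e.symm _ _ _ _ _ _ (hp₁ _ _) hh (hp₀ _ _)] at h2
    exact (delta1Tmul_injective h2).symm
  · intro Y s t
    rw [hm₁, comp_mul_eq, lift_fst, lift_snd]
  · intro Y f g s t
    have h1 := hm₂ Y (T.act f s) (T.act g t)
    simp only [T.proj_act] at h1
    have hh : T.proj (T.act (f * g) (m Y s t)) = lift (T.proj s) (T.proj t) ≫ μ[G] := by
      rw [T.proj_act, hm₁]
    have h2 := delta1Tmul_act (lift (T.proj s) (T.proj t)) (hp₁ s t) (hm₁ Y s t) (hp₀ s t)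
      (s₁ := T.act g t) (s₀₁ := T.act (f * g) (m Y s t)) (s₀ := T.act f s)
      ((T.proj_act _ _).trans (hp₁ s t)) hh ((T.proj_act _ _).trans (hp₀ s t)) rfl rfl rfl
    -- Rescaling the three slots by g, fg and f does not move the section of δ¹T, so fg times the
    -- old product solves the equation that defines the new one.
    rw [← hm₂, show g * (f * g)⁻¹ * f = 1 by rw [mul_inv]; simp, Torsor.one_act, h1] at h2
    exact (delta1Tmul_injective h2).symm

/-- Sections t₀, t₁ exist only locally, but t₁ ⊗ (t₀t₁)^∨ ⊗ t₀ does not depend on them: by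
biequivariance the three scalars cancel. The local values therefore glue to an isomorphism. -/
lemma exists_trivialisation (M : Multiplication T) :
    ∃ τ : Iso (Torsor.trivial J F (G ⊗ G)) (delta1 T), M.Presents τ := by
  have hp : ∀ ⦃Y : C⦄ {x : Y ⟶ G ⊗ G} {t₀ t₁ : T.At Y}, T.proj t₁ = x ≫ snd G G →
      T.proj t₀ = x ≫ fst G G → T.proj (M.mul t₀ t₁) = x ≫ μ[G] := fun Y x t₀ t₁ h₁ h₀ => by
    rw [M.proj_mul, comp_mul_eq, h₀, h₁]
  let φ : LocalIso (Torsor.trivial J F (G ⊗ G)) (delta1 T) :=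
    { rel := fun Y a p => ∃ (t₀ t₁ : T.At Y) (h₁ : T.proj t₁ = a.down.2 ≫ snd G G)
        (h₀ : T.proj t₀ = a.down.2 ≫ fst G G), p = (delta1 T).act a.down.1
          (delta1Tmul a.down.2 t₁ (M.mul t₀ t₁) t₀ h₁ (hp h₁ h₀) h₀)
      rel_res := by
        rintro Y Z h a _ ⟨t₀, t₁, h₁, h₀, rfl⟩
        refine ⟨res h t₀, res h t₁, by rw [T.proj_res, h₁]; exact (Category.assoc _ _ _).symm,
          by rw [T.proj_res, h₀]; exact (Category.assoc _ _ _).symm, ?_⟩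
        rw [Torsor.res_act, res_delta1Tmul]
        simp only [M.res_mul]
        rfl
      rel_proj := by
        rintro Y a _ ⟨t₀, t₁, h₁, h₀, rfl⟩
        rfl
      rel_act := by
        rintro Y f a _ ⟨t₀, t₁, h₁, h₀, rfl⟩
        exact ⟨t₀, t₁, h₁, h₀, (Torsor.mul_act _ _ _ _).symm⟩
      rel_unique := by
        rintro Y a _ _ ⟨t₀, t₁, h₁, h₀, rfl⟩ ⟨s₀, s₁, k₁, k₀, rfl⟩
        obtain ⟨f₀, rfl⟩ := T.exists_act (h₀.trans k₀.symm)
        obtain ⟨f₁, rfl⟩ := T.exists_act (h₁.trans k₁.symm)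
        rw [delta1Tmul_act a.down.2 h₁ (hp h₁ h₀) h₀ k₁ (hp k₁ k₀) k₀ rfl
          (M.act_mul_act f₀ f₁ t₀ t₁) rfl,
          show f₁ * (f₀ * f₁)⁻¹ * f₀ = 1 by rw [mul_inv]; simp, Torsor.one_act]
      rel_cover := by
        intro Y g
        obtain ⟨A, hA, hA'⟩ := T.locally_nonempty (g ≫ fst G G)
        obtain ⟨B, hB, hB'⟩ := T.locally_nonempty (g ≫ snd G G)
        refine ⟨A ⊓ B, J.intersection_covering hA hB, fun Z k hk => ?_⟩
        obtain ⟨t₀, h₀⟩ := hA' k hk.1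
        obtain ⟨t₁, h₁⟩ := hB' k hk.2
        exact ⟨unitAt J F (k ≫ g), _, ⟨t₀, t₁, h₁.trans (Category.assoc _ _ _).symm,
          h₀.trans (Category.assoc _ _ _).symm, rfl⟩, rfl⟩ }
  exact ⟨φ.toIso, fun Y x t₀ t₁ h₁ h₀₁ h₀ =>
    LocalIso.toIso_eq _ ⟨t₀, t₁, h₁, h₀, (Torsor.one_act _ _).symm⟩⟩

/-- The element `a ∈ F(G³)` measures the failure of associativity of a multiplication. -/
def IsAssociator (M : Multiplication T) (a : G ⊗ G ⊗ G ⟶ F) : Prop :=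
  ∀ ⦃Y : C⦄ (r s t : T.At Y), M.mul (M.mul r s) t =
    T.act (lift (T.proj r) (lift (T.proj s) (T.proj t)) ≫ a) (M.mul r (M.mul s t))

/-- The section defining κ_T may be computed with any six sections over the relevant points. With
products chosen for three of them, κ_T and δ²τ differ only by the discrepancy between (rs)t and
r(st), which identifies u_τ with the associator. -/
lemma Presents.isAssociator {M : Multiplication T}
    {τ : Iso (Torsor.trivial J F (G ⊗ G)) (delta1 T)} (H : M.Presents τ) {a : G ⊗ G ⊗ G ⟶ F}
    (ha : IsObstruction T τ a) : M.IsAssociator a := by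
  intro Y r s t
  set x := lift (T.proj r) (lift (T.proj s) (T.proj t)) with hx
  let A : Six T x :=
    { t₀ := r
      t₁ := s
      t₂ := t
      t₀₁ := M.mul r s
      t₁₂ := M.mul s t
      -- One bracketing has to be chosen here. With (rs)t, the factor over (g₀g₁, g₂) is a value of
      -- τ and only the one over (g₀, g₁g₂) is not.
      t₀₁₂ := M.mul (M.mul r s) t
      h₀ := by simp [hx]
      h₁ := by simp [hx]
      h₂ := by simp [hx]
      h₀₁ := M.proj_mul _ _
      h₁₂ := M.proj_mul _ _
      h₀₁₂ := by rw [M.proj_mul, M.proj_mul] }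
  -- The obstruction equation with κ_T moved to the other side, so that both members are explicit
  -- sections of δ²(δ¹T).
  have h1 : (delta2Map τ).toEquiv ((delta2Trivial J F G).toEquiv (unitAt J F x)) =
      (kappa T).toEquiv ((mulIso a).toEquiv (unitAt J F x)) := by
    rw [← ha Y (unitAt J F x)]
    exact ((kappa T).toEquiv.apply_symm_apply _).symm
  rw [mulIso_unitAt, Iso.toEquiv_act, delta2Trivial_unitAt, delta2Map_delta2Tmul,
    show (kappa T).toEquiv (unitAt J F x) = kappaTmul A from
      LocalIso.toIso_eq _ ⟨A, (Torsor.one_act _ _).symm⟩] at h1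
  obtain ⟨f, hf⟩ := T.exists_act (t := M.mul r (M.mul s t)) (t' := M.mul (M.mul r s) t)
    (by simp only [M.proj_mul, mul_assoc])
  have e₁₂ : A.s₁₂ = τ.toEquiv (unitAt J F (x ≫ p12 G)) := (H _ _ _ _ _ _).symm
  have e₀₁' : A.s₀₁' = τ.toEquiv (unitAt J F (x ≫ m01 G)) := (H _ _ _ _ _ _).symm
  have e₀₁ : A.s₀₁ = τ.toEquiv (unitAt J F (x ≫ p01 G)) := (H _ _ _ _ _ _).symm
  have hp : T.proj (M.mul r (M.mul s t)) = (x ≫ m12 G) ≫ μ[G] := by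
    rw [M.proj_mul, M.proj_mul, comp_mul_eq]
    simp [hx, m12, MonObj.comp_mul]
  -- Here τ has the middle factor r(st), whereas the six sections contain (rs)t = f · r(st); the
  -- dual slot turns f into f⁻¹.
  have e₁₂' : A.s₁₂' = (delta1 T).act f⁻¹ (τ.toEquiv (unitAt J F (x ≫ m12 G))) := by
    rw [H (x ≫ m12 G) r (M.mul s t) (by simp [hx, m12, MonObj.comp_mul, M.proj_mul]) hp
      (by simp [hx, m12])]
    exact delta1Tmul_act_mid _ _ _ _ _ hf
  have h2 := delta2Tmul_act x (P := delta1 T) (f₁₂ := 1) (f₀₁' := 1) (f₀₁ := 1)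
    (r₁₂ := A.s₁₂) (r₀₁' := A.s₀₁') (r₁₂' := A.s₁₂') (r₀₁ := A.s₀₁)
    (by rw [τ.proj_toEquiv, proj_unitAt]) (by rw [τ.proj_toEquiv, proj_unitAt])
    (by rw [τ.proj_toEquiv, proj_unitAt]) (by rw [τ.proj_toEquiv, proj_unitAt])
    (proj_delta1Tmul _ _ _ _ _ _ _) (proj_delta1Tmul _ _ _ _ _ _ _)
    (proj_delta1Tmul _ _ _ _ _ _ _) (proj_delta1Tmul _ _ _ _ _ _ _)
    (e₁₂.trans (Torsor.one_act _ _).symm) (e₀₁'.trans (Torsor.one_act _ _).symm)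
    e₁₂' (e₀₁.trans (Torsor.one_act _ _).symm)
  rw [h1] at h2
  change kappaTmul A = _ at h2
  rw [← Torsor.mul_act] at h2
  -- The section of κ_T is thus fixed by f⁻¹a, and freeness gives f = a.
  have h3 := (act_eq_self_iff _).1 h2.symm
  simp only [inv_one, mul_one, one_mul] at h3
  rw [hf, inv_mul_eq_one.1 h3]

/-- The composition defining u_τ is an automorphism of a trivial torsor, hence a multiplication. -/
lemma exists_isObstruction (T : Torsor J F G)
    (τ : Iso (Torsor.trivial J F (G ⊗ G)) (delta1 T)) : ∃ a, IsObstruction T τ a :=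
  exists_mulIso _

end Multiplication

end Torsor

end

end TorsExt
namespace TorsExt

noncomputable section

variable {C : Type u} [Category.{v} C] [CartesianMonoidalCategory C] [BraidedCategory C]
  {J : GrothendieckTopology C} [J.Subcanonical] {F G : C} [GrpObj F] [IsCommMonObj F] [GrpObj G]

/-! ### The Hochschild differentials evaluated at generalised points -/

section Hochschild

variable {Y : C}

lemma comp_hd1 (g₀ g₁ : Y ⟶ G) (u : G ⟶ F) :
    lift g₀ g₁ ≫ hd1 G F u = (g₁ ≫ u) * ((g₀ * g₁) ≫ u)⁻¹ * (g₀ ≫ u) := by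
  change lift g₀ g₁ ≫ ((snd G G ≫ u) * (μ[G] ≫ u)⁻¹ * (fst G G ≫ u)) = _
  simp only [MonObj.comp_mul, GrpObj.comp_inv, ← Category.assoc, Torsor.comp_mul_eq, lift_fst,
    lift_snd]

lemma comp_hd2 (g₀ g₁ g₂ : Y ⟶ G) (u : G ⊗ G ⟶ F) :
    lift g₀ (lift g₁ g₂) ≫ hd2 G F u = (lift g₁ g₂ ≫ u) * (lift (g₀ * g₁) g₂ ≫ u)⁻¹ *
      (lift g₀ (g₁ * g₂) ≫ u) * (lift g₀ g₁ ≫ u)⁻¹ := by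
  change lift g₀ (lift g₁ g₂) ≫
    ((p12 G ≫ u) * (m01 G ≫ u)⁻¹ * (m12 G ≫ u) * (p01 G ≫ u)⁻¹) = _
  have h₁ : lift g₀ (lift g₁ g₂) ≫ p12 G = lift g₁ g₂ := by simp [p12]
  have h₂ : lift g₀ (lift g₁ g₂) ≫ m01 G = lift (g₀ * g₁) g₂ := by simp [m01, MonObj.comp_mul]
  have h₃ : lift g₀ (lift g₁ g₂) ≫ m12 G = lift g₀ (g₁ * g₂) := by simp [m12, MonObj.comp_mul]
  have h₄ : lift g₀ (lift g₁ g₂) ≫ p01 G = lift g₀ g₁ := by simp [p01]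
  simp only [MonObj.comp_mul, GrpObj.comp_inv, ← Category.assoc, h₁, h₂, h₃, h₄]

lemma comp_hd3 (g₀ g₁ g₂ g₃ : Y ⟶ G) (u : G ⊗ G ⊗ G ⟶ F) :
    lift g₀ (lift g₁ (lift g₂ g₃)) ≫ hd3 G F u = (lift g₁ (lift g₂ g₃) ≫ u) *
      (lift (g₀ * g₁) (lift g₂ g₃) ≫ u)⁻¹ * (lift g₀ (lift (g₁ * g₂) g₃) ≫ u) *
      (lift g₀ (lift g₁ (g₂ * g₃)) ≫ u)⁻¹ * (lift g₀ (lift g₁ g₂) ≫ u) := by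
  simp only [hd3, MonoidHom.mk'_apply, MonObj.comp_mul, GrpObj.comp_inv, ← Category.assoc,
    comp_lift, lift_fst, lift_snd]

end Hochschild

namespace Torsor

/-! ### The cocycle identity, and change of product or of torsor -/

namespace Multiplication

variable {T T' T'' : Torsor J F G}

@[ext]
lemma ext' {M M' : Multiplication T} (h : ∀ ⦃Y : C⦄ (s t : T.At Y), M.mul s t = M'.mul s t) :
    M = M' := by
  cases M; cases M'
  congr 1
  funext Y s t
  exact h s t

/-- This is the pentagon: the two chains of rebracketings from ((qr)s)t to q(r(st)) give the same
scalar, since F acts freely. It suffices to check it locally on G⁴, where the universal quadruple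
lifts to sections of T. -/
lemma IsAssociator.hd3_eq_one {M : Multiplication T} {a : G ⊗ G ⊗ G ⟶ F} (h : M.IsAssociator a) :
    hd3 G F a = 1 := by
  obtain ⟨A₀, hA₀, e₀⟩ := T.locally_nonempty (fst G (G ⊗ G ⊗ G))
  obtain ⟨A₁, hA₁, e₁⟩ := T.locally_nonempty (snd G (G ⊗ G ⊗ G) ≫ fst _ _)
  obtain ⟨A₂, hA₂, e₂⟩ := T.locally_nonempty (snd G (G ⊗ G ⊗ G) ≫ snd _ _ ≫ fst _ _)
  obtain ⟨A₃, hA₃, e₃⟩ := T.locally_nonempty (snd G (G ⊗ G ⊗ G) ≫ snd _ _ ≫ snd _ _)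
  refine hom_ext (J.intersection_covering (J.intersection_covering hA₀ hA₁)
    (J.intersection_covering hA₂ hA₃)) fun Z k hk => ?_
  obtain ⟨q, hq⟩ := e₀ k hk.1.1
  obtain ⟨r, hr⟩ := e₁ k hk.1.2
  obtain ⟨s, hs⟩ := e₂ k hk.2.1
  obtain ⟨t, ht⟩ := e₃ k hk.2.2
  have hk : k = lift (T.proj q) (lift (T.proj r) (lift (T.proj s) (T.proj t))) := by
    rw [hq, hr, hs, ht, ← comp_lift, ← comp_lift, ← comp_lift]
    have h₁ : lift (snd G (G ⊗ G ⊗ G) ≫ snd G (G ⊗ G) ≫ fst G G)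
        (snd G (G ⊗ G ⊗ G) ≫ snd G (G ⊗ G) ≫ snd G G) = snd _ _ ≫ snd _ _ := by
      rw [← comp_lift, ← comp_lift, lift_fst_snd, Category.comp_id]
    rw [h₁, ← comp_lift, lift_fst_snd, Category.comp_id, lift_fst_snd, Category.comp_id]
  rw [hk, comp_hd3, MonObj.comp_one]
  -- The short side of the pentagon, through (qr)(st).
  have p1 : M.mul (M.mul (M.mul q r) s) t =
      T.act ((lift (T.proj q * T.proj r) (lift (T.proj s) (T.proj t)) ≫ a) *
        (lift (T.proj q) (lift (T.proj r) (T.proj s * T.proj t)) ≫ a))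
        (M.mul q (M.mul r (M.mul s t))) := by
    rw [h (M.mul q r) s t, h q r (M.mul s t), T.mul_act]
    simp only [M.proj_mul]
  -- The long side, through (q(rs))t and q((rs)t); biequivariance moves the scalars of inner
  -- products to the front.
  have p2 : M.mul (M.mul (M.mul q r) s) t =
      T.act ((lift (T.proj q) (lift (T.proj r) (T.proj s)) ≫ a) *
        (lift (T.proj q) (lift (T.proj r * T.proj s) (T.proj t)) ≫ a) *
        (lift (T.proj r) (lift (T.proj s) (T.proj t)) ≫ a))
        (M.mul q (M.mul r (M.mul s t))) := by
    rw [h q r s, M.act_mul, h q (M.mul r s) t, h r s t, M.mul_act, T.mul_act, T.mul_act]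
    simp only [M.proj_mul]
  have p3 := T.act_inj (p1.symm.trans p2)
  generalize lift (T.proj q * T.proj r) (lift (T.proj s) (T.proj t)) ≫ a = x₁ at *
  generalize lift (T.proj q) (lift (T.proj r) (T.proj s * T.proj t)) ≫ a = x₂ at *
  generalize lift (T.proj q) (lift (T.proj r) (T.proj s)) ≫ a = x₃ at *
  generalize lift (T.proj q) (lift (T.proj r * T.proj s) (T.proj t)) ≫ a = x₄ at *
  generalize lift (T.proj r) (lift (T.proj s) (T.proj t)) ≫ a = x₅ at *
  calc x₅ * x₁⁻¹ * x₄ * x₂⁻¹ * x₃ = (x₃ * x₄ * x₅) * (x₁ * x₂)⁻¹ := by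
        rw [mul_inv]; ac_rfl
    _ = 1 := by rw [← p3, mul_inv_cancel]

lemma IsAssociator.mem_ker {M : Multiplication T} {a : G ⊗ G ⊗ G ⟶ F} (h : M.IsAssociator a) :
    a ∈ (hd3 G F).ker :=
  h.hd3_eq_one

/-- The universal triple of points of G lifts to T locally, and F acts freely on sections of T. -/
lemma IsAssociator.unique {M : Multiplication T} {a b : G ⊗ G ⊗ G ⟶ F} (ha : M.IsAssociator a)
    (hb : M.IsAssociator b) : a = b := by
  obtain ⟨A₀, hA₀, e₀⟩ := T.locally_nonempty (fst G (G ⊗ G))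
  obtain ⟨A₁, hA₁, e₁⟩ := T.locally_nonempty (snd G (G ⊗ G) ≫ fst _ _)
  obtain ⟨A₂, hA₂, e₂⟩ := T.locally_nonempty (snd G (G ⊗ G) ≫ snd _ _)
  refine hom_ext (J.intersection_covering (J.intersection_covering hA₀ hA₁) hA₂) fun Z k hk => ?_
  obtain ⟨r, hr⟩ := e₀ k hk.1.1
  obtain ⟨s, hs⟩ := e₁ k hk.1.2
  obtain ⟨t, ht⟩ := e₂ k hk.2
  have hk : k = lift (T.proj r) (lift (T.proj s) (T.proj t)) := by
    rw [hr, hs, ht, ← comp_lift, ← comp_lift, ← comp_lift, lift_fst_snd, Category.comp_id,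
      lift_fst_snd, Category.comp_id]
  rw [hk]
  exact T.act_inj ((ha r s t).symm.trans (hb r s t))

/-- The multiplication obtained by multiplying the trivialisation of `δ¹ T` by `u ∈ F(G²)`. -/
def twist (M : Multiplication T) (u : G ⊗ G ⟶ F) : Multiplication T where
  mul s t := T.act (lift (T.proj s) (T.proj t) ≫ u)⁻¹ (M.mul s t)
  res_mul h s t := by
    rw [T.res_act, M.res_mul, T.proj_res, T.proj_res, ← comp_lift, GrpObj.comp_inv, Category.assoc]
  proj_mul s t := by rw [T.proj_act, M.proj_mul]
  act_mul_act f g s t := by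
    rw [M.act_mul_act, T.proj_act, T.proj_act, T.act_comm]

lemma twist_mul (M : Multiplication T) (u : G ⊗ G ⟶ F) {Y : C} (s t : T.At Y) :
    (M.twist u).mul s t = T.act (lift (T.proj s) (T.proj t) ≫ u)⁻¹ (M.mul s t) := rfl

/-- The product occupies the dual slot of δ¹T, so the inverse in the twisted product becomes u
itself on the trivialisation. -/
lemma Presents.twist {M : Multiplication T}
    {τ : Iso (Torsor.trivial J F (G ⊗ G)) (delta1 T)} (H : M.Presents τ) (u : G ⊗ G ⟶ F) :
    (M.twist u).Presents ((mulIso u).trans τ) := by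
  refine presents_of_lift fun Y t₀ t₁ h₁ h₀₁ h₀ => ?_
  change τ.toEquiv ((mulIso u).toEquiv _) = _
  have h : T.proj (M.mul t₀ t₁) = lift (T.proj t₀) (T.proj t₁) ≫ μ[G] := by
    rw [← h₀₁, proj_mul, proj_mul]
  rw [mulIso_unitAt, τ.toEquiv_act, H _ t₀ t₁ h₁ h h₀,
    delta1Tmul_act_mid _ h₁ h h₀ h₀₁ (M.twist_mul u t₀ t₁), inv_inv]

/-- The bracketing (rs)t collects the inverses of u(r,s) and u(rs,t), and r(st) those of u(s,t) and
u(r,st), written here at the underlying points. Their quotient is d²u. -/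
lemma IsAssociator.twist {M : Multiplication T} {a : G ⊗ G ⊗ G ⟶ F} (h : M.IsAssociator a)
    (u : G ⊗ G ⟶ F) : (M.twist u).IsAssociator (a * hd2 G F u) := by
  intro Y r s t
  simp only [twist_mul, M.act_mul, M.mul_act, T.proj_act, M.proj_mul, h r s t, ← T.mul_act,
    MonObj.comp_mul, comp_hd2]
  congr 1
  generalize lift (T.proj r) (lift (T.proj s) (T.proj t)) ≫ a = x₁
  generalize lift (T.proj r) (T.proj s) ≫ u = x₂
  generalize lift (T.proj r * T.proj s) (T.proj t) ≫ u = x₃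
  generalize lift (T.proj s) (T.proj t) ≫ u = x₄
  generalize lift (T.proj r) (T.proj s * T.proj t) ≫ u = x₅
  calc x₃⁻¹ * (x₂⁻¹ * x₁) = x₁ * (x₄ * x₃⁻¹ * x₅ * x₂⁻¹) * (x₅ * x₄)⁻¹ := by
        rw [show x₁ * (x₄ * x₃⁻¹ * x₅ * x₂⁻¹) = x₃⁻¹ * (x₂⁻¹ * x₁) * (x₅ * x₄) by ac_rfl,
          mul_inv_cancel_right]
    _ = _ := by rw [mul_inv]

/-- Any two multiplications on `T` differ by an element of `F(G²)`. -/
lemma exists_eq_twist (M M' : Multiplication T) : ∃ u : G ⊗ G ⟶ F, M' = M.twist u := by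
  obtain ⟨A, hA, eA⟩ := T.locally_nonempty (fst G G)
  obtain ⟨B, hB, eB⟩ := T.locally_nonempty (snd G G)
  -- The ratio of the two products of s and t is a section of F. By biequivariance of both products
  -- it depends only on the images of s and t in G, so the local ratios glue over G².
  obtain ⟨u, hu⟩ := hom_glue (J := J) (X := F) (Y := G ⊗ G)
    (fun Z k f => ∃ s t : T.At Z, lift (T.proj s) (T.proj t) = k ∧
      M'.mul s t = T.act f⁻¹ (M.mul s t))
    (by
      rintro Z W h k f ⟨s, t, rfl, e⟩
      refine ⟨res k s, res k t, by rw [T.proj_res, T.proj_res, comp_lift], ?_⟩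
      rw [← M'.res_mul, e, T.res_act, M.res_mul, GrpObj.comp_inv])
    (by
      rintro Z h f f' ⟨s, t, e, h₁⟩ ⟨s', t', e', h₂⟩
      obtain ⟨a, rfl⟩ := T.exists_act (t := s) (t' := s') (by
        have := congrArg (· ≫ fst G G) (e.trans e'.symm)
        simpa using this)
      obtain ⟨b, rfl⟩ := T.exists_act (t := t) (t' := t') (by
        have := congrArg (· ≫ snd G G) (e.trans e'.symm)
        simpa using this)
      rw [M.act_mul_act, M'.act_mul_act, h₁, T.act_comm] at h₂
      -- Both members carry the scalar ab; acting with its inverse leaves the two candidate ratios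
      -- applied to the same product.
      exact inv_injective (T.act_inj (T.act_inv_act (a * b) _ ▸
        T.act_inv_act (a * b) (T.act f'⁻¹ _) ▸ congrArg (T.act (a * b)⁻¹)
          ((T.act_comm _ _ _).trans (h₂.trans (T.act_comm _ _ _))))))
    (J.intersection_covering hA hB)
    (by
      intro Z k hk
      obtain ⟨s, hs⟩ := eA k hk.1
      obtain ⟨t, ht⟩ := eB k hk.2
      obtain ⟨f, hf⟩ := T.exists_act (t := M.mul s t) (t' := M'.mul s t)
        (by rw [M.proj_mul, M'.proj_mul])
      refine ⟨f⁻¹, s, t, ?_, by rw [inv_inv, hf]⟩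
      rw [hs, ht, ← comp_lift, lift_fst_snd, Category.comp_id])
  refine ⟨u, ext' fun Y s t => ?_⟩
  obtain ⟨f, hf⟩ := T.exists_act (t := M.mul s t) (t' := M'.mul s t)
    (by rw [M.proj_mul, M'.proj_mul])
  rw [twist_mul, hu _ f⁻¹ ⟨s, t, rfl, by rw [inv_inv, hf]⟩, inv_inv, hf]

/-- An isomorphism of torsors compatible with given multiplications. -/
def IsHom (φ : Iso T T') (M : Multiplication T) (M' : Multiplication T') : Prop :=
  ∀ ⦃Y : C⦄ (s t : T.At Y), φ.toEquiv (M.mul s t) = M'.mul (φ.toEquiv s) (φ.toEquiv t)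

lemma IsHom.symm {φ : Iso T T'} {M : Multiplication T} {M' : Multiplication T'}
    (h : IsHom φ M M') : IsHom φ.symm M' M := fun Y s t => by
  refine φ.toEquiv.injective ?_
  change φ.toEquiv (φ.toEquiv.symm _) = φ.toEquiv (M.mul (φ.toEquiv.symm _) (φ.toEquiv.symm _))
  rw [h, Equiv.apply_symm_apply, Equiv.apply_symm_apply, Equiv.apply_symm_apply]

lemma IsHom.trans {φ : Iso T T'} {ψ : Iso T' T''} {M : Multiplication T} {M' : Multiplication T'}
    {M'' : Multiplication T''} (h : IsHom φ M M') (h' : IsHom ψ M' M'') :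
    IsHom (φ.trans ψ) M M'' := fun Y s t => by
  change ψ.toEquiv (φ.toEquiv _) = M''.mul (ψ.toEquiv (φ.toEquiv _)) (ψ.toEquiv (φ.toEquiv _))
  rw [h, h']

lemma IsHom.isAssociator {φ : Iso T T'} {M : Multiplication T} {M' : Multiplication T'}
    (h : IsHom φ M M') {a : G ⊗ G ⊗ G ⟶ F} (ha : M.IsAssociator a) : M'.IsAssociator a := by
  intro Y r s t
  obtain ⟨r, rfl⟩ := φ.toEquiv.surjective r
  obtain ⟨s, rfl⟩ := φ.toEquiv.surjective s
  obtain ⟨t, rfl⟩ := φ.toEquiv.surjective t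
  rw [← h, ← h, ← h, ← h, ha r s t, φ.toEquiv_act]
  simp only [φ.proj_toEquiv]

/-- Transport of a multiplication along an isomorphism of torsors. -/
def map (φ : Iso T T') (M : Multiplication T) : Multiplication T' where
  mul s t := φ.toEquiv (M.mul (φ.symm.toEquiv s) (φ.symm.toEquiv t))
  res_mul h s t := by rw [← φ.res_toEquiv, M.res_mul, φ.symm.res_toEquiv, φ.symm.res_toEquiv]
  proj_mul s t := by
    rw [φ.proj_toEquiv, M.proj_mul, φ.symm.proj_toEquiv, φ.symm.proj_toEquiv]
  act_mul_act f g s t := by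
    rw [φ.symm.toEquiv_act, φ.symm.toEquiv_act, M.act_mul_act, φ.toEquiv_act]

lemma isHom_map (φ : Iso T T') (M : Multiplication T) : IsHom φ M (M.map φ) := fun Y s t => by
  change _ = φ.toEquiv (M.mul (φ.toEquiv.symm _) (φ.toEquiv.symm _))
  rw [Equiv.symm_apply_apply, Equiv.symm_apply_apply]

/-- Associators of multiplications on isomorphic torsors differ by a coboundary. -/
lemma IsAssociator.exists_eq_mul_hd2 (φ : Iso T T') {M : Multiplication T}
    {M' : Multiplication T'} {a a' : G ⊗ G ⊗ G ⟶ F} (h : M.IsAssociator a)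
    (h' : M'.IsAssociator a') : ∃ u, a' = a * hd2 G F u := by
  -- Transport along φ preserves the associator, so only two products on one and the same torsor
  -- remain to be compared.
  obtain ⟨u, rfl⟩ := exists_eq_twist (M.map φ) M'
  exact ⟨u, h'.unique (((isHom_map φ M).isAssociator h).twist u)⟩

variable (J F G) in
/-- The multiplication of the product group `F × G`. -/
def trivial : Multiplication (Torsor.trivial J F G) where
  mul s t := ⟨(s.down.1 * t.down.1, s.down.2 * t.down.2)⟩
  res_mul h s t := ULift.ext _ _ (Prod.ext (MonObj.comp_mul h _ _) (MonObj.comp_mul h _ _))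
  proj_mul _ _ := rfl
  act_mul_act f g s t := ULift.ext _ _ (Prod.ext (mul_mul_mul_comm _ _ _ _) rfl)

/-- Each section of F_G is a scalar times a unit section, and the scalars f₁, (f₀f₁)⁻¹, f₀ cancel.
Hence the base point for α, the trivialisation τ₀, is the product group F × G. -/
lemma trivial_presents : (trivial J F G).Presents (delta1Trivial J F G) := by
  intro Y x t₀ t₁ h₁ h₀₁ h₀
  rw [delta1Trivial_unitAt]
  have e : ∀ {X : C} (t : (Torsor.trivial J F X).At Y) {g : Y ⟶ X}
      (h : (Torsor.trivial J F X).proj t = g),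
      t = (Torsor.trivial J F X).act t.down.1 (unitAt J F g) := by
    rintro X t _ rfl
    exact ULift.ext _ _ (Prod.ext (mul_one _).symm rfl)
  refine Eq.symm ((delta1Tmul_act x (proj_unitAt _) (proj_unitAt _) (proj_unitAt _) h₁ h₀₁ h₀
    (e _ h₁) (e _ h₀₁) (e _ h₀)).trans ?_)
  rw [act_eq_self_iff]
  change t₁.down.1 * (t₀.down.1 * t₁.down.1)⁻¹ * t₀.down.1 = 1
  rw [mul_inv_rev, mul_inv_cancel_left, inv_mul_cancel]

lemma trivial_isAssociator : (trivial J F G).IsAssociator 1 := by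
  intro Y r s t
  rw [MonObj.comp_one, Torsor.one_act]
  exact ULift.ext _ _ (Prod.ext (mul_assoc _ _ _) (mul_assoc _ _ _))

/-! ### Contracted products of multiplications -/

section Tensor

lemma tmul_congr {T T' : Torsor J F G} {Y : C} {a b : T.At Y} {a' b' : T'.At Y} (h : a = b)
    (h' : a' = b') (e e') : tmul a a' e = tmul b b' e' := by
  subst h h'; rfl

lemma mul_compat (M : Multiplication T) (M' : Multiplication T') {Y : C} {s t : T.At Y}
    {s' t' : T'.At Y} (e : T.proj s = T'.proj s') (d : T.proj t = T'.proj t') :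
    T.proj (M.mul s t) = T'.proj (M'.mul s' t') := by
  rw [M.proj_mul, M'.proj_mul, e, d]

/-- Sections of T ⊗ T' are only locally of the form t ⊗ t'. For such sections the componentwise
product is well defined: antidiagonal changes by f and g amount to the antidiagonal change by fg.
Hence the local products glue. -/
lemma exists_tensorMul (M : Multiplication T) (M' : Multiplication T') {Y : C}
    (o p : (Torsor.tensor T T').At Y) : ∃ r : (Torsor.tensor T T').At Y,
    ∀ ⦃Z : C⦄ (h : Z ⟶ Y) (r' : (Torsor.tensor T T').At Z),
      (∃ (a : T.At Z) (a' : T'.At Z) (e : _) (b : T.At Z) (b' : T'.At Z) (d : _),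
        res h o = tmul a a' e ∧ res h p = tmul b b' d ∧
        r' = tmul (M.mul a b) (M'.mul a' b') (mul_compat M M' e d)) → res h r = r' := by
  obtain ⟨R, hR, ho⟩ := exists_tmul o
  obtain ⟨R', hR', hp⟩ := exists_tmul p
  refine sheaf_glue (Torsor.tensor T T').isSheaf _ ?_ ?_ (J.intersection_covering hR hR') ?_
  · rintro Z W h k _ ⟨a, a', e, b, b', d, h1, h2, rfl⟩
    refine ⟨res k a, res k a', by rw [T.proj_res, T'.proj_res, e], res k b, res k b',
      by rw [T.proj_res, T'.proj_res, d], ?_, ?_, ?_⟩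
    · rw [← res_res, h1, res_tmul]
    · rw [← res_res, h2, res_tmul]
    · rw [res_tmul]; exact tmul_congr (M.res_mul _ _ _) (M'.res_mul _ _ _) _ _
  · rintro Z h _ _ ⟨a, a', e, b, b', d, h1, h2, rfl⟩ ⟨a₁, a₁', e₁, b₁, b₁', d₁, h3, h4, rfl⟩
    obtain ⟨f, rfl, rfl⟩ := tmul_eq_iff.1 (h1.symm.trans h3)
    obtain ⟨g, rfl, rfl⟩ := tmul_eq_iff.1 (h2.symm.trans h4)
    exact tmul_eq_iff.2 ⟨f * g, M.act_mul_act _ _ _ _, by rw [M'.act_mul_act, mul_inv]⟩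
  · intro Z h hh
    obtain ⟨a, a', e, h1⟩ := ho h hh.1
    obtain ⟨b, b', d, h2⟩ := hp h hh.2
    exact ⟨_, a, a', e, b, b', d, h1, h2, rfl⟩

/-- The product on `T ⊗ T'` with `(s ⊗ s') (t ⊗ t') = (s t) ⊗ (s' t')`. -/
def tensorMul (M : Multiplication T) (M' : Multiplication T') {Y : C}
    (o p : (Torsor.tensor T T').At Y) : (Torsor.tensor T T').At Y :=
  (exists_tensorMul M M' o p).choose

lemma res_tensorMul_eq (M : Multiplication T) (M' : Multiplication T') {Y Z : C} (h : Z ⟶ Y)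
    {o p : (Torsor.tensor T T').At Y} {a b : T.At Z} {a' b' : T'.At Z} {e d}
    (h1 : res h o = tmul a a' e) (h2 : res h p = tmul b b' d) :
    res h (tensorMul M M' o p) = tmul (M.mul a b) (M'.mul a' b') (mul_compat M M' e d) :=
  (exists_tensorMul M M' o p).choose_spec h _ ⟨a, a', e, b, b', d, h1, h2, rfl⟩

/-- Two sections of a torsor depending on two sections of `T ⊗ T'` agree as soon as their
restrictions agree wherever the latter are of the form `t ⊗ t'`. -/
lemma tensor_ext₂ {P : Torsor J F G} {Y : C} (o p : (Torsor.tensor T T').At Y) {q q' : P.At Y}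
    (h : ∀ ⦃Z : C⦄ (k : Z ⟶ Y) (a b : T.At Z) (a' b' : T'.At Z) (e d),
      res k o = tmul a a' e → res k p = tmul b b' d → res k q = res k q') : q = q' := by
  obtain ⟨R, hR, ho⟩ := exists_tmul o
  obtain ⟨R', hR', hp⟩ := exists_tmul p
  refine sheaf_ext P.isSheaf (J.intersection_covering hR hR') fun Z k hk => ?_
  obtain ⟨a, a', e, h1⟩ := ho k hk.1
  obtain ⟨b, b', d, h2⟩ := hp k hk.2
  exact h k a b a' b' e d h1 h2

/-- The contracted product of two multiplications. -/
def tensor (M : Multiplication T) (M' : Multiplication T') :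
    Multiplication (Torsor.tensor T T') where
  mul := tensorMul M M'
  res_mul h o p := by
    refine tensor_ext₂ (res h o) (res h p) fun Z k a b a' b' e d h1 h2 => ?_
    rw [res_tensorMul_eq M M' k h1 h2, res_res]
    rw [res_res] at h1 h2
    exact res_tensorMul_eq M M' (k ≫ h) h1 h2
  proj_mul o p := by
    obtain ⟨R, hR, ho⟩ := exists_tmul o
    obtain ⟨R', hR', hp⟩ := exists_tmul p
    refine hom_ext (J.intersection_covering hR hR') fun W k hk => ?_
    obtain ⟨a, a', e, h1⟩ := ho k hk.1
    obtain ⟨b, b', d, h2⟩ := hp k hk.2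
    rw [MonObj.comp_mul, ← Torsor.proj_res, ← Torsor.proj_res, ← Torsor.proj_res,
      res_tensorMul_eq M M' k h1 h2, h1, h2]
    exact M.proj_mul a b
  act_mul_act f g o p := by
    refine tensor_ext₂ o p fun Z k a b a' b' e d h1 h2 => ?_
    rw [res_tensorMul_eq M M' k (a := T.act (k ≫ f) a) (a' := a') (b := T.act (k ≫ g) b)
      (b' := b') (e := by rw [T.proj_act, e]) (d := by rw [T.proj_act, d])
      (by rw [Torsor.res_act, h1, act_tmul']) (by rw [Torsor.res_act, h2, act_tmul']),
      Torsor.res_act, res_tensorMul_eq M M' k h1 h2, act_tmul', MonObj.comp_mul]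
    exact tmul_congr (M.act_mul_act _ _ _ _) rfl _ _

lemma tensor_mul_tmul (M : Multiplication T) (M' : Multiplication T') {Y : C} {a b : T.At Y}
    {a' b' : T'.At Y} (e d) :
    (M.tensor M').mul (tmul a a' e) (tmul b b' d) =
      tmul (M.mul a b) (M'.mul a' b') (mul_compat M M' e d) := by
  have := res_tensorMul_eq M M' (𝟙 Y) (res_id (tmul a a' e)) (res_id (tmul b b' d))
  rwa [res_id] at this

/-- On tensors t ⊗ t' each component contributes its own associator, evaluated at the same triple of
points of G. This is what makes ξ multiplicative. -/
lemma IsAssociator.tensor {M : Multiplication T} {M' : Multiplication T'}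
    {a a' : G ⊗ G ⊗ G ⟶ F} (h : M.IsAssociator a) (h' : M'.IsAssociator a') :
    (M.tensor M').IsAssociator (a * a') := by
  intro Y o p q
  obtain ⟨R, hR, ho⟩ := exists_tmul o
  obtain ⟨R', hR', hp⟩ := exists_tmul p
  obtain ⟨R'', hR'', hq⟩ := exists_tmul q
  refine sheaf_ext (Torsor.tensor T T').isSheaf
    (J.intersection_covering (J.intersection_covering hR hR') hR'') fun W k hk => ?_
  obtain ⟨r, r', e₁, h₁⟩ := ho k hk.1.1
  obtain ⟨s, s', e₂, h₂⟩ := hp k hk.1.2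
  obtain ⟨t, t', e₃, h₃⟩ := hq k hk.2
  have hx : k ≫ lift ((Torsor.tensor T T').proj o)
      (lift ((Torsor.tensor T T').proj p) ((Torsor.tensor T T').proj q)) =
      lift (T.proj r) (lift (T.proj s) (T.proj t)) := by
    rw [comp_lift, comp_lift, ← Torsor.proj_res, ← Torsor.proj_res, ← Torsor.proj_res, h₁, h₂, h₃]
    rfl
  rw [Torsor.res_act, ← Category.assoc, hx]
  simp only [Multiplication.res_mul, h₁, h₂, h₃, tensor_mul_tmul]
  rw [MonObj.comp_mul]
  refine tmul_act_act (h r s t) ?_ _ _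
  rw [h' r' s' t', e₁, e₂, e₃]

/-- Both sides are compatible with restriction, and sections of T ⊗ T' are locally of the form t ⊗
t'. -/
lemma isHom_of_tmul {P : Torsor J F G} {φ : Iso (Torsor.tensor T T') P}
    {N : Multiplication (Torsor.tensor T T')} {M'' : Multiplication P}
    (h : ∀ ⦃Y : C⦄ (a b : T.At Y) (a' b' : T'.At Y) (e d),
      φ.toEquiv (N.mul (tmul a a' e) (tmul b b' d)) =
        M''.mul (φ.toEquiv (tmul a a' e)) (φ.toEquiv (tmul b b' d))) : IsHom φ N M'' := by
  intro Y o p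
  refine tensor_ext₂ o p fun Z k a b a' b' e d h1 h2 => ?_
  rw [← φ.res_toEquiv, N.res_mul, M''.res_mul, ← φ.res_toEquiv, ← φ.res_toEquiv, h1, h2, h]

lemma IsHom.tensorMap {T₁ T₂ T₁' T₂' : Torsor J F G} {φ : Iso T₁ T₂} {φ' : Iso T₁' T₂'}
    {M₁ : Multiplication T₁} {M₂ : Multiplication T₂} {M₁' : Multiplication T₁'}
    {M₂' : Multiplication T₂'} (h : IsHom φ M₁ M₂) (h' : IsHom φ' M₁' M₂') :
    IsHom (Torsor.tensorMap φ φ') (M₁.tensor M₁') (M₂.tensor M₂') := by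
  have key : ∀ ⦃Y : C⦄ (t : T₁.At Y) (t' : T₁'.At Y) (e),
      (Torsor.tensorMap φ φ').toEquiv (tmul t t' e) = tmul (φ.toEquiv t) (φ'.toEquiv t')
        (by rw [φ.proj_toEquiv, φ'.proj_toEquiv, e]) := fun Y t t' e =>
    LocalIso.toIso_eq _ ⟨t, t', e, rfl, rfl⟩
  refine isHom_of_tmul fun Y a b a' b' e d => ?_
  rw [tensor_mul_tmul, key, key, key, tensor_mul_tmul]
  exact tmul_congr (h _ _) (h' _ _) _ _

/-- Cocycles multiply when the twisted groups on F_G are contracted. Together with the description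
of the Baer sum as a contracted product, this makes α multiplicative. -/
lemma isHom_trivialTensor (u v : G ⊗ G ⟶ F) :
    IsHom (trivialTensor (Torsor.trivial J F G)).toIso
      (((trivial J F G).twist u).tensor ((trivial J F G).twist v))
      ((trivial J F G).twist (u * v)) := by
  have key : ∀ ⦃Y : C⦄ (t t' : (Torsor.trivial J F G).At Y) (e),
      (trivialTensor (Torsor.trivial J F G)).toIso.toEquiv (tmul t t' e) =
        (Torsor.trivial J F G).act t.down.1 t' := fun Y t t' e =>
    LocalIso.toIso_eq _ ⟨t, t', e, rfl, rfl⟩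
  refine isHom_of_tmul fun Y a b a' b' e d => ?_
  rw [tensor_mul_tmul, key, key, key]
  have e' : a.down.2 = a'.down.2 := e
  have d' : b.down.2 = b'.down.2 := d
  refine ULift.ext _ _ (Prod.ext ?_ rfl)
  change (lift a.down.2 b.down.2 ≫ u)⁻¹ * (a.down.1 * b.down.1) *
    ((lift a'.down.2 b'.down.2 ≫ v)⁻¹ * (a'.down.1 * b'.down.1)) =
    (lift a'.down.2 b'.down.2 ≫ (u * v))⁻¹ * ((a.down.1 * a'.down.1) * (b.down.1 * b'.down.1))
  -- The two components lie over the same points of G, so u and v are evaluated at the same pair;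
  -- the rest is commutativity of F.
  rw [e', d', MonObj.comp_mul, mul_inv]
  ac_rfl

end Tensor

end Multiplication

end Torsor

end

end TorsExt
namespace TorsExt

noncomputable section

variable {C : Type u} [Category.{v} C] [CartesianMonoidalCategory C] [BraidedCategory C]
  {J : GrothendieckTopology C} [J.Subcanonical] {F G : C} [GrpObj F] [IsCommMonObj F] [GrpObj G]

/-! ### From an associative product to a central extension -/

namespace Torsor.Multiplication

variable {T : Torsor J F G}

lemma IsAssociator.assoc {M : Multiplication T} (hM : M.IsAssociator 1) {Y : C} (r s t : T.At Y) :
    M.mul (M.mul r s) t = M.mul r (M.mul s t) := by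
  rw [hM r s t, MonObj.comp_one, T.one_act]

/-- A multiplication has a unique idempotent section over the unit of `G`. -/
lemma exists_one (M : Multiplication T) (Y : C) :
    ∃ e : T.At Y, T.proj e = 1 ∧ M.mul e e = e := by
  obtain ⟨A, hA, hex⟩ := T.locally_nonempty (1 : Y ⟶ G)
  have hex' : ∀ ⦃Z : C⦄ (k : Z ⟶ Y), A k → ∃ e : T.At Z, T.proj e = 1 ∧ M.mul e e = e := by
    intro Z k hk
    obtain ⟨t, ht⟩ := hex k hk
    rw [MonObj.comp_one] at ht
    -- Over the unit of G, a section and its square differ by a scalar f; then f⁻¹t squares to f⁻²f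
    -- t = f⁻¹t. No associativity is involved.
    obtain ⟨f, hf⟩ := T.exists_act (t := t) (t' := M.mul t t) (by rw [M.proj_mul, ht, mul_one])
    refine ⟨T.act f⁻¹ t, by rw [T.proj_act, ht], ?_⟩
    rw [M.act_mul_act, hf, ← T.mul_act, inv_mul_cancel_right]
  obtain ⟨e, he⟩ := sheaf_glue T.isSheaf (Y := Y)
    (fun Z k e => T.proj e = 1 ∧ M.mul e e = e)
    (by
      rintro Z W h k e ⟨h1, h2⟩
      exact ⟨by rw [T.proj_res, h1, MonObj.comp_one], by rw [← M.res_mul, h2]⟩)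
    (by
      rintro Z h e e' ⟨h1, h2⟩ ⟨h3, h4⟩
      obtain ⟨f, rfl⟩ := T.exists_act (h1.trans h3.symm)
      -- If e and fe are both idempotent, then f²e = fe, so f = 1; this uniqueness permits the
      -- gluing.
      rw [M.act_mul_act, h2] at h4
      rw [mul_eq_left.1 (T.act_inj h4), T.one_act]) hA hex'
  refine ⟨e, hom_ext hA fun Z k hk => ?_, sheaf_ext T.isSheaf hA fun Z k hk => ?_⟩
  · obtain ⟨e', h1, h2⟩ := hex' k hk
    rw [← T.proj_res, he k e' ⟨h1, h2⟩, h1, MonObj.comp_one]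
  · obtain ⟨e', h1, h2⟩ := hex' k hk
    rw [M.res_mul, he k e' ⟨h1, h2⟩, h2]

/-- The unit section of a multiplication. -/
def one (M : Multiplication T) (Y : C) : T.At Y := (M.exists_one Y).choose

lemma proj_one (M : Multiplication T) (Y : C) : T.proj (M.one Y) = 1 :=
  (M.exists_one Y).choose_spec.1

lemma one_mul_one (M : Multiplication T) (Y : C) : M.mul (M.one Y) (M.one Y) = M.one Y :=
  (M.exists_one Y).choose_spec.2

/-- Uniqueness turns the unit, which is chosen separately over each object, into a family compatible
with restriction. -/
lemma eq_one (M : Multiplication T) {Y : C} {e : T.At Y} (h : T.proj e = 1) (h' : M.mul e e = e) :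
    e = M.one Y := by
  obtain ⟨f, rfl⟩ := T.exists_act ((M.proj_one Y).trans h.symm)
  rw [M.act_mul_act, M.one_mul_one] at h'
  rw [mul_eq_left.1 (T.act_inj h'), T.one_act]

lemma res_one (M : Multiplication T) {Y Z : C} (k : Z ⟶ Y) : res k (M.one Y) = M.one Z :=
  M.eq_one (by rw [T.proj_res, M.proj_one, MonObj.comp_one]) (by rw [← M.res_mul, M.one_mul_one])

/-- Multiplying t by the unit e gives ft for some scalar f. Comparing (ee)t with e(et) yields ft =
f²t, hence f = 1. -/
lemma IsAssociator.one_mul {M : Multiplication T} (hM : M.IsAssociator 1) {Y : C} (t : T.At Y) :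
    M.mul (M.one Y) t = t := by
  obtain ⟨f, hf⟩ := T.exists_act (t := t) (t' := M.mul (M.one Y) t)
    (by rw [M.proj_mul, M.proj_one, _root_.one_mul])
  have h := hM.assoc (M.one Y) (M.one Y) t
  rw [M.one_mul_one, hf, M.mul_act, hf, ← T.mul_act] at h
  rw [hf, mul_eq_left.1 (T.act_inj h).symm, T.one_act]

/-- A local section over the inverse point becomes a left inverse after rescaling, and the scalar is
forced; so the local left inverses are unique and glue. -/
lemma IsAssociator.exists_inv {M : Multiplication T} (hM : M.IsAssociator 1) {Y : C} (t : T.At Y) :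
    ∃ s : T.At Y, M.mul s t = M.one Y := by
  obtain ⟨A, hA, hex⟩ := T.locally_nonempty (T.proj t)⁻¹
  have hex' : ∀ ⦃Z : C⦄ (k : Z ⟶ Y), A k →
      ∃ s : T.At Z, T.proj s = (k ≫ T.proj t)⁻¹ ∧ M.mul s (res k t) = M.one Z := by
    intro Z k hk
    obtain ⟨s, hs⟩ := hex k hk
    rw [GrpObj.comp_inv] at hs
    obtain ⟨f, hf⟩ := T.exists_act (t := M.mul s (res k t)) (t' := M.one Z)
      (by rw [M.proj_mul, hs, T.proj_res, inv_mul_cancel, M.proj_one])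
    exact ⟨T.act f s, by rw [T.proj_act, hs], by rw [M.act_mul, hf]⟩
  obtain ⟨s, hs⟩ := sheaf_glue T.isSheaf (Y := Y)
    (fun Z k s => T.proj s = (k ≫ T.proj t)⁻¹ ∧ M.mul s (res k t) = M.one Z)
    (by
      rintro Z W h k s ⟨h1, h2⟩
      exact ⟨by rw [T.proj_res, h1, GrpObj.comp_inv, Category.assoc],
        by rw [← res_res, ← M.res_mul, h2, M.res_one]⟩)
    (by
      rintro Z h s s' ⟨h1, h2⟩ ⟨h3, h4⟩
      obtain ⟨f, rfl⟩ := T.exists_act (h1.trans h3.symm)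
      rw [M.act_mul, h2, act_eq_self_iff] at h4
      rw [h4, T.one_act]) hA hex'
  refine ⟨s, sheaf_ext T.isSheaf hA fun Z k hk => ?_⟩
  obtain ⟨s', h1, h2⟩ := hex' k hk
  rw [M.res_mul, hs k s' ⟨h1, h2⟩, h2, M.res_one]

/-- The group structure on sections given by an associative multiplication. -/
@[reducible]
def group (M : Multiplication T) (hM : M.IsAssociator 1) (Y : C) : Group (T.At Y) :=
  letI : Mul (T.At Y) := ⟨M.mul⟩
  letI : One (T.At Y) := ⟨M.one Y⟩
  letI : Inv (T.At Y) := ⟨fun t => (hM.exists_inv t).choose⟩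
  -- A left unit and left inverses are enough for a group.
  Group.ofLeftAxioms hM.assoc hM.one_mul fun t => (hM.exists_inv t).choose_spec

/-- The central extension given by an associative multiplication on a torsor. -/
def toExt (M : Multiplication T) (hM : M.IsAssociator 1) : CentralExt J F G where
  sec := T.sec
  isSheaf := T.isSheaf
  group := M.group hM
  res_mul := M.res_mul
  incl {Y} := letI := M.group hM Y
    MonoidHom.mk' (fun f => T.act f (M.one Y)) fun f g => by
      change _ = M.mul _ _
      rw [M.act_mul_act, M.one_mul_one]
  res_incl h f := (T.res_act _ _ _).trans (congrArg _ (M.res_one h))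
  proj {Y} := letI := M.group hM Y
    MonoidHom.mk' T.proj M.proj_mul
  proj_res := T.proj_res
  incl_injective {Y} f g h := T.act_inj h
  proj_eq_one_iff {Y} a := by
    constructor
    · intro h
      obtain ⟨f, hf⟩ := T.exists_act ((M.proj_one Y).trans h.symm)
      exact ⟨f, hf.symm⟩
    · rintro ⟨f, rfl⟩
      exact (T.proj_act _ _).trans (M.proj_one Y)
  proj_locally_surjective := T.locally_nonempty
  central {Y} f a := by
    let := M.group hM Y
    change M.mul (T.act f (M.one Y)) a = M.mul a (T.act f (M.one Y))
    rw [M.act_mul, M.mul_act, hM.one_mul]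
    -- The right unit law comes from the group structure just built; together with biequivariance it
    -- makes F central.
    exact congrArg (T.act f) (mul_one a).symm

/-- The torsor of `M.toExt` is the given one. -/
def toExtTorsor (M : Multiplication T) (hM : M.IsAssociator 1) : Iso (M.toExt hM).torsor T where
  toEquiv := Equiv.refl _
  res_toEquiv _ _ := rfl
  proj_toEquiv _ := rfl
  toEquiv_act {Y} f t := (M.act_mul f (M.one Y) t).trans (congrArg (T.act f) (hM.one_mul t))

end Torsor.Multiplication

/-! ### From a central extension to an associative product -/

namespace CentralExt

open TorsExt.Torsor (Multiplication)
open TorsExt.Torsor.Multiplication (IsHom)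

/-- The multiplication of an extension. -/
def multiplication (E : CentralExt J F G) : Multiplication E.torsor where
  mul s t := s * t
  res_mul h s t := E.res_mul h s t
  proj_mul s t := map_mul E.proj s t
  act_mul_act f g s t := E.mul_mul_eq f g s t

lemma multiplication_isAssociator (E : CentralExt J F G) : E.multiplication.IsAssociator 1 := by
  intro Y r s t
  rw [MonObj.comp_one, Torsor.one_act]
  exact mul_assoc _ _ _

lemma isHom_toExtTorsor {T : Torsor J F G} (M : Multiplication T) (hM : M.IsAssociator 1) :
    IsHom (M.toExtTorsor hM) (M.toExt hM).multiplication M := fun _ _ _ => rfl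

/-- The same φ serves on both sides. The two expressions for the value of τ have equal outer
factors, so they agree exactly when the middle factors φ(e₀e₁) and φ(e₀)φ(e₁) do. -/
lemma corresponds_iff {T : Torsor J F G} {M : Multiplication T}
    {τ : Torsor.Iso (Torsor.trivial J F (G ⊗ G)) (Torsor.delta1 T)} (H : M.Presents τ)
    (E : CentralExt J F G) : E.Corresponds T τ ↔ ∃ φ, IsHom φ E.multiplication M := by
  refine exists_congr fun φ => ⟨fun h Y e₀ e₁ => ?_, fun h Y e₀ e₁ => ?_⟩
  · refine Torsor.delta1Tmul_injective ((h Y e₀ e₁).symm.trans (H _ (φ.toEquiv e₀) (φ.toEquiv e₁)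
      (by rw [φ.proj_toEquiv, lift_snd]) ?_ (by rw [φ.proj_toEquiv, lift_fst])))
    rw [M.proj_mul, Torsor.comp_mul_eq, φ.proj_toEquiv, φ.proj_toEquiv, lift_fst, lift_snd]
  · have e := h e₀ e₁
    change φ.toEquiv (e₀ * e₁) = _ at e
    simp only [e]
    exact H _ _ _ _ _ _

/-- An isomorphism of torsors that is multiplicative is an isomorphism of extensions. -/
def isoOfIsHom {E E' : CentralExt J F G} (φ : Torsor.Iso E.torsor E'.torsor)
    (h : IsHom φ E.multiplication E'.multiplication) : Iso E E' where
  toMulEquiv {Y} := { φ.toEquiv (Y := Y) with map_mul' := fun a b => h a b }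
  res_toMulEquiv := φ.res_toEquiv
  toMulEquiv_incl {Y} f := by
    -- The image of the unit is idempotent in a group, hence the unit. Compatibility with F then
    -- follows by letting F act on the unit.
    have h1 : φ.toEquiv (1 : E.At Y) = (1 : E'.At Y) := by
      have := h (1 : E.At Y) (1 : E.At Y)
      change φ.toEquiv ((1 : E.At Y) * 1) = (φ.toEquiv (1 : E.At Y) * φ.toEquiv (1 : E.At Y) :
        E'.At Y) at this
      rw [mul_one] at this
      exact mul_eq_left.1 this.symm
    have h2 := φ.toEquiv_act f (1 : E.At Y)
    change φ.toEquiv (E.incl f * 1) = E'.incl f * φ.toEquiv (1 : E.At Y) at h2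
    rwa [h1, mul_one, mul_one] at h2
  proj_toMulEquiv := φ.proj_toEquiv

/-- Both products are determined by the same componentwise formula on tensors a ⊗ a', which exist
locally. -/
lemma isHom_baerTorsor (E E' : CentralExt J F G) :
    IsHom (baerTorsor E E') (baer E E').multiplication
      (E.multiplication.tensor E'.multiplication) := by
  intro Y o p
  refine Torsor.Multiplication.tensor_ext₂ o p fun Z k a b a' b' e d h1 h2 => ?_
  change res k (baerMul o p) = res k (Torsor.Multiplication.tensorMul _ _ o p)
  rw [res_baerMul_eq k h1 h2, Torsor.Multiplication.res_tensorMul_eq _ _ k h1 h2]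
  rfl

end CentralExt

/-! ### The homomorphism α and its injectivity -/

namespace Ext

open TorsExt.Torsor (Multiplication)
open TorsExt.Torsor.Multiplication (IsHom)

lemma mk_eq_iff {E E' : CentralExt J F G} : mk E = mk E' ↔ Nonempty (CentralExt.Iso E E') :=
  Quotient.eq (r := CentralExt.setoid J F G)

lemma mk_mul (E E' : CentralExt J F G) : mk E * mk E' = mk (CentralExt.baer E E') := rfl

lemma one_eq : (1 : Ext J F G) = mk (CentralExt.trivial J F G) := rfl

/-- Reduces equality of classes to a multiplicative isomorphism of torsors. The description of α,
its injectivity and exactness at Ext are all read off from this form. -/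
lemma mk_eq_mk_toExt_iff {T : Torsor J F G} {M : Multiplication T} {hM : M.IsAssociator 1}
    {E : CentralExt J F G} : mk (M.toExt hM) = mk E ↔ ∃ φ, IsHom φ E.multiplication M := by
  rw [eq_comm, mk_eq_iff]
  constructor
  · rintro ⟨φ⟩
    exact ⟨φ.torsor.trans (M.toExtTorsor hM), IsHom.trans (M' := (M.toExt hM).multiplication)
      (fun Y s t => map_mul φ.toMulEquiv s t) (CentralExt.isHom_toExtTorsor M hM)⟩
  · rintro ⟨φ, hφ⟩
    exact ⟨CentralExt.isoOfIsHom _ (hφ.trans (CentralExt.isHom_toExtTorsor M hM).symm)⟩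

variable (J) in
-- The product group has associator 1, and twisting by a multiplies it by d²a, which is 1 for a
-- cocycle.
lemma twist_isAssociator {a : G ⊗ G ⟶ F} (ha : a ∈ (hd2 G F).ker) :
    ((Multiplication.trivial J F G).twist a).IsAssociator 1 := by
  have := (Torsor.Multiplication.trivial_isAssociator (J := J) (F := F) (G := G)).twist a
  rwa [one_mul, MonoidHom.mem_ker.1 ha] at this

variable (J) in
/-- The extension of `G` by `F` given by a Hochschild `2`-cocycle. -/
def ofCocycle {a : G ⊗ G ⟶ F} (ha : a ∈ (hd2 G F).ker) : CentralExt J F G :=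
  ((Multiplication.trivial J F G).twist a).toExt (twist_isAssociator J ha)

variable (J F G) in
/-- The homomorphism from Hochschild `2`-cocycles to extensions. -/
def ofCocycleHom : (hd2 G F).ker →* Ext J F G :=
  MonoidHom.mk' (fun a => mk (ofCocycle J a.2)) fun a b => by
    rw [mk_mul]
    -- The Baer sum is the contracted product of two twisted copies of F_G, and the isomorphism F_G
    -- ⊗ F_G ≅ F_G multiplies the twists.
    refine mk_eq_mk_toExt_iff.2 ⟨_, (CentralExt.isHom_baerTorsor _ _).trans
      (((CentralExt.isHom_toExtTorsor _ _).tensorMap (CentralExt.isHom_toExtTorsor _ _)).trans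
        (Torsor.Multiplication.isHom_trivialTensor a.1 b.1))⟩

/-- The automorphisms of the trivial torsor change a cocycle by a coboundary. -/
lemma isHom_mulIso_iff {b : G ⟶ F} {a a' : G ⊗ G ⟶ F} :
    IsHom (Torsor.mulIso b) ((Multiplication.trivial J F G).twist a)
      ((Multiplication.trivial J F G).twist a') ↔ a' = a * hd1 G F b := by
  have key : ∀ ⦃Y : C⦄ (s t : (Torsor.trivial J F G).At Y),
      (Torsor.mulIso b).toEquiv (((Multiplication.trivial J F G).twist a).mul s t) =
        ((Multiplication.trivial J F G).twist a').mul ((Torsor.mulIso b).toEquiv s)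
          ((Torsor.mulIso b).toEquiv t) ↔
      lift s.down.2 t.down.2 ≫ a' = lift s.down.2 t.down.2 ≫ (a * hd1 G F b) := by
    intro Y s t
    have h : (Torsor.mulIso b).toEquiv (((Multiplication.trivial J F G).twist a).mul s t) =
        ((Multiplication.trivial J F G).twist a').mul ((Torsor.mulIso b).toEquiv s)
          ((Torsor.mulIso b).toEquiv t) ↔
        ((s.down.2 * t.down.2) ≫ b) * ((lift s.down.2 t.down.2 ≫ a)⁻¹ *
          (s.down.1 * t.down.1)) = (lift s.down.2 t.down.2 ≫ a')⁻¹ *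
          (((s.down.2 ≫ b) * s.down.1) * ((t.down.2 ≫ b) * t.down.1)) :=
      ⟨fun h => (Prod.ext_iff.1 (ULift.up_injective h)).1,
        fun h => ULift.ext _ _ (Prod.ext h rfl)⟩
    rw [h, MonObj.comp_mul, comp_hd1]
    generalize lift s.down.2 t.down.2 ≫ a = x
    generalize lift s.down.2 t.down.2 ≫ a' = x'
    generalize (s.down.2 * t.down.2) ≫ b = z
    generalize s.down.2 ≫ b = z₀
    generalize t.down.2 ≫ b = z₁
    -- The F-coordinates of s and t occur identically on both sides and cancel, leaving a relation
    -- between a, a' and the three values of b that make up d¹b.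
    rw [eq_inv_mul_iff_mul_eq, ← mul_left_inj (s.down.1 * t.down.1)⁻¹,
      show x' * (z * (x⁻¹ * (s.down.1 * t.down.1))) * (s.down.1 * t.down.1)⁻¹ = x' * (z * x⁻¹) by
        group,
      show z₀ * s.down.1 * (z₁ * t.down.1) * (s.down.1 * t.down.1)⁻¹ = z₀ * z₁ by
        rw [mul_mul_mul_comm, mul_inv_cancel_right],
      ← eq_mul_inv_iff_mul_eq, mul_inv, inv_inv]
    refine Eq.congr_right ?_
    ac_rfl
  constructor
  · intro h
    -- The unit sections over the two projections form the universal pair: their point of G² is the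
    -- identity.
    have := (key ⟨(1, fst G G)⟩ ⟨(1, snd G G)⟩).1 (h _ _)
    rwa [lift_fst_snd, Category.id_comp, Category.id_comp] at this
  · rintro rfl Y s t
    exact (key s t).2 rfl

lemma isHom_congr {T T' : Torsor J F G} {φ ψ : Torsor.Iso T T'} {M : Multiplication T}
    {M' : Multiplication T'} (h : ∀ (Y : C) (t : T.At Y), φ.toEquiv t = ψ.toEquiv t)
    (hφ : IsHom φ M M') : IsHom ψ M M' := fun Y s t => by
  rw [← h, ← h, ← h, hφ]

/-- The trivial extension has cocycle 1. An isomorphism with it is a multiplicative automorphism of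
F_G, that is, multiplication by some b in F(G), and such an automorphism changes cocycles by d¹b. -/
lemma ofCocycleHom_eq_one_iff (a : (hd2 G F).ker) :
    ofCocycleHom J F G a = 1 ↔ (a : G ⊗ G ⟶ F) ∈ (hd1 G F).range := by
  have h0 : IsHom (CentralExt.trivialTorsor J F G) (CentralExt.trivial J F G).multiplication
      ((Multiplication.trivial J F G).twist 1) := fun Y s t => by
    rw [Torsor.Multiplication.twist_mul, MonObj.comp_one, inv_one, Torsor.one_act]
    rfl
  rw [one_eq]
  refine Iff.trans (mk_eq_mk_toExt_iff (E := CentralExt.trivial J F G)) ?_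
  constructor
  · rintro ⟨φ, hφ⟩
    obtain ⟨b, hb⟩ := Torsor.exists_mulIso ((CentralExt.trivialTorsor J F G).symm.trans φ)
    have := isHom_mulIso_iff.1 (isHom_congr hb (h0.symm.trans hφ))
    exact ⟨b, by rw [this, one_mul]⟩
  · rintro ⟨b, hb⟩
    exact ⟨_, h0.trans (isHom_mulIso_iff.2 ((one_mul (hd1 G F b)).trans hb).symm)⟩

variable (J F G) in
/-- The homomorphism from Hochschild cohomology to extensions. -/
def ofHH2 : HH2 G F →* Ext J F G :=
  QuotientGroup.lift _ (ofCocycleHom J F G) fun a ha =>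
    (ofCocycleHom_eq_one_iff a).2 (Subgroup.mem_subgroupOf.1 ha)

/-- The twist by a of the product group presents the datum (F_G, a · τ₀), so corresponding to this
datum means being isomorphic to the extension built from a. -/
lemma ofHH2_eq_iff {a : G ⊗ G ⟶ F} (ha : a ∈ (hd2 G F).ker) (E : CentralExt J F G) :
    ofHH2 J F G (QuotientGroup.mk ⟨a, ha⟩) = mk E ↔
      E.Corresponds (Torsor.trivial J F G)
        ((Torsor.mulIso a).trans (Torsor.delta1Trivial J F G)) := by
  rw [CentralExt.corresponds_iff (Torsor.Multiplication.trivial_presents.twist a)]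
  exact mk_eq_mk_toExt_iff

lemma ofHH2_injective : Function.Injective (ofHH2 J F G) := by
  refine (injective_iff_map_eq_one _).2 fun x => ?_
  induction x using QuotientGroup.induction_on with
  | H a =>
    intro h
    exact (QuotientGroup.eq_one_iff a).2
      (Subgroup.mem_subgroupOf.2 ((ofCocycleHom_eq_one_iff (J := J) a).1 h))

end Ext

/-! ### The homomorphisms β and ξ, and exactness -/

section K

open TorsExt.Torsor (Multiplication)

/-- Membership in the kernel means that δ¹T is trivial, and its trivialisations are the products on
T. -/
lemma mem_K_iff {T : Torsor J F G} : H1.mk T ∈ K J F G ↔ Nonempty (Multiplication T) := by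
  have h : H1.mk T ∈ K J F G ↔ Nonempty (Torsor.Iso (Torsor.trivial J F (G ⊗ G))
      (Torsor.delta1 T)) := by
    refine Iff.trans ?_ (H1.mk_eq (T := Torsor.trivial J F (G ⊗ G)) (T' := Torsor.delta1 T))
    exact eq_comm
  rw [h]
  exact ⟨fun ⟨τ⟩ => ⟨(Torsor.Multiplication.exists_of_trivialisation τ).choose⟩,
    fun ⟨M⟩ => ⟨M.exists_trivialisation.choose⟩⟩

variable (J F G) in
/-- The homomorphism sending an extension to its torsor. -/
def Ext.toK : Ext J F G →* K J F G where
  toFun := Quotient.lift (fun E => ⟨H1.mk E.torsor, mem_K_iff.2 ⟨E.multiplication⟩⟩)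
    fun _ _ ⟨φ⟩ => Subtype.ext (H1.sound φ.torsor)
  map_one' := Subtype.ext (H1.sound (CentralExt.trivialTorsor J F G))
  map_mul' := by
    rintro ⟨E⟩ ⟨E'⟩
    exact Subtype.ext (H1.sound (CentralExt.baerTorsor E E'))

lemma Ext.coe_toK_mk (E : CentralExt J F G) :
    (Ext.toK J F G (Ext.mk E) : H1 J F G) = H1.mk E.torsor := rfl

/-- The associator is obtained as u_τ for the trivialisation τ of the product, which spares a
separate gluing over G³. -/
lemma exists_isAssociator {T : Torsor J F G} (M : Multiplication T) :
    ∃ a, M.IsAssociator a := by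
  obtain ⟨τ, hτ⟩ := M.exists_trivialisation
  obtain ⟨a, ha⟩ := Torsor.Multiplication.exists_isObstruction T τ
  exact ⟨a, hτ.isAssociator ha⟩

/-- Well-definedness of ξ: neither the representing torsor nor the product on it matters, because
any two associators differ by some d²u. -/
lemma exists_obstruction_class (k : K J F G) : ∃ c : HH3 G F, ∀ (T : Torsor J F G)
    (M : Multiplication T) (a : G ⊗ G ⊗ G ⟶ F) (ha : M.IsAssociator a), H1.mk T = k →
      c = QuotientGroup.mk ⟨a, ha.mem_ker⟩ := by
  obtain ⟨k, hk⟩ := k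
  induction k using H1.ind with
  | h T =>
    obtain ⟨M⟩ := mem_K_iff.1 hk
    obtain ⟨a, ha⟩ := exists_isAssociator M
    refine ⟨QuotientGroup.mk ⟨a, ha.mem_ker⟩, fun T' M' a' ha' e => ?_⟩
    obtain ⟨φ⟩ := H1.mk_eq.1 e.symm
    obtain ⟨u, rfl⟩ := ha.exists_eq_mul_hd2 φ ha'
    refine QuotientGroup.eq.2 (Subgroup.mem_subgroupOf.2 ⟨u, ?_⟩)
    exact (inv_mul_cancel_left a _).symm

/-- The class of the associator of a multiplication on a torsor representing an element of `K`. -/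
def obstructionClass (k : K J F G) : HH3 G F := (exists_obstruction_class k).choose

lemma obstructionClass_eq {k : K J F G} {T : Torsor J F G} {M : Multiplication T}
    {a : G ⊗ G ⊗ G ⟶ F} (ha : M.IsAssociator a) (h : H1.mk T = k) :
    obstructionClass k = QuotientGroup.mk ⟨a, ha.mem_ker⟩ :=
  (exists_obstruction_class k).choose_spec T M a ha h

variable (J F G) in
/-- The homomorphism sending the class of a torsor to the class of its associator. -/
def obstructionHom : K J F G →* HH3 G F :=
  MonoidHom.mk' obstructionClass fun k k' => by
    obtain ⟨k, hk⟩ := k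
    obtain ⟨k', hk'⟩ := k'
    induction k using H1.ind with
    | h T =>
    induction k' using H1.ind with
    | h T' =>
      obtain ⟨M⟩ := mem_K_iff.1 hk
      obtain ⟨M'⟩ := mem_K_iff.1 hk'
      obtain ⟨a, ha⟩ := exists_isAssociator M
      obtain ⟨a', ha'⟩ := exists_isAssociator M'
      -- The class of T ⊗ T' may be computed with the contracted product of the two chosen products,
      -- whose associator is aa'.
      exact (obstructionClass_eq (ha.tensor ha') rfl).trans
        (congrArg₂ (· * ·) (obstructionClass_eq (k := ⟨H1.mk T, hk⟩) ha rfl)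
          (obstructionClass_eq (k := ⟨H1.mk T', hk'⟩) ha' rfl)).symm

lemma obstructionHom_apply {T : Torsor J F G} (hT : H1.mk T ∈ K J F G) {M : Multiplication T}
    {a : G ⊗ G ⊗ G ⟶ F} (ha : M.IsAssociator a) :
    obstructionHom J F G ⟨H1.mk T, hT⟩ = QuotientGroup.mk ⟨a, ha.mem_ker⟩ :=
  obstructionClass_eq ha rfl

/-- When the torsor of E is trivial, the group law of E can be carried to F_G, where it is a twist
of the product group by some u. As both are associative, u is a cocycle, and E comes from it.
Conversely, extensions built from cocycles live on F_G. -/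
lemma ofHH2_mulExact_toK : Function.MulExact (Ext.ofHH2 J F G) (Ext.toK J F G) := by
  intro x
  induction x using Quotient.inductionOn with
  | h E =>
  change Ext.toK J F G (Ext.mk E) = 1 ↔ Ext.mk E ∈ _
  have h : Ext.toK J F G (Ext.mk E) = 1 ↔
      Nonempty (Torsor.Iso E.torsor (Torsor.trivial J F G)) := by
    rw [← H1.mk_eq]
    exact Subtype.ext_iff
  rw [h]
  constructor
  · rintro ⟨φ⟩
    obtain ⟨u, hu⟩ := Torsor.Multiplication.exists_eq_twist (Multiplication.trivial J F G)
      (E.multiplication.map φ)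
    have hφ := Torsor.Multiplication.isHom_map φ E.multiplication
    rw [hu] at hφ
    have h1 := hφ.isAssociator E.multiplication_isAssociator
    have h2 := (Torsor.Multiplication.trivial_isAssociator (J := J) (F := F) (G := G)).twist u
    have hu : u ∈ (hd2 G F).ker := by
      rw [MonoidHom.mem_ker, ← one_mul (hd2 G F u)]
      -- Both 1 · d²u and 1 are associators of the transported product.
      exact h2.unique h1
    exact ⟨QuotientGroup.mk ⟨u, hu⟩, Ext.mk_eq_mk_toExt_iff.2 ⟨φ, hφ⟩⟩
  · rintro ⟨y, hy⟩
    induction y using QuotientGroup.induction_on with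
    | H a =>
      obtain ⟨φ, -⟩ := Ext.mk_eq_mk_toExt_iff.1 hy
      exact ⟨φ⟩

/-- If the associator is d²u, twisting the product by u⁻¹ makes it associative, which yields an
extension with the given torsor. Conversely the group law of an extension is a product with
associator 1, so its obstruction vanishes. -/
lemma toK_mulExact_obstructionHom :
    Function.MulExact (Ext.toK J F G) (obstructionHom J F G) := by
  rintro ⟨k, hk⟩
  induction k using H1.ind with
  | h T =>
  constructor
  · intro h
    obtain ⟨M⟩ := mem_K_iff.1 hk
    obtain ⟨a, ha⟩ := exists_isAssociator M
    rw [obstructionHom_apply hk ha, QuotientGroup.eq_one_iff, Subgroup.mem_subgroupOf] at h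
    obtain ⟨u, hu⟩ := h
    have h1 := ha.twist u⁻¹
    rw [map_inv, hu, mul_inv_cancel] at h1
    exact ⟨Ext.mk ((M.twist u⁻¹).toExt h1), Subtype.ext (H1.sound (Multiplication.toExtTorsor _ h1))⟩
  · rintro ⟨x, hx⟩
    induction x using Quotient.inductionOn with
    | h E =>
    rw [← hx]
    exact (obstructionClass_eq E.multiplication_isAssociator rfl).trans
      ((QuotientGroup.eq_one_iff _).2 (one_mem _))

end K

end

end TorsExt
-- The exact sequence on the fppf site
theorem theorem2 {S : AlgebraicGeometry.Scheme.{u}} (G F : Over S) [GrpObj G] [GrpObj F]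
    [IsCommMonObj F] [AlgebraicGeometry.IsAffineHom F.hom] [AlgebraicGeometry.Flat F.hom]
    [AlgebraicGeometry.LocallyOfFinitePresentation F.hom] :
    ∃ (α : TorsExt.HH2 G F →* TorsExt.Ext (TorsExt.fppf S) F G)
      (β : TorsExt.Ext (TorsExt.fppf S) F G →* TorsExt.K (TorsExt.fppf S) F G)
      (ξ : TorsExt.K (TorsExt.fppf S) F G →* TorsExt.HH3 G F),
      -- `α` sends the class of `a` to the extension given by the datum `(F_G, a · τ₀)`
      (∀ (a : G ⊗ G ⟶ F) (ha : a ∈ (TorsExt.hd2 G F).ker)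
        (E : TorsExt.CentralExt (TorsExt.fppf S) F G),
        α (QuotientGroup.mk ⟨a, ha⟩) = TorsExt.Ext.mk E ↔
          E.Corresponds (TorsExt.Torsor.trivial (TorsExt.fppf S) F G)
            ((TorsExt.Torsor.mulIso a).trans
              (TorsExt.Torsor.delta1Trivial (TorsExt.fppf S) F G))) ∧
      -- `β` sends the class of `E` to the class of the torsor `E → G`
      (∀ E : TorsExt.CentralExt (TorsExt.fppf S) F G,
        (β (TorsExt.Ext.mk E) : TorsExt.H1 (TorsExt.fppf S) F G) = TorsExt.H1.mk E.torsor) ∧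
      -- `ξ` sends the class of `T` to the class of `u_τ`, for every trivialisation `τ` of `δ¹ T`
      (∀ (T : TorsExt.Torsor (TorsExt.fppf S) F G)
        (hT : TorsExt.H1.mk T ∈ TorsExt.K (TorsExt.fppf S) F G)
        (τ : TorsExt.Torsor.Iso (TorsExt.Torsor.trivial (TorsExt.fppf S) F (G ⊗ G))
          (TorsExt.Torsor.delta1 T)),
        ∃ a : G ⊗ G ⊗ G ⟶ F, TorsExt.Torsor.IsObstruction T τ a ∧
          ∃ ha : a ∈ (TorsExt.hd3 G F).ker,
            ξ ⟨TorsExt.H1.mk T, hT⟩ = QuotientGroup.mk ⟨a, ha⟩) ∧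
      Function.Injective α ∧ Function.MulExact α β ∧ Function.MulExact β ξ := by
  refine ⟨TorsExt.Ext.ofHH2 _ F G, TorsExt.Ext.toK _ F G, TorsExt.obstructionHom _ F G,
    fun a ha E => TorsExt.Ext.ofHH2_eq_iff ha E, TorsExt.Ext.coe_toK_mk, fun T hT τ => ?_,
    TorsExt.Ext.ofHH2_injective, TorsExt.ofHH2_mulExact_toK, TorsExt.toK_mulExact_obstructionHom⟩
  -- The class ξ(T) can be computed from any product on T. Choosing the one that comes from the
  -- given τ makes u_τ its associator, which shows at once that u_τ is a cocycle and represents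
  -- ξ(T).
  obtain ⟨M, hM⟩ := TorsExt.Torsor.Multiplication.exists_of_trivialisation τ
  obtain ⟨a, ha⟩ := TorsExt.Torsor.Multiplication.exists_isObstruction T τ
  have h := hM.isAssociator ha
  exact ⟨a, ha, h.mem_ker, TorsExt.obstructionHom_apply hT h⟩
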